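/- Fix real numbers $\omega>0$ and $\hbar>0$. For a non-empty open interval $I\subseteq\mathbb R$ (bounded or not) let $C_c^\infty(I)$ be the space of complex-valued smooth functions with compact support in $I$, and write $\langle f,g\rangle=\int_{\mathbb R} f(t)g(t)\,dt$. **Prefactorization algebras.** A prefactorization algebra $\mathfrak F$ on $\mathbb R$ assigns to every non-empty open interval $U$ a cochain complex of complex vector spaces $\mathfrak F(U)$, to every inclusion $U\subseteq V$ a chain map $m_U^V:\mathfrak F(U)\to\mathfrak F(V)$, and to all disjoint $U_1,U_2\subseteq V$ a chain map $m_{U_1,U_2}^V:\mathfrak F(U_1)\otimes\mathfrak F(U_2)\to\mathfrak F(V)$, such that: $m_V^V=\mathrm{id}$ and $m_V^W m_U^V=m_U^W$; $m_V^W\circ m_{U_1,U_2}^V=m_{U_1,U_2}^W$; $m_{V_1,V_2}^W\circ(m_{U_1}^{V_1}\otimes m_{U_2}^{V_2})=m_{U_1,U_2}^W$ when $U_i\subseteq V_i\subseteq W$, $V_1\cap V_2=\emptyset$; $m_{V_1,U_3}^W\circ(m_{U_1,U_2}^{V_1}\otimes\mathrm{id})=m_{U_1,V_2}^W\circ(\mathrm{id}\otimes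 m_{U_2,U_3}^{V_2})$ whenever $U_1,U_2\subseteq V_1\subseteq W$ and $U_2,U_3\subseteq V_2\subseteq W$ with $U_1\cap U_2=U_2\cap U_3=V_1\cap U_3=U_1\cap V_2=\emptyset$; and $m_{U_1,U_2}^V(a,b)=(-1)^{|a||b|}m_{U_2,U_1}^V(b,a)$ for homogeneous $a,b$. A morphism $R:\mathfrak F\to\mathfrak G$ is a family of chain maps $R_U:\mathfrak F(U)\to\mathfrak G(U)$ commuting with all maps $m_U^V$ and $m_{U_1,U_2}^V$; it is a quasi-isomorphism if every $R_U$ induces an isomorphism on cohomology. **The off-shell algebra $\mathfrak F_{\rm BV}$.** Let $\mathrm{Obs}^q(I)$ be the graded symmetric algebra on two copies of $C_c^\infty(I)$, one in degree $-1$ and one in degree $0$, with product written $\wedge$, and with differential $d+\Delta$. Here $d$ is the graded derivation with $dg=\ddot g+\omega^2 g$ (of degree $0$) for $g$ of degree $-1$ and $df=0$ for $f$ of degree $0$; and $$\Delta(x_1\wedge\dots\wedge x_n)=\sum_{i<j}\pm\,\Delta(x_i\wedge x_j)\,x_1\wedge\dots\widehat{x_i}\dots\widehat{x_j}\dots\wedge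 x_n ,$$ with the Koszul sign of moving $x_i,x_j$ to the front, where $\Delta(f\wedge g)=i\hbar\langle f,g\rangle$ for $f$ of degree $0$ and $g$ of degree $-1$, and $\Delta$ vanishes on two letters of equal degree. Set $\mathfrak F_{\rm BV}(I)=\mathrm{Obs}^q(I)$, let $m_I^J$ be extension by zero of every letter, and $m_{I_1,I_2}^J(F_1,F_2)=m_{I_1}^J(F_1)\wedge m_{I_2}^J(F_2)$. **The Weyl algebra $\mathfrak F_{\rm Weyl}$.** Let $\mathfrak F_{\rm Weyl}(I)=\mathbb C[a,a^\dagger]$, in degree $0$ with zero differential, let $m_I^J=\mathrm{id}$, and $$\mu(F,G)=\sum_{n\ge0}\frac1{n!}\,\frac{\partial^nF}{\partial a^n}\,\frac{\partial^nG}{\partial (a^\dagger)^n},\qquad m_{I_1,I_2}^J(F,G)=\begin{cases}\mu(G,F)& I_1<I_2,\\ \mu(F,G)& I_1>I_2,\end{cases}$$ where $I_1<I_2$ means $t<s$ for all $t\in I_1$, $s\in I_2$. **The projection.** Let $\sigma_\pm(t)=\sqrt{\hbar/2\omega}\;e^{\mp i\omega t}$. Let $\Pi_0:\mathrm{Obs}^q(I)\to\mathbb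 C[a,a^\dagger]$ be the algebra morphism with $\Pi_0(f)=\langle f,\sigma_+\rangle a+\langle f,\sigma_-\rangle a^\dagger$ on letters of degree $0$ and $\Pi_0=0$ on letters of degree $-1$. With the Feynman propagator $h(f)(t)=\frac{i}{2\omega}\int_{\mathbb R} e^{-i\omega|t-s|}f(s)\,ds$ put $C(f_1\wedge f_2)=i\hbar\langle f_1,h(f_2)\rangle$ for $f_1,f_2$ of degree $0$, $C=0$ on two letters not both of degree $0$, and extend $C$ to words as a sum over pairs of letters, as for $\Delta$. The operator $C$ is locally nilpotent, so $\Pi_I=\Pi_0\circ e^{-C}$ is defined. **Theorem.** $\mathfrak F_{\rm BV}$ and $\mathfrak F_{\rm Weyl}$ are prefactorization algebras on $\mathbb R$, and the family of maps $\Pi_I:\mathfrak F_{\rm BV}(I)\to\mathfrak F_{\rm Weyl}(I)$, over the non-empty open intervals $I\subseteq\mathbb R$, is a quasi-isomorphism of prefactorization algebras. -/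

import Mathlib

open TopologicalSpace CategoryTheory
open scoped TensorProduct

noncomputable section

namespace HarmonicOscillator

/-! ### Exponential of a locally nilpotent operator -/

section LocExp

variable {M : Type*} [AddCommGroup M] [Module ℂ M]

/-- Every vector is killed by some power of `D`. -/
def LocallyNilpotent (D : Module.End ℂ M) : Prop := ∀ x, ∃ n : ℕ, (D ^ n) x = 0

theorem pow_apply_eq_zero_of_le {D : Module.End ℂ M} {x : M} {m n : ℕ} (hmn : m ≤ n)
    (h : (D ^ m) x = 0) : (D ^ n) x = 0 := by
  obtain ⟨k, rfl⟩ := Nat.exists_eq_add_of_le' hmn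
  rw [pow_add, Module.End.mul_apply, h, map_zero]

theorem exists_pow_add {D : Module.End ℂ M} {x y : M}
    (hx : ∃ n : ℕ, (D ^ n) x = 0) (hy : ∃ n : ℕ, (D ^ n) y = 0) :
    ∃ n : ℕ, (D ^ n) (x + y) = 0 := by
  obtain ⟨m, hm⟩ := hx
  obtain ⟨n, hn⟩ := hy
  refine ⟨max m n, ?_⟩
  rw [map_add, pow_apply_eq_zero_of_le (le_max_left m n) hm,
    pow_apply_eq_zero_of_le (le_max_right m n) hn, add_zero]

theorem finsum_exp_eq {D : Module.End ℂ M} {x : M} {N : ℕ} (h : (D ^ N) x = 0) :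
    ∑ᶠ n : ℕ, ((n.factorial : ℂ)⁻¹) • (D ^ n) x =
      ∑ n ∈ Finset.range N, ((n.factorial : ℂ)⁻¹) • (D ^ n) x := by
  refine finsum_eq_sum_of_support_subset _ fun n hn => ?_
  by_contra hlt
  simp only [Finset.coe_range, Set.mem_Iio, not_lt] at hlt
  exact hn (by simp [pow_apply_eq_zero_of_le hlt h])

/-- `exp D = ∑ₙ Dⁿ / n!` for a locally nilpotent operator `D`
(on each vector the sum is finite). -/
def locExp (D : Module.End ℂ M) (hD : LocallyNilpotent D) : M →ₗ[ℂ] M where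
  toFun x := ∑ᶠ n : ℕ, ((n.factorial : ℂ)⁻¹) • (D ^ n) x
  map_add' x y := by
    obtain ⟨a, ha⟩ := hD x
    obtain ⟨b, hb⟩ := hD y
    have ha' := pow_apply_eq_zero_of_le (le_max_left a b) ha
    have hb' := pow_apply_eq_zero_of_le (le_max_right a b) hb
    have hab : (D ^ max a b) (x + y) = 0 := by rw [map_add, ha', hb', add_zero]
    rw [finsum_exp_eq ha', finsum_exp_eq hb', finsum_exp_eq hab, ← Finset.sum_add_distrib]
    simp
  map_smul' c x := by
    obtain ⟨a, ha⟩ := hD x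
    have hca : (D ^ a) (c • x) = 0 := by rw [map_smul, ha, smul_zero]
    rw [finsum_exp_eq ha, finsum_exp_eq hca, RingHom.id_apply, Finset.smul_sum]
    refine Finset.sum_congr rfl fun n _ => ?_
    rw [map_smul, smul_comm]

end LocExp

/-! ### Differential graded vector spaces

A ℤ-graded complex vector space with an operator `d`; the axioms of a cochain complex are the
predicate `IsComplex`. -/

structure DGSpace where
  carrier : Type
  [addCommGroup : AddCommGroup carrier]
  [module : Module ℂ carrier]
  /-- the homogeneous elements of degree `n` -/
  deg : ℤ → Submodule ℂ carrier
  d : carrier →ₗ[ℂ] carrier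

attribute [instance] DGSpace.addCommGroup DGSpace.module

namespace DGSpace

instance : CoeSort DGSpace Type := ⟨DGSpace.carrier⟩

/-- `E` is the direct sum of its homogeneous parts, and `d` is a differential of degree `1`. -/
structure IsComplex (E : DGSpace) : Prop where
  internal : DirectSum.IsInternal E.deg
  d_mem : ∀ n : ℤ, ∀ x ∈ E.deg n, E.d x ∈ E.deg (n + 1)
  d_d : ∀ x, E.d (E.d x) = 0

/-- A linear map of degree `0` that commutes with the differentials. -/
structure IsChainMap {E F : DGSpace} (R : E →ₗ[ℂ] F) : Prop where
  map_mem : ∀ n : ℤ, ∀ x ∈ E.deg n, R x ∈ F.deg n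
  map_d : ∀ x, R (E.d x) = F.d (R x)

/-- The associated cochain complex `⋯ → E^n → E^(n+1) → ⋯` of complex vector spaces. -/
def IsComplex.toCochainComplex {E : DGSpace} (hE : E.IsComplex) :
    CochainComplex (ModuleCat ℂ) ℤ :=
  CochainComplex.of (fun n => ModuleCat.of ℂ (E.deg n))
    (fun n => ModuleCat.ofHom (E.d.restrict (hE.d_mem n)))
    (fun _ => ModuleCat.hom_ext (LinearMap.ext fun x => Subtype.ext (hE.d_d x.1)))

/-- The morphism of cochain complexes given by a chain map. -/
def IsChainMap.toHom {E F : DGSpace} {R : E →ₗ[ℂ] F} (hR : IsChainMap R)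
    (hE : E.IsComplex) (hF : F.IsComplex) : hE.toCochainComplex ⟶ hF.toCochainComplex :=
  CochainComplex.ofHom
    (fun n => ModuleCat.ofHom (R.restrict (hR.map_mem n)))
    (fun n => by
      dsimp only [IsComplex.toCochainComplex]
      rw [CochainComplex.of_d, CochainComplex.of_d]
      exact ModuleCat.hom_ext (LinearMap.ext fun x => Subtype.ext (hR.map_d x.1).symm))

/-- `R` is a chain map between complexes that induces isomorphisms on cohomology. -/
def IsQuasiIso {E F : DGSpace} (R : E →ₗ[ℂ] F) : Prop :=
  ∃ (hE : E.IsComplex) (hF : F.IsComplex) (hR : IsChainMap R),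
    _root_.QuasiIso (hR.toHom hE hF)

end DGSpace

/-! ### Prefactorization algebras -/

/-- The connected (in particular nonempty) open subsets of `X`. For `X = ℝ` these are the nonempty
open intervals, bounded or not. -/
abbrev ConnectedOpens (X : Type*) [TopologicalSpace X] : Type _ :=
  {U : Opens X // IsConnected (U : Set X)}

/-- The data of a prefactorization algebra with values in complexes; the axioms are
`IsPrefactorizationAlgebra`. -/
structure PrefactorizationData (X : Type*) [TopologicalSpace X] where
  obj : ConnectedOpens X → DGSpace
  incl : ∀ {U V : ConnectedOpens X}, U ≤ V → (obj U →ₗ[ℂ] obj V)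
  prod : ∀ {U₁ U₂ V : ConnectedOpens X}, Disjoint U₁.1 U₂.1 → U₁ ≤ V → U₂ ≤ V →
    (obj U₁ →ₗ[ℂ] obj U₂ →ₗ[ℂ] obj V)

structure IsPrefactorizationAlgebra {X : Type*} [TopologicalSpace X]
    (F : PrefactorizationData X) : Prop where
  isComplex : ∀ U, (F.obj U).IsComplex
  incl_isChainMap : ∀ {U V : ConnectedOpens X} (h : U ≤ V), DGSpace.IsChainMap (F.incl h)
  /-- the product is a chain map `F(U₁) ⊗ F(U₂) → F(V)`: it has degree `0` … -/
  prod_mem : ∀ {U₁ U₂ V : ConnectedOpens X} (h : Disjoint U₁.1 U₂.1) (h₁ : U₁ ≤ V) (h₂ : U₂ ≤ V)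
    (p q : ℤ), ∀ a ∈ (F.obj U₁).deg p, ∀ b ∈ (F.obj U₂).deg q,
      F.prod h h₁ h₂ a b ∈ (F.obj V).deg (p + q)
  /-- … and commutes with the differentials -/
  prod_d : ∀ {U₁ U₂ V : ConnectedOpens X} (h : Disjoint U₁.1 U₂.1) (h₁ : U₁ ≤ V) (h₂ : U₂ ≤ V)
    (p : ℤ), ∀ a ∈ (F.obj U₁).deg p, ∀ b,
      (F.obj V).d (F.prod h h₁ h₂ a b) =
        F.prod h h₁ h₂ ((F.obj U₁).d a) b +
          ((-1 : ℂ) ^ p) • F.prod h h₁ h₂ a ((F.obj U₂).d b)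
  incl_refl : ∀ (V : ConnectedOpens X) (a : F.obj V), F.incl (le_refl V) a = a
  incl_incl : ∀ {U V W : ConnectedOpens X} (h : U ≤ V) (h' : V ≤ W) (a : F.obj U),
    F.incl h' (F.incl h a) = F.incl (h.trans h') a
  incl_prod : ∀ {U₁ U₂ V W : ConnectedOpens X} (h : Disjoint U₁.1 U₂.1) (h₁ : U₁ ≤ V)
    (h₂ : U₂ ≤ V) (h' : V ≤ W) (a : F.obj U₁) (b : F.obj U₂),
    F.incl h' (F.prod h h₁ h₂ a b) = F.prod h (h₁.trans h') (h₂.trans h') a b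
  prod_incl : ∀ {U₁ U₂ V₁ V₂ W : ConnectedOpens X} (hU : Disjoint U₁.1 U₂.1)
    (hV : Disjoint V₁.1 V₂.1) (h₁ : U₁ ≤ V₁) (h₂ : U₂ ≤ V₂) (h₁' : V₁ ≤ W) (h₂' : V₂ ≤ W)
    (a : F.obj U₁) (b : F.obj U₂),
    F.prod hV h₁' h₂' (F.incl h₁ a) (F.incl h₂ b) =
      F.prod hU (h₁.trans h₁') (h₂.trans h₂') a b
  assoc : ∀ {U₁ U₂ U₃ V₁ V₂ W : ConnectedOpens X}
    (h₁₂ : Disjoint U₁.1 U₂.1) (h₂₃ : Disjoint U₂.1 U₃.1)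
    (hV₁ : Disjoint V₁.1 U₃.1) (hV₂ : Disjoint U₁.1 V₂.1)
    (u₁ : U₁ ≤ V₁) (u₂ : U₂ ≤ V₁) (u₂' : U₂ ≤ V₂) (u₃ : U₃ ≤ V₂)
    (v₁ : V₁ ≤ W) (v₂ : V₂ ≤ W) (w₁ : U₁ ≤ W) (w₃ : U₃ ≤ W)
    (a : F.obj U₁) (b : F.obj U₂) (c : F.obj U₃),
    F.prod hV₁ v₁ w₃ (F.prod h₁₂ u₁ u₂ a b) c = F.prod hV₂ w₁ v₂ a (F.prod h₂₃ u₂' u₃ b c)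
  comm : ∀ {U₁ U₂ V : ConnectedOpens X} (h : Disjoint U₁.1 U₂.1) (h₁ : U₁ ≤ V) (h₂ : U₂ ≤ V)
    (p q : ℤ), ∀ a ∈ (F.obj U₁).deg p, ∀ b ∈ (F.obj U₂).deg q,
      F.prod h h₁ h₂ a b = ((-1 : ℂ) ^ (p * q)) • F.prod h.symm h₂ h₁ b a

/-- A morphism of prefactorization algebras: a family of chain maps that commutes with the
inclusions and with the products. -/
structure IsMorphism {X : Type*} [TopologicalSpace X] (F G : PrefactorizationData X)
    (R : ∀ U : ConnectedOpens X, F.obj U →ₗ[ℂ] G.obj U) : Prop where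
  isChainMap : ∀ U, DGSpace.IsChainMap (R U)
  map_incl : ∀ {U V : ConnectedOpens X} (h : U ≤ V) (a : F.obj U),
    R V (F.incl h a) = G.incl h (R U a)
  map_prod : ∀ {U₁ U₂ V : ConnectedOpens X} (h : Disjoint U₁.1 U₂.1) (h₁ : U₁ ≤ V)
    (h₂ : U₂ ≤ V) (a : F.obj U₁) (b : F.obj U₂),
    R V (F.prod h h₁ h₂ a b) = G.prod h h₁ h₂ (R U₁ a) (R U₂ b)

/-- A quasi-isomorphism of prefactorization algebras: a morphism each component of which is a
quasi-isomorphism. -/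
structure IsQuasiIsomorphism {X : Type*} [TopologicalSpace X] (F G : PrefactorizationData X)
    (R : ∀ U : ConnectedOpens X, F.obj U →ₗ[ℂ] G.obj U) : Prop
    extends IsMorphism F G R where
  isQuasiIso : ∀ U, DGSpace.IsQuasiIso (R U)

/-! ### Graded symmetric algebras

For a graded vector space with even part `V` and odd part `V'`, the graded symmetric algebra is
`Sym(V) ⊗ Λ(V')`: the element `(f₁ ⋯ fₘ) ⊗ (g₁ ∧ ⋯ ∧ gₖ)` is the word
`f₁ ∧ ⋯ ∧ fₘ ∧ g₁ ∧ ⋯ ∧ gₖ`. As `Sym(V)` is even, the graded product is the usual product of the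
tensor product of two algebras. -/

section GradedSym

variable {V : Type*} [AddCommGroup V] [Module ℂ V]

/-- The projection of `Sym V` to its linear part. -/
def linearPart : SymmetricAlgebra ℂ V →ₗ[ℂ] V :=
  letI : Module ℂᵐᵒᵖ V := Module.compHom V ((RingHom.id ℂ).fromOpposite mul_comm)
  haveI : IsCentralScalar ℂ V := ⟨fun _ _ => rfl⟩
  let φ : SymmetricAlgebra ℂ V →ₐ[ℂ] TrivSqZeroExt ℂ V :=
    SymmetricAlgebra.lift (TrivSqZeroExt.inrHom ℂ V)
  TrivSqZeroExt.sndHom ℂ V ∘ₗ φ.toLinearMap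

theorem linearPart_ι (v : V) : linearPart (SymmetricAlgebra.ι ℂ V v) = v := by
  let _ : Module ℂᵐᵒᵖ V := Module.compHom V ((RingHom.id ℂ).fromOpposite mul_comm)
  have : IsCentralScalar ℂ V := ⟨fun _ _ => rfl⟩
  simp [linearPart]

theorem linearPart_algebraMap (r : ℂ) : linearPart (V := V) (algebraMap ℂ _ r) = 0 := by
  let _ : Module ℂᵐᵒᵖ V := Module.compHom V ((RingHom.id ℂ).fromOpposite mul_comm)
  have : IsCentralScalar ℂ V := ⟨fun _ _ => rfl⟩
  simp only [linearPart, LinearMap.comp_apply, AlgHom.toLinearMap_apply, AlgHom.commutes]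
  rfl

theorem linearPart_mul (a b : SymmetricAlgebra ℂ V) :
    linearPart (a * b) =
      SymmetricAlgebra.algebraMapInv a • linearPart b +
        SymmetricAlgebra.algebraMapInv b • linearPart a := by
  let _ : Module ℂᵐᵒᵖ V := Module.compHom V ((RingHom.id ℂ).fromOpposite mul_comm)
  have : IsCentralScalar ℂ V := ⟨fun _ _ => rfl⟩
  have hfst : ∀ a : SymmetricAlgebra ℂ V,
      (SymmetricAlgebra.lift (TrivSqZeroExt.inrHom ℂ V) a : TrivSqZeroExt ℂ V).fst =
        SymmetricAlgebra.algebraMapInv a := by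
    intro a
    have h : (TrivSqZeroExt.fstHom ℂ ℂ V).comp (SymmetricAlgebra.lift (TrivSqZeroExt.inrHom ℂ V))
        = SymmetricAlgebra.algebraMapInv := by
      ext v
      simp [SymmetricAlgebra.algebraMapInv]
    exact DFunLike.congr_fun h a
  simp only [linearPart, LinearMap.comp_apply, AlgHom.toLinearMap_apply, map_mul,
    TrivSqZeroExt.sndHom_apply, TrivSqZeroExt.snd_mul, hfst]
  rfl

/-- `f₁ ⋯ fₘ ↦ ∑ᵢ fᵢ ⊗ (f₁ ⋯ f̂ᵢ ⋯ fₘ)`: the coproduct with `f ↦ f ⊗ 1 + 1 ⊗ f`, projected to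
the linear part of the first factor. -/
def peelSym : SymmetricAlgebra ℂ V →ₗ[ℂ] V ⊗[ℂ] SymmetricAlgebra ℂ V :=
  linearPart.rTensor _ ∘ₗ Coalgebra.comul

theorem peelSym_algebraMap (r : ℂ) : peelSym (V := V) (algebraMap ℂ _ r) = 0 := by
  rw [peelSym, LinearMap.comp_apply, Bialgebra.comul_algebraMap,
    Algebra.TensorProduct.algebraMap_apply, LinearMap.rTensor_tmul, linearPart_algebraMap,
    TensorProduct.zero_tmul]

theorem peelSym_ι (v : V) : peelSym (SymmetricAlgebra.ι ℂ V v) = v ⊗ₜ 1 := by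
  have h1 : linearPart (1 : SymmetricAlgebra ℂ V) = 0 := by
    rw [← map_one (algebraMap ℂ (SymmetricAlgebra ℂ V)), linearPart_algebraMap]
  rw [peelSym, LinearMap.comp_apply, SymmetricAlgebra.comul_ι, map_add, LinearMap.rTensor_tmul,
    LinearMap.rTensor_tmul, linearPart_ι, h1, TensorProduct.zero_tmul, add_zero]

/-- `peelSym` is a derivation. -/
theorem peelSym_mul (a b : SymmetricAlgebra ℂ V) :
    peelSym (a * b) = (LinearMap.mul ℂ (SymmetricAlgebra ℂ V) a).lTensor V (peelSym b) +
      (LinearMap.mul ℂ (SymmetricAlgebra ℂ V) b).lTensor V (peelSym a) := by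
  have key : ∀ x y : SymmetricAlgebra ℂ V ⊗[ℂ] SymmetricAlgebra ℂ V,
      linearPart.rTensor (SymmetricAlgebra ℂ V) (x * y) =
        (LinearMap.mul ℂ (SymmetricAlgebra ℂ V) ((TensorProduct.lid ℂ _)
          (SymmetricAlgebra.algebraMapInv.toLinearMap.rTensor _ x))).lTensor V
            (linearPart.rTensor _ y) +
        (LinearMap.mul ℂ (SymmetricAlgebra ℂ V) ((TensorProduct.lid ℂ _)
          (SymmetricAlgebra.algebraMapInv.toLinearMap.rTensor _ y))).lTensor V
            (linearPart.rTensor _ x) := by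
    intro x y
    induction x using TensorProduct.induction_on with
    | zero => simp [LinearMap.lTensor_zero]
    | add x x' hx hx' =>
      simp only [add_mul, map_add, hx, hx', LinearMap.lTensor_add,
        LinearMap.add_apply]
      abel
    | tmul p q =>
      induction y using TensorProduct.induction_on with
      | zero => simp [LinearMap.lTensor_zero]
      | add y y' hy hy' =>
        simp only [mul_add, map_add, hy, hy', LinearMap.lTensor_add,
          LinearMap.add_apply]
        abel
      | tmul p' q' =>
        simp only [Algebra.TensorProduct.tmul_mul_tmul, LinearMap.rTensor_tmul, linearPart_mul,
          TensorProduct.add_tmul, TensorProduct.lid_tmul, AlgHom.toLinearMap_apply,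
          LinearMap.lTensor_tmul, LinearMap.mul_apply', smul_mul_assoc,
          TensorProduct.tmul_smul, TensorProduct.smul_tmul']
        rw [mul_comm q q']
  have hcounit : ∀ a : SymmetricAlgebra ℂ V, (TensorProduct.lid ℂ _)
      (SymmetricAlgebra.algebraMapInv.toLinearMap.rTensor (SymmetricAlgebra ℂ V)
        (Coalgebra.comul (R := ℂ) a)) = a := by
    intro a
    have h := Coalgebra.rTensor_counit_comul (R := ℂ) a
    have h2 : (Coalgebra.counit (R := ℂ) : SymmetricAlgebra ℂ V →ₗ[ℂ] ℂ) =
        SymmetricAlgebra.algebraMapInv.toLinearMap := rfl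
    rw [← h2, h, TensorProduct.lid_tmul, one_smul]
  rw [peelSym, LinearMap.comp_apply, LinearMap.comp_apply, LinearMap.comp_apply,
    Bialgebra.comul_mul, key, hcounit, hcounit]

/-- `g₁ ∧ ⋯ ∧ gₖ ↦ ∑ⱼ (-1)^(j-1) gⱼ ⊗ (g₁ ∧ ⋯ ∧ ĝⱼ ∧ ⋯ ∧ gₖ)`, through the recursion
`peelExt (g ∧ x) = g ⊗ x - g ∧ peelExt x`. -/
def peelExt : ExteriorAlgebra ℂ V →ₗ[ℂ] V ⊗[ℂ] ExteriorAlgebra ℂ V :=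
  CliffordAlgebra.foldr' (0 : QuadraticForm ℂ V)
    (LinearMap.mk₂ ℂ
      (fun (g : V) (p : ExteriorAlgebra ℂ V × (V ⊗[ℂ] ExteriorAlgebra ℂ V)) =>
        g ⊗ₜ[ℂ] p.1 - (LinearMap.mul ℂ (ExteriorAlgebra ℂ V) (ExteriorAlgebra.ι ℂ g)).lTensor V p.2)
      (fun g g' p => by
        rw [map_add, map_add, LinearMap.lTensor_add, LinearMap.add_apply,
          TensorProduct.add_tmul]
        abel)
      (fun c g p => by
        rw [map_smul, map_smul, LinearMap.lTensor_smul, LinearMap.smul_apply,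
          smul_sub, TensorProduct.smul_tmul'])
      (fun g p p' => by
        rw [Prod.fst_add, Prod.snd_add, map_add, TensorProduct.tmul_add]
        abel)
      (fun c g p => by
        rw [Prod.smul_fst, Prod.smul_snd, map_smul, TensorProduct.tmul_smul, smul_sub]))
    (fun g x fx => by
      have h : (LinearMap.mul ℂ (ExteriorAlgebra ℂ V) (ExteriorAlgebra.ι ℂ g)).lTensor V
          ((LinearMap.mul ℂ (ExteriorAlgebra ℂ V) (ExteriorAlgebra.ι ℂ g)).lTensor V fx) = 0 := by
        have h0 : LinearMap.mul ℂ (ExteriorAlgebra ℂ V) (ExteriorAlgebra.ι ℂ g) ∘ₗ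
            LinearMap.mul ℂ (ExteriorAlgebra ℂ V) (ExteriorAlgebra.ι ℂ g) = 0 := by
          refine LinearMap.ext fun y => ?_
          rw [LinearMap.comp_apply, LinearMap.mul_apply', LinearMap.mul_apply', ← mul_assoc,
            ExteriorAlgebra.ι_sq_zero, zero_mul, LinearMap.zero_apply]
        rw [← LinearMap.comp_apply, ← LinearMap.lTensor_comp, h0, LinearMap.lTensor_zero,
          LinearMap.zero_apply]
      simp only [LinearMap.mk₂_apply, map_sub, h, LinearMap.lTensor_tmul, LinearMap.mul_apply',
        sub_zero, zero_apply, zero_smul]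
      exact sub_self _)
    0

theorem peelExt_algebraMap (r : ℂ) : peelExt (V := V) (algebraMap ℂ _ r) = 0 := by
  rw [peelExt, CliffordAlgebra.foldr'_algebraMap, smul_zero]

theorem peelExt_ι_mul (g : V) (x : ExteriorAlgebra ℂ V) :
    peelExt (ExteriorAlgebra.ι ℂ g * x) =
      g ⊗ₜ x - (LinearMap.mul ℂ (ExteriorAlgebra ℂ V) (ExteriorAlgebra.ι ℂ g)).lTensor V (peelExt x) :=
  CliffordAlgebra.foldr'_ι_mul _ _ _ _ _ _

/-- Contraction with `φ`, `f₁ ⋯ fₘ ↦ ∑ᵢ φ(fᵢ) f₁ ⋯ f̂ᵢ ⋯ fₘ`. -/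
def contract : Module.Dual ℂ V →ₗ[ℂ] SymmetricAlgebra ℂ V →ₗ[ℂ] SymmetricAlgebra ℂ V where
  toFun φ := (TensorProduct.lid ℂ _).toLinearMap ∘ₗ φ.rTensor _ ∘ₗ peelSym
  map_add' φ ψ := by
    rw [LinearMap.rTensor_add, LinearMap.add_comp, LinearMap.comp_add]
  map_smul' c φ := by
    rw [LinearMap.rTensor_smul, LinearMap.smul_comp, LinearMap.comp_smul, RingHom.id_apply]

/-- For `A : V' → End(Sym V)`, the operator
`s ⊗ (g₁ ∧ ⋯ ∧ gₖ) ↦ ∑ⱼ (-1)^(j-1) A(gⱼ)(s) ⊗ (g₁ ∧ ⋯ ∧ ĝⱼ ∧ ⋯ ∧ gₖ)`. -/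
def koszul {V' : Type*} [AddCommGroup V'] [Module ℂ V']
    (A : V' →ₗ[ℂ] SymmetricAlgebra ℂ V →ₗ[ℂ] SymmetricAlgebra ℂ V) :
    SymmetricAlgebra ℂ V ⊗[ℂ] ExteriorAlgebra ℂ V' →ₗ[ℂ]
      SymmetricAlgebra ℂ V ⊗[ℂ] ExteriorAlgebra ℂ V' :=
  (TensorProduct.lift A.flip).rTensor (ExteriorAlgebra ℂ V') ∘ₗ
    (TensorProduct.assoc ℂ (SymmetricAlgebra ℂ V) V' (ExteriorAlgebra ℂ V')).symm.toLinearMap ∘ₗ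
      peelExt.lTensor (SymmetricAlgebra ℂ V)

/-- For a symmetric bilinear form `B`, the second-order operator
`f₁ ⋯ fₘ ↦ ∑_{i<j} B(fᵢ, fⱼ) f₁ ⋯ f̂ᵢ ⋯ f̂ⱼ ⋯ fₘ`, written as half the sum over all `i ≠ j`. -/
def pairContract (B : V →ₗ[ℂ] V →ₗ[ℂ] ℂ) : SymmetricAlgebra ℂ V →ₗ[ℂ] SymmetricAlgebra ℂ V :=
  (1 / 2 : ℂ) • (TensorProduct.lift (contract ∘ₗ B) ∘ₗ peelSym)

variable (V) in
/-- The polynomials of degree at most `n` in `Sym V`. -/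
def symFil (n : ℕ) : Submodule ℂ (SymmetricAlgebra ℂ V) :=
  (1 ⊔ LinearMap.range (SymmetricAlgebra.ι ℂ V)) ^ n

theorem symFil_mono {m n : ℕ} (h : m ≤ n) : symFil V m ≤ symFil V n :=
  pow_le_pow_right' le_sup_left h

theorem exists_mem_symFil (s : SymmetricAlgebra ℂ V) : ∃ n, s ∈ symFil V n := by
  induction s using SymmetricAlgebra.induction with
  | algebraMap r => exact ⟨0, by rw [symFil, pow_zero]; exact Submodule.algebraMap_mem r⟩
  | ι v =>
    exact ⟨1, by rw [symFil, pow_one]; exact Submodule.mem_sup_right (LinearMap.mem_range_self _ v)⟩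
  | mul a b ha hb =>
    obtain ⟨m, hm⟩ := ha
    obtain ⟨n, hn⟩ := hb
    exact ⟨m + n, by rw [symFil, pow_add]; exact Submodule.mul_mem_mul hm hn⟩
  | add a b ha hb =>
    obtain ⟨m, hm⟩ := ha
    obtain ⟨n, hn⟩ := hb
    exact ⟨max m n, add_mem (symFil_mono (le_max_left m n) hm) (symFil_mono (le_max_right m n) hn)⟩

theorem peelSym_of_mem_zero {s : SymmetricAlgebra ℂ V} (h : s ∈ symFil V 0) : peelSym s = 0 := by
  rw [symFil, pow_zero] at h
  obtain ⟨r, rfl⟩ := Submodule.mem_one.mp h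
  exact peelSym_algebraMap r

variable (V) in
/-- The span of the `v ⊗ s` with `s` of degree at most `n`. -/
def tensorFil (n : ℕ) : Submodule ℂ (V ⊗[ℂ] SymmetricAlgebra ℂ V) :=
  Submodule.span ℂ {z | ∃ v, ∃ s ∈ symFil V n, z = v ⊗ₜ s}

theorem map_mem_of_mem_tensorFil {N : Type*} [AddCommGroup N] [Module ℂ N] {n : ℕ}
    (φ : V ⊗[ℂ] SymmetricAlgebra ℂ V →ₗ[ℂ] N) (P : Submodule ℂ N)
    (h : ∀ v, ∀ s ∈ symFil V n, φ (v ⊗ₜ s) ∈ P) {z : V ⊗[ℂ] SymmetricAlgebra ℂ V}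
    (hz : z ∈ tensorFil V n) : φ z ∈ P := by
  have hle : tensorFil V n ≤ P.comap φ := by
    refine Submodule.span_le.mpr ?_
    rintro _ ⟨v, s, hs, rfl⟩
    exact h v s hs
  exact hle hz

theorem tmul_mem_tensorFil (v : V) {n : ℕ} {s : SymmetricAlgebra ℂ V} (hs : s ∈ symFil V n) :
    v ⊗ₜ s ∈ tensorFil V n :=
  Submodule.subset_span ⟨v, s, hs, rfl⟩

theorem peelSym_mem (n : ℕ) : ∀ s ∈ symFil V (n + 1), peelSym s ∈ tensorFil V n := by
  have h1 : ∀ m ∈ symFil V 1, ∃ v : V, peelSym m = v ⊗ₜ 1 := by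
    intro m hm
    rw [symFil, pow_one] at hm
    obtain ⟨a, ha, b, ⟨v, rfl⟩, rfl⟩ := Submodule.mem_sup.mp hm
    refine ⟨v, ?_⟩
    rw [map_add, peelSym_of_mem_zero (by rwa [symFil, pow_zero]), zero_add, peelSym_ι]
  induction n with
  | zero =>
    intro s hs
    obtain ⟨v, hv⟩ := h1 s hs
    rw [hv]
    exact tmul_mem_tensorFil v (by rw [symFil, pow_zero]; exact Submodule.one_le.mp le_rfl)
  | succ n ih =>
    intro s hs
    rw [symFil, pow_succ'] at hs
    induction hs using Submodule.mul_induction_on' with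
    | add x _ y _ hx hy => rw [map_add]; exact add_mem hx hy
    | mem_mul_mem m hm x hx =>
      have hm' : m ∈ symFil V 1 := by rwa [symFil, pow_one]
      obtain ⟨v, hv⟩ := h1 m hm'
      rw [peelSym_mul, hv]
      refine add_mem ?_ ?_
      · refine map_mem_of_mem_tensorFil _ _ (fun w y hy => ?_) (ih x hx)
        rw [LinearMap.lTensor_tmul, LinearMap.mul_apply']
        refine tmul_mem_tensorFil w ?_
        rw [symFil, pow_succ']
        exact Submodule.mul_mem_mul hm hy
      · rw [LinearMap.lTensor_tmul, LinearMap.mul_apply', mul_one]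
        exact tmul_mem_tensorFil v hx

theorem contract_mem (φ : Module.Dual ℂ V) (n : ℕ) : ∀ s ∈ symFil V n,
    contract φ s ∈ symFil V n := by
  intro s hs
  refine map_mem_of_mem_tensorFil
    ((TensorProduct.lid ℂ (SymmetricAlgebra ℂ V)).toLinearMap ∘ₗ φ.rTensor _) _
    (fun v y hy => ?_) (peelSym_mem n s (symFil_mono n.le_succ hs))
  simpa using Submodule.smul_mem _ (φ v) hy

theorem pairContract_mem (B : V →ₗ[ℂ] V →ₗ[ℂ] ℂ) (n : ℕ) : ∀ s ∈ symFil V (n + 1),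
    pairContract B s ∈ symFil V n := by
  intro s hs
  refine Submodule.smul_mem _ _ ?_
  refine map_mem_of_mem_tensorFil (TensorProduct.lift (contract ∘ₗ B)) _
    (fun v y hy => ?_) (peelSym_mem n s hs)
  simpa using contract_mem (B v) n y hy

theorem pairContract_locallyNilpotent (B : V →ₗ[ℂ] V →ₗ[ℂ] ℂ) :
    LocallyNilpotent (pairContract B) := by
  have h : ∀ n : ℕ, ∀ s ∈ symFil V n, (pairContract B ^ (n + 1)) s = 0 := by
    intro n
    induction n with
    | zero =>
      intro s hs
      rw [zero_add, pow_one, pairContract, LinearMap.smul_apply, LinearMap.comp_apply,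
        peelSym_of_mem_zero hs, map_zero, smul_zero]
    | succ n ih =>
      intro s hs
      rw [pow_succ, Module.End.mul_apply]
      exact ih _ (pairContract_mem B n s hs)
  intro s
  obtain ⟨n, hn⟩ := exists_mem_symFil s
  exact ⟨n + 1, h n s hn⟩

theorem neg_rTensor_locallyNilpotent {S N : Type*} [AddCommGroup S] [Module ℂ S]
    [AddCommGroup N] [Module ℂ N] {D : Module.End ℂ S} (hD : LocallyNilpotent D) :
    LocallyNilpotent (-(D.rTensor N)) := by
  intro x
  induction x using TensorProduct.induction_on with
  | zero => exact ⟨0, by simp⟩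
  | add x y hx hy => exact exists_pow_add hx hy
  | tmul s t =>
    obtain ⟨n, hn⟩ := hD s
    have h : ∀ (k : ℕ) (u : S), ((-(D.rTensor N) : Module.End ℂ (S ⊗[ℂ] N)) ^ k) (u ⊗ₜ t) =
        (-1 : ℂ) ^ k • ((D ^ k) u ⊗ₜ[ℂ] t) := by
      intro k
      induction k with
      | zero => intro u; simp
      | succ k ih =>
        intro u
        rw [pow_succ, Module.End.mul_apply, LinearMap.neg_apply, LinearMap.rTensor_tmul, map_neg,
          ih, pow_succ (-1 : ℂ), pow_succ D, Module.End.mul_apply, mul_neg_one, neg_smul]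
    exact ⟨n, by rw [h, hn, TensorProduct.zero_tmul, smul_zero]⟩

end GradedSym

/-! ### Test functions on an interval -/

section Linear

/-- The compactly supported smooth functions `C_c^∞(I)` with complex values. -/
abbrev Cc (I : Opens ℝ) : Type := TestFunction I ℂ ⊤

/-- The inclusion `C_c^∞(I) → C_c^∞(J)` for `I ⊆ J`. -/
def inclCc {I J : Opens ℝ} (h : I ≤ J) : Cc I →ₗ[ℂ] Cc J where
  toFun f := ⟨f, f.contDiff, f.hasCompactSupport, f.tsupport_subset.trans h⟩
  map_add' _ _ := rfl
  map_smul' _ _ := rfl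

/-- The derivative `f ↦ f'`. -/
def derivCc {I : Opens ℝ} : Cc I →ₗ[ℂ] Cc I where
  toFun f := ⟨deriv f, (contDiff_infty_iff_deriv.mp f.contDiff).2, f.hasCompactSupport.deriv,
    (closure_minimal (support_deriv_subset (f := f)) (isClosed_tsupport f)).trans f.tsupport_subset⟩
  map_add' f g := by
    ext t
    have hf := (contDiff_infty_iff_deriv.mp f.contDiff).1 t
    have hg := (contDiff_infty_iff_deriv.mp g.contDiff).1 t
    exact deriv_add hf hg
  map_smul' c f := by
    ext t
    have hf := (contDiff_infty_iff_deriv.mp f.contDiff).1 t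
    exact deriv_const_smul c hf

/-- The equation of motion operator `f ↦ f'' + ω² f`. -/
def eom (ω : ℝ) {I : Opens ℝ} : Cc I →ₗ[ℂ] Cc I :=
  derivCc ∘ₗ derivCc + ((ω : ℂ) ^ 2) • LinearMap.id

theorem integrable_mul {I : Opens ℝ} (f : Cc I) {u : ℝ → ℂ} (hu : Continuous u) :
    MeasureTheory.Integrable (fun t => f t * u t) :=
  (f.continuous.mul hu).integrable_of_hasCompactSupport f.hasCompactSupport.mul_right

/-- The functional `f ↦ ⟨f, u⟩ = ∫ f(t) u(t) dt`. -/
def pairWith {I : Opens ℝ} (u : ℝ → ℂ) (hu : Continuous u) : Cc I →ₗ[ℂ] ℂ where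
  toFun f := ∫ t, f t * u t
  map_add' f g := by
    rw [← MeasureTheory.integral_add (integrable_mul f hu) (integrable_mul g hu)]
    simp [add_mul]
  map_smul' c f := by
    simp [mul_assoc, MeasureTheory.integral_const_mul]

/-- The bilinear pairing `⟨f, g⟩ = ∫ f(t) g(t) dt`. -/
def pairing {I : Opens ℝ} : Cc I →ₗ[ℂ] Cc I →ₗ[ℂ] ℂ :=
  LinearMap.mk₂ ℂ (fun f g => pairWith g g.continuous f)
    (fun f f' g => map_add _ f f') (fun c f g => map_smul _ c f)
    (fun f g g' => by
      simp only [pairWith, LinearMap.coe_mk, AddHom.coe_mk]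
      rw [← MeasureTheory.integral_add (integrable_mul f g.continuous)
        (integrable_mul f g'.continuous)]
      simp [mul_add])
    (fun c f g => by
      simp only [pairWith, LinearMap.coe_mk, AddHom.coe_mk, smul_eq_mul]
      rw [← MeasureTheory.integral_const_mul]
      simp [mul_left_comm])

/-- `h(f)(t) = (i / 2ω) ∫ e^{-iω|t-s|} f(s) ds`, the convolution with the Feynman propagator. -/
def feynman (ω : ℝ) (f : ℝ → ℂ) (t : ℝ) : ℂ :=
  Complex.I / (2 * ω) * ∫ s, Complex.exp (-Complex.I * ω * |t - s|) * f s

theorem continuous_kernel (ω : ℝ) :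
    Continuous fun p : ℝ × ℝ => Complex.exp (-Complex.I * ω * (|p.1 - p.2| : ℝ)) := by
  fun_prop

theorem norm_kernel (ω t s : ℝ) : ‖Complex.exp (-Complex.I * ω * (|t - s| : ℝ))‖ = 1 := by
  have h : -Complex.I * ω * (|t - s| : ℝ) = ((-ω * |t - s| : ℝ) : ℂ) * Complex.I := by
    push_cast; ring
  rw [h, Complex.norm_exp_ofReal_mul_I]

theorem integrable_kernel_mul (ω : ℝ) {I : Opens ℝ} (f : Cc I) (t : ℝ) :
    MeasureTheory.Integrable (fun s => Complex.exp (-Complex.I * ω * (|t - s| : ℝ)) * f s) := by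
  have h := integrable_mul f ((continuous_kernel ω).comp (Continuous.prodMk_right t))
  simpa [mul_comm] using h

theorem continuous_feynman (ω : ℝ) {I : Opens ℝ} (f : Cc I) : Continuous (feynman ω f) := by
  refine continuous_const.mul
    (MeasureTheory.continuous_of_dominated (bound := fun s => ‖f s‖) ?_ ?_ ?_ ?_)
  · exact fun t => (integrable_kernel_mul ω f t).aestronglyMeasurable
  · intro t
    filter_upwards with s
    rw [norm_mul, norm_kernel, one_mul]
  · exact (f.continuous.integrable_of_hasCompactSupport f.hasCompactSupport).norm
  · filter_upwards with s
    exact ((continuous_kernel ω).comp (Continuous.prodMk_left s)).mul continuous_const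

theorem feynman_add (ω : ℝ) {I : Opens ℝ} (f g : Cc I) (t : ℝ) :
    feynman ω (f + g : Cc I) t = feynman ω f t + feynman ω g t := by
  simp only [feynman]
  rw [← mul_add, ← MeasureTheory.integral_add (integrable_kernel_mul ω f t)
    (integrable_kernel_mul ω g t)]
  simp [mul_add]

theorem feynman_smul (ω : ℝ) {I : Opens ℝ} (c : ℂ) (f : Cc I) (t : ℝ) :
    feynman ω (c • f : Cc I) t = c * feynman ω f t := by
  simp only [feynman]
  rw [mul_left_comm, ← MeasureTheory.integral_const_mul c]
  simp only [IsSMulApply.smul_apply, smul_eq_mul, mul_left_comm]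

/-- The Wick contraction of two functions of degree `0`,
`C(f, g) = Δ(f ∧ h(g)) = iℏ ∫ f(t) h(g)(t) dt`. It is a symmetric form. -/
def wickForm (ω ℏ : ℝ) {I : Opens ℝ} : Cc I →ₗ[ℂ] Cc I →ₗ[ℂ] ℂ :=
  LinearMap.mk₂ ℂ (fun f g => Complex.I * ℏ * pairWith (feynman ω g) (continuous_feynman ω g) f)
    (fun f f' g => by rw [map_add, mul_add])
    (fun c f g => by rw [map_smul, smul_eq_mul, smul_eq_mul, mul_left_comm])
    (fun f g g' => by
      simp only [pairWith, LinearMap.coe_mk, AddHom.coe_mk, feynman_add]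
      rw [← mul_add, ← MeasureTheory.integral_add (integrable_mul f (continuous_feynman ω g))
        (integrable_mul f (continuous_feynman ω g'))]
      simp only [mul_add])
    (fun c f g => by
      simp only [pairWith, LinearMap.coe_mk, AddHom.coe_mk, feynman_smul, smul_eq_mul]
      rw [mul_left_comm, ← MeasureTheory.integral_const_mul c]
      simp only [mul_left_comm])

/-- The solution `σ₊(t) = √(ℏ/2ω) e^{-iωt}` of the equation of motion. -/
def sigmaPlus (ω ℏ : ℝ) (t : ℝ) : ℂ :=
  (Real.sqrt (ℏ / (2 * ω)) : ℂ) * Complex.exp (-Complex.I * ω * t)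

/-- The solution `σ₋(t) = √(ℏ/2ω) e^{iωt}` of the equation of motion. -/
def sigmaMinus (ω ℏ : ℝ) (t : ℝ) : ℂ :=
  (Real.sqrt (ℏ / (2 * ω)) : ℂ) * Complex.exp (Complex.I * ω * t)

theorem continuous_sigmaPlus (ω ℏ : ℝ) : Continuous (sigmaPlus ω ℏ) := by
  unfold sigmaPlus; fun_prop

theorem continuous_sigmaMinus (ω ℏ : ℝ) : Continuous (sigmaMinus ω ℏ) := by
  unfold sigmaMinus; fun_prop

end Linear

/-! ### The off-shell prefactorization algebra -/

section BV

/-- The underlying space `Sym(C_c^∞(I) → C_c^∞(I))` of the observables: functions of degree `0` are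
the generators of the symmetric algebra, functions of degree `-1` those of the exterior
algebra. -/
abbrev Obs (I : Opens ℝ) : Type :=
  SymmetricAlgebra ℂ (Cc I) ⊗[ℂ] ExteriorAlgebra ℂ (Cc I)

/-- The words with `k` letters of degree `-1` have degree `-k`. -/
def obsDeg (I : Opens ℝ) (n : ℤ) : Submodule ℂ (Obs I) :=
  if n ≤ 0 then
    LinearMap.range ((⋀[ℂ]^n.natAbs (Cc I)).subtype.lTensor (SymmetricAlgebra ℂ (Cc I)))
  else ⊥

/-- The differential `d`: the derivation with `g ↦ g'' + ω² g` for `g` of degree `-1` and `f ↦ 0`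
for `f` of degree `0`. -/
def classicalD (ω : ℝ) (I : Opens ℝ) : Obs I →ₗ[ℂ] Obs I :=
  koszul (LinearMap.mul ℂ (SymmetricAlgebra ℂ (Cc I)) ∘ₗ SymmetricAlgebra.ι ℂ (Cc I) ∘ₗ eom ω)

/-- The BV operator `Δ`: the second-order operator with `Δ(f ∧ g) = iℏ ⟨f, g⟩` for `f` of degree `0`
and `g` of degree `-1`. -/
def bvLaplacian (ℏ : ℝ) (I : Opens ℝ) : Obs I →ₗ[ℂ] Obs I :=
  (Complex.I * ℏ) • koszul (contract ∘ₗ pairing.flip)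

/-- `Obs^q(I)`, with the differential `d + Δ`. -/
def obsQ (ω ℏ : ℝ) (I : Opens ℝ) : DGSpace where
  carrier := Obs I
  deg := obsDeg I
  d := classicalD ω I + bvLaplacian ℏ I

/-- The inclusion `Obs^q(I) → Obs^q(J)` for `I ⊆ J`, letter by letter. -/
def obsIncl {I J : Opens ℝ} (h : I ≤ J) : Obs I →ₐ[ℂ] Obs J :=
  Algebra.TensorProduct.map
    (SymmetricAlgebra.lift (SymmetricAlgebra.ι ℂ (Cc J) ∘ₗ inclCc h))
    (ExteriorAlgebra.map (inclCc h))

/-- The prefactorization algebra of quantum observables; the product is the wedge product. -/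
def bvFactorization (ω ℏ : ℝ) : PrefactorizationData ℝ where
  obj I := obsQ ω ℏ I.1
  incl h := (obsIncl h).toLinearMap
  prod {_ _ J} _ h₁ h₂ :=
    (LinearMap.mul ℂ (Obs J.1)).compl₁₂ (obsIncl h₁).toLinearMap (obsIncl h₂).toLinearMap

end BV

/-! ### The prefactorization algebra of the Weyl algebra -/

section Weyl

/-- The polynomials `ℂ[a, a†]` in two variables `a = X 0` and `a† = X 1`, which stand for the normal
ordered operators. -/
abbrev Weyl : Type := MvPolynomial (Fin 2) ℂ

theorem pderiv_locallyNilpotent (i : Fin 2) (p : Weyl) :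
    ∃ n : ℕ, (((MvPolynomial.pderiv i).toLinearMap : Module.End ℂ Weyl) ^ n) p = 0 := by
  have h : ∀ (n : ℕ) (s : Fin 2 →₀ ℕ) (c : ℂ), s i = n →
      (((MvPolynomial.pderiv i).toLinearMap : Module.End ℂ Weyl) ^ (n + 1))
        (MvPolynomial.monomial s c) = 0 := by
    intro n
    induction n with
    | zero =>
      intro s c hs
      simp [MvPolynomial.pderiv_monomial, hs]
    | succ n ih =>
      intro s c hs
      rw [pow_succ, Module.End.mul_apply]
      have hd : ((MvPolynomial.pderiv i).toLinearMap : Module.End ℂ Weyl)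
          (MvPolynomial.monomial s c) =
            MvPolynomial.monomial (s - Finsupp.single i 1) (c * (s i : ℂ)) :=
        MvPolynomial.pderiv_monomial
      rw [hd]
      exact ih _ _ (by simp [hs])
  induction p using MvPolynomial.induction_on' with
  | monomial s c => exact ⟨_, h _ s c rfl⟩
  | add p q hp hq => exact exists_pow_add hp hq

/-- The operator `∂/∂a ⊗ ∂/∂a†`. -/
def weylContraction : Module.End ℂ (Weyl ⊗[ℂ] Weyl) :=
  TensorProduct.map (MvPolynomial.pderiv 0).toLinearMap (MvPolynomial.pderiv 1).toLinearMap

theorem weylContraction_locallyNilpotent : LocallyNilpotent weylContraction := by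
  intro x
  induction x using TensorProduct.induction_on with
  | zero => exact ⟨0, by simp⟩
  | add x y hx hy => exact exists_pow_add hx hy
  | tmul p q =>
    obtain ⟨n, hn⟩ := pderiv_locallyNilpotent 0 p
    refine ⟨n, ?_⟩
    rw [weylContraction, TensorProduct.map_pow, TensorProduct.map_tmul, hn,
      TensorProduct.zero_tmul]

/-- The normal ordered product `μ(F, G) = ∧ ∘ exp(∂/∂a ⊗ ∂/∂a†)(F ⊗ G)`. -/
def weylMul : Weyl →ₗ[ℂ] Weyl →ₗ[ℂ] Weyl :=
  TensorProduct.curry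
    (LinearMap.mul' ℂ Weyl ∘ₗ locExp weylContraction weylContraction_locallyNilpotent)

/-- `ℂ[a, a†]` in degree `0`, with zero differential. -/
def weylSpace : DGSpace where
  carrier := Weyl
  deg n := if n = 0 then ⊤ else ⊥
  d := 0

/-- `I₁ < I₂`: every time in `I₁` is earlier than every time in `I₂`. -/
def Earlier (I₁ I₂ : ConnectedOpens ℝ) : Prop := ∀ t ∈ I₁.1, ∀ s ∈ I₂.1, t < s

open Classical in
/-- The prefactorization algebra of the Weyl algebra: the inclusions are the identity, and the
product is `μ` in time order, later factors to the left. -/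
def weylFactorization : PrefactorizationData ℝ where
  obj _ := weylSpace
  incl _ := LinearMap.id (M := Weyl)
  prod {I₁ I₂ _} _ _ _ := if Earlier I₁ I₂ then weylMul.flip else weylMul

end Weyl

/-! ### The projection -/

section Projection

/-- `Π₀(f) = ⟨f, σ₊⟩ a + ⟨f, σ₋⟩ a†` for `f` of degree `0`. -/
def projLin (ω ℏ : ℝ) (I : Opens ℝ) : Cc I →ₗ[ℂ] Weyl :=
  (pairWith (sigmaPlus ω ℏ) (continuous_sigmaPlus ω ℏ)).smulRight (MvPolynomial.X 0) +
    (pairWith (sigmaMinus ω ℏ) (continuous_sigmaMinus ω ℏ)).smulRight (MvPolynomial.X 1)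

/-- `Π₀`: the algebra morphism that extends `projLin` and is zero on functions of degree `-1`. -/
def projZero (ω ℏ : ℝ) (I : Opens ℝ) : Obs I →ₐ[ℂ] Weyl :=
  Algebra.TensorProduct.lift (SymmetricAlgebra.lift (projLin ω ℏ I))
    ((Algebra.ofId ℂ Weyl).comp ExteriorAlgebra.algebraMapInv) (fun _ _ => Commute.all _ _)

/-- The Wick contraction `C` as a second-order operator on words. -/
def wick (ω ℏ : ℝ) (I : Opens ℝ) : Obs I →ₗ[ℂ] Obs I :=
  (pairContract (wickForm ω ℏ)).rTensor (ExteriorAlgebra ℂ (Cc I))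

theorem neg_wick_locallyNilpotent (ω ℏ : ℝ) (I : Opens ℝ) :
    LocallyNilpotent (-(wick ω ℏ I)) :=
  neg_rTensor_locallyNilpotent (pairContract_locallyNilpotent _)

/-- `Π = Π₀ ∘ e^{-C} : Obs^q(I) → ℂ[a, a†]`. -/
def proj (ω ℏ : ℝ) (I : Opens ℝ) : Obs I →ₗ[ℂ] Weyl :=
  (projZero ω ℏ I).toLinearMap ∘ₗ locExp (-(wick ω ℏ I)) (neg_wick_locallyNilpotent ω ℏ I)

end Projection

end HarmonicOscillator

end

/-! Let `P = eom ω` be the operator `g ↦ g'' + ω² g` on test functions. The differential `d + Δ` is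
a Koszul operator: it removes each letter `g` of degree `-1`, with a sign, and applies to the
letters of degree `0` the operator "multiply by `P g`, plus `iℏ` times contraction with `⟨·, g⟩`"
(`obsQ_d`). These coefficient operators commute because `P` is symmetric, so `d + Δ` squares to zero
(`bvCoeff_comm`). Contractions between disjoint supports vanish, so `d + Δ` obeys the Leibniz rule
on the products (`bvCoeff_mul`, `koszul_wordMap_mul`).

The Feynman propagator inverts `P` from the left (`feynman_eom`), hence `C(f, P g) = iℏ⟨f, g⟩`. The
commutator of `C` with multiplication by `P g` is therefore `iℏ` times contraction with `⟨·, g⟩`,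
and `e^{-C}` intertwines `d + Δ` with `d`. After this change of variables `Π` becomes `Π₀` and the
complex becomes the Koszul complex of `P`. The map `P` is injective, and its image is the common
kernel of `⟨·, σ₊⟩` and `⟨·, σ₋⟩` (`exists_eom_eq`). A left inverse of `P` gives a homotopy whose
anticommutator with `d` counts the letters in the image of `P` and those of degree `-1`. Dividing by
this number leaves only the polynomials on a two-dimensional complement of the image, that is `ℂ[a,
a†]` (`exists_koszul_eq`, `exists_koszul_bvCoeff_eq`).

Compatibility with the products is Wick's theorem. If `f` is later than `g`, the Feynman kernel
factors and `C(f, g) = -⟨f, σ₊⟩⟨g, σ₋⟩`. The contractions between a later word and an earlier one,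
exponentiated, then become `exp(∂/∂a ⊗ ∂/∂a†)` under `Π₀`, with the later factor on the left
(`projSym_mul`). Since `Π` is surjective over every interval, associativity of the time-ordered
product on `ℂ[a, a†]` is inherited from that of words. -/

noncomputable section

namespace HarmonicOscillator

/-! ### The exponential of a locally nilpotent operator -/

section LocExp

variable {M N : Type*} [AddCommGroup M] [Module ℂ M] [AddCommGroup N] [Module ℂ N]

theorem locExp_apply {D : Module.End ℂ M} (hD : LocallyNilpotent D) {x : M} {n : ℕ}
    (h : (D ^ n) x = 0) :
    locExp D hD x = ∑ k ∈ Finset.range n, ((k.factorial : ℂ)⁻¹) • (D ^ k) x :=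
  finsum_exp_eq h

theorem locExp_of_apply_eq_zero {D : Module.End ℂ M} (hD : LocallyNilpotent D) {x : M}
    (h : D x = 0) : locExp D hD x = x := by
  rw [locExp_apply hD (n := 1) (by simpa using h)]
  simp

theorem map_locExp {D : Module.End ℂ M} (hD : LocallyNilpotent D) {D' : Module.End ℂ N}
    (hD' : LocallyNilpotent D') (φ : M →ₗ[ℂ] N) (h : ∀ x, φ (D x) = D' (φ x)) (x : M) :
    φ (locExp D hD x) = locExp D' hD' (φ x) := by
  have hpow : ∀ (k : ℕ) (x : M), φ ((D ^ k) x) = (D' ^ k) (φ x) := by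
    intro k
    induction k with
    | zero => intro x; simp
    | succ k ih => intro x; rw [pow_succ, pow_succ, Module.End.mul_apply, Module.End.mul_apply,
        ih, h]
  obtain ⟨n, hn⟩ := hD x
  rw [locExp_apply hD hn, locExp_apply hD' (by rw [← hpow, hn, map_zero]), map_sum]
  simp [hpow]

/-- If `[D, T] = c` commutes with `D`, then `exp(D) T = (T + c) exp(D)`. -/
theorem locExp_commutator {D T c : Module.End ℂ M} (hD : LocallyNilpotent D)
    (hT : ∀ x, D (T x) = T (D x) + c x) (hc : ∀ x, D (c x) = c (D x)) (x : M) :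
    locExp D hD (T x) = T (locExp D hD x) + c (locExp D hD x) := by
  have hpow : ∀ (k : ℕ) (x : M), (D ^ (k + 1)) (T x) =
      T ((D ^ (k + 1)) x) + ((k + 1 : ℕ) : ℂ) • c ((D ^ k) x) := by
    intro k
    induction k with
    | zero => intro x; simp [hT]
    | succ k ih =>
      intro x
      have hcomm : (D ^ (k + 1)) (c x) = c ((D ^ (k + 1)) x) := by
        have hC : Commute D c := LinearMap.ext hc
        exact LinearMap.congr_fun (hC.pow_left (k + 1)) x
      have hs : ∀ (k : ℕ) (x : M), (D ^ k) (D x) = (D ^ (k + 1)) x := fun k x => by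
        rw [pow_succ, Module.End.mul_apply]
      rw [← hs, hT, map_add, ih, hcomm, hs, hs]
      push_cast
      module
  obtain ⟨n, hn⟩ := hD x
  -- One power more than is needed to kill `x`: moving `D` past `T` leaves a term with one factor
  -- `D` fewer.
  have hn1 := pow_apply_eq_zero_of_le n.le_succ hn
  have hTn : (D ^ (n + 1)) (T x) = 0 := by rw [hpow, hn, hn1]; simp
  rw [locExp_apply hD hTn, Finset.sum_range_succ']
  simp only [hpow, smul_add, Finset.sum_add_distrib]
  conv_rhs => rw [locExp_apply hD hn1, Finset.sum_range_succ', map_add, map_sum]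
  have h2 : c (∑ k ∈ Finset.range n, (((k + 1).factorial : ℂ)⁻¹) • (D ^ (k + 1)) x +
      (((Nat.factorial 0 : ℕ) : ℂ)⁻¹) • (D ^ 0) x) = c (locExp D hD x) := by
    rw [locExp_apply hD hn1, Finset.sum_range_succ']
  rw [h2, locExp_apply hD hn, map_sum]
  have h3 : ∀ k ∈ Finset.range n, (((k + 1).factorial : ℂ)⁻¹) • ((k + 1 : ℕ) : ℂ) • c ((D ^ k) x) =
      c (((k.factorial : ℂ)⁻¹) • (D ^ k) x) := by
    intro k _
    rw [map_smul, smul_smul, Nat.factorial_succ]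
    congr 1
    have : ((k + 1 : ℕ) : ℂ) ≠ 0 := Nat.cast_ne_zero.mpr k.succ_ne_zero
    have : (k.factorial : ℂ) ≠ 0 := Nat.cast_ne_zero.mpr k.factorial_ne_zero
    push_cast at *
    field_simp
  rw [Finset.sum_congr rfl h3]
  simp only [map_smul, pow_zero, Module.End.one_apply]
  abel

end LocExp

/-! ### Operators on the symmetric algebra -/

section Sym

variable {V V' : Type*} [AddCommGroup V] [Module ℂ V] [AddCommGroup V'] [Module ℂ V']

-- Words are built by multiplying letters on from the left. The operators below are known through
-- their commutators with a letter, so this is the form of induction that fits them; it follows by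
-- showing that left multiplication by any element preserves `P`.
open SymmetricAlgebra in
@[elab_as_elim]
theorem sym_induction {P : SymmetricAlgebra ℂ V → Prop} (one : P 1)
    (add : ∀ s t, P s → P t → P (s + t)) (smul : ∀ (c : ℂ) s, P s → P (c • s))
    (ι_mul : ∀ v s, P s → P (ι ℂ V v * s)) (s : SymmetricAlgebra ℂ V) : P s := by
  suffices h : ∀ a b : SymmetricAlgebra ℂ V, P b → P (a * b) by simpa using h s 1 one
  intro a
  induction a using SymmetricAlgebra.induction with
  | algebraMap r => intro b hb; rw [← Algebra.smul_def]; exact smul r b hb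
  | ι v => exact fun b hb => ι_mul v b hb
  | mul a a' ha ha' => intro b hb; rw [mul_assoc]; exact ha _ (ha' b hb)
  | add a a' ha ha' => intro b hb; rw [add_mul]; exact add _ _ (ha b hb) (ha' b hb)

theorem contract_one (φ : Module.Dual ℂ V) : contract φ (1 : SymmetricAlgebra ℂ V) = 0 := by
  have h := peelSym_algebraMap (V := V) 1
  rw [map_one] at h
  simp [contract, h]

theorem contract_ι (φ : Module.Dual ℂ V) (v : V) :
    contract φ (SymmetricAlgebra.ι ℂ V v) = algebraMap ℂ _ (φ v) := by
  simp [contract, peelSym_ι, Algebra.algebraMap_eq_smul_one]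

theorem contract_mul (φ : Module.Dual ℂ V) (a b : SymmetricAlgebra ℂ V) :
    contract φ (a * b) = a * contract φ b + b * contract φ a := by
  have h : ∀ (a : SymmetricAlgebra ℂ V) (z : V ⊗[ℂ] SymmetricAlgebra ℂ V),
      TensorProduct.lid ℂ _ (φ.rTensor _ ((LinearMap.mul ℂ (SymmetricAlgebra ℂ V) a).lTensor V z)) =
        a * TensorProduct.lid ℂ _ (φ.rTensor _ z) := by
    intro a z
    induction z using TensorProduct.induction_on with
    | zero => simp
    | add x y hx hy => simp only [map_add, hx, hy, mul_add]
    | tmul v s => simp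
  simp [contract, peelSym_mul, h]

theorem contract_ι_mul (φ : Module.Dual ℂ V) (v : V) (s : SymmetricAlgebra ℂ V) :
    contract φ (SymmetricAlgebra.ι ℂ V v * s) =
      SymmetricAlgebra.ι ℂ V v * contract φ s + φ v • s := by
  rw [contract_mul, contract_ι, mul_comm s, Algebra.smul_def]

theorem contract_comm (φ ψ : Module.Dual ℂ V) (s : SymmetricAlgebra ℂ V) :
    contract φ (contract ψ s) = contract ψ (contract φ s) := by
  induction s using sym_induction with
  | one => simp [contract_one]
  | add s t hs ht => simp only [map_add, hs, ht]
  | smul c s hs => simp only [map_smul, hs]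
  | ι_mul v s hs =>
    simp only [contract_ι_mul, map_add, map_smul, hs]
    abel

theorem contract_map (f : V →ₗ[ℂ] V') (φ : Module.Dual ℂ V') (s : SymmetricAlgebra ℂ V) :
    contract φ (SymmetricAlgebra.lift (SymmetricAlgebra.ι ℂ V' ∘ₗ f) s) =
      SymmetricAlgebra.lift (SymmetricAlgebra.ι ℂ V' ∘ₗ f) (contract (φ ∘ₗ f) s) := by
  induction s using sym_induction with
  | one => simp [contract_one]
  | add s t hs ht => simp only [map_add, hs, ht]
  | smul c s hs => simp only [map_smul, hs]
  | ι_mul v s hs => simp [contract_ι_mul, hs]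

/-! ### Second-order operators and their exponentials -/

theorem pairContract_one (B : V →ₗ[ℂ] V →ₗ[ℂ] ℂ) :
    pairContract B (1 : SymmetricAlgebra ℂ V) = 0 := by
  have h := peelSym_algebraMap (V := V) 1
  rw [map_one] at h
  simp [pairContract, h]

theorem pairContract_neg (B : V →ₗ[ℂ] V →ₗ[ℂ] ℂ) : pairContract (-B) = -pairContract B := by
  have h : (TensorProduct.lift (contract ∘ₗ (-B)) :
      V ⊗[ℂ] SymmetricAlgebra ℂ V →ₗ[ℂ] SymmetricAlgebra ℂ V) =
      -TensorProduct.lift (contract ∘ₗ B) := by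
    ext; simp
  rw [pairContract, h, pairContract, LinearMap.neg_comp, smul_neg]

/-- The new letter can be the first or the second of an ordered pair. By symmetry of `B` both cases
contribute the same, and the factor `1/2` in `pairContract` merges them into one contraction. -/
theorem pairContract_ι_mul {B : V →ₗ[ℂ] V →ₗ[ℂ] ℂ} (hB : ∀ v w, B v w = B w v) (v : V)
    (s : SymmetricAlgebra ℂ V) :
    pairContract B (SymmetricAlgebra.ι ℂ V v * s) =
      SymmetricAlgebra.ι ℂ V v * pairContract B s + contract (B v) s := by
  have h : ∀ z : V ⊗[ℂ] SymmetricAlgebra ℂ V, TensorProduct.lift (contract ∘ₗ B)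
      ((LinearMap.mul ℂ (SymmetricAlgebra ℂ V) (SymmetricAlgebra.ι ℂ V v)).lTensor V z) =
      SymmetricAlgebra.ι ℂ V v * TensorProduct.lift (contract ∘ₗ B) z +
        TensorProduct.lid ℂ _ ((B v).rTensor _ z) := by
    intro z
    induction z using TensorProduct.induction_on with
    | zero => simp
    | add x y hx hy => simp only [map_add, hx, hy, mul_add]; abel
    | tmul w s => simp [contract_ι_mul, hB w v]
  have h2 : contract (B v) s = TensorProduct.lid ℂ _ ((B v).rTensor _ (peelSym s)) := rfl
  simp only [pairContract, LinearMap.smul_apply, LinearMap.comp_apply, peelSym_mul, map_add, h,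
    peelSym_ι, LinearMap.lTensor_tmul, LinearMap.mul_apply', mul_one, TensorProduct.lift.tmul,
    mul_smul_comm, h2]
  module

/-- Differential operators with constant coefficients commute. This supplies the condition on the
commutator in `locExp_commutator`. -/
theorem pairContract_contract {B : V →ₗ[ℂ] V →ₗ[ℂ] ℂ} (hB : ∀ v w, B v w = B w v)
    (φ : Module.Dual ℂ V) (s : SymmetricAlgebra ℂ V) :
    pairContract B (contract φ s) = contract φ (pairContract B s) := by
  induction s using sym_induction with
  | one => simp [contract_one, pairContract_one]
  | add s t hs ht => simp only [map_add, hs, ht]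
  | smul c s hs => simp only [map_smul, hs]
  | ι_mul v s hs =>
    simp only [contract_ι_mul, map_add, map_smul, pairContract_ι_mul hB, hs, contract_comm φ]
    abel

theorem pairContract_map (f : V →ₗ[ℂ] V') {B : V →ₗ[ℂ] V →ₗ[ℂ] ℂ} {B' : V' →ₗ[ℂ] V' →ₗ[ℂ] ℂ}
    (hB : ∀ v w, B v w = B w v) (hB' : ∀ v w, B' v w = B' w v)
    (h : ∀ v w, B' (f v) (f w) = B v w) (s : SymmetricAlgebra ℂ V) :
    pairContract B' (SymmetricAlgebra.lift (SymmetricAlgebra.ι ℂ V' ∘ₗ f) s) =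
      SymmetricAlgebra.lift (SymmetricAlgebra.ι ℂ V' ∘ₗ f) (pairContract B s) := by
  induction s using sym_induction with
  | one => simp [pairContract_one]
  | add s t hs ht => simp only [map_add, hs, ht]
  | smul c s hs => simp only [map_smul, hs]
  | ι_mul v s hs =>
    have h2 : B' (f v) ∘ₗ f = B v := LinearMap.ext (h v)
    simp [pairContract_ι_mul hB, pairContract_ι_mul hB', hs, contract_map, h2]

/-- The exponential of the second-order operator `pairContract B`. -/
def wickExp (B : V →ₗ[ℂ] V →ₗ[ℂ] ℂ) : SymmetricAlgebra ℂ V →ₗ[ℂ] SymmetricAlgebra ℂ V :=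
  locExp (pairContract B) (pairContract_locallyNilpotent B)

theorem wickExp_one (B : V →ₗ[ℂ] V →ₗ[ℂ] ℂ) : wickExp B 1 = 1 :=
  locExp_of_apply_eq_zero _ (pairContract_one B)

theorem wickExp_contract {B : V →ₗ[ℂ] V →ₗ[ℂ] ℂ} (hB : ∀ v w, B v w = B w v)
    (φ : Module.Dual ℂ V) (s : SymmetricAlgebra ℂ V) :
    wickExp B (contract φ s) = contract φ (wickExp B s) :=
  (map_locExp _ _ (contract φ) (fun s => (pairContract_contract hB φ s).symm) s).symm

/-- Conjugation by the exponential shifts multiplication by `v` by its commutator with `pairContract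
B`. Together with `wickExp_one` this recursion determines `wickExp B`. -/
theorem wickExp_ι_mul {B : V →ₗ[ℂ] V →ₗ[ℂ] ℂ} (hB : ∀ v w, B v w = B w v) (v : V)
    (s : SymmetricAlgebra ℂ V) :
    wickExp B (SymmetricAlgebra.ι ℂ V v * s) =
      SymmetricAlgebra.ι ℂ V v * wickExp B s + contract (B v) (wickExp B s) :=
  locExp_commutator (T := LinearMap.mul ℂ _ (SymmetricAlgebra.ι ℂ V v)) (c := contract (B v)) _
    (pairContract_ι_mul hB v) (pairContract_contract hB _) s

/-- The shifts by `contract (B v)` and by its negative cancel, letter by letter. -/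
theorem wickExp_wickExp_neg {B : V →ₗ[ℂ] V →ₗ[ℂ] ℂ} (hB : ∀ v w, B v w = B w v)
    (s : SymmetricAlgebra ℂ V) : wickExp B (wickExp (-B) s) = s := by
  have hB' : ∀ v w, (-B) v w = (-B) w v := fun v w => by simp [hB v w]
  induction s using sym_induction with
  | one => simp [wickExp_one]
  | add s t hs ht => simp only [map_add, hs, ht]
  | smul c s hs => simp only [map_smul, hs]
  | ι_mul v s hs =>
    rw [wickExp_ι_mul hB', map_add, wickExp_ι_mul hB, wickExp_contract hB, hs]
    simp

theorem wickExp_map (f : V →ₗ[ℂ] V') {B : V →ₗ[ℂ] V →ₗ[ℂ] ℂ} {B' : V' →ₗ[ℂ] V' →ₗ[ℂ] ℂ}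
    (hB : ∀ v w, B v w = B w v) (hB' : ∀ v w, B' v w = B' w v)
    (h : ∀ v w, B' (f v) (f w) = B v w) (s : SymmetricAlgebra ℂ V) :
    wickExp B' (SymmetricAlgebra.lift (SymmetricAlgebra.ι ℂ V' ∘ₗ f) s) =
      SymmetricAlgebra.lift (SymmetricAlgebra.ι ℂ V' ∘ₗ f) (wickExp B s) :=
  (map_locExp _ _ (SymmetricAlgebra.lift (SymmetricAlgebra.ι ℂ V' ∘ₗ f)).toLinearMap
    (fun s => (pairContract_map f hB hB' h s).symm) s).symm

/-- For fixed `t` the map `s ↦ s ⊗ t` intertwines the two operators, hence their exponentials. This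
reduces the exponential in `proj` to the symmetric factor. -/
theorem locExp_neg_rTensor (B : V →ₗ[ℂ] V →ₗ[ℂ] ℂ) {N : Type*} [AddCommGroup N] [Module ℂ N]
    (hD : LocallyNilpotent (-((pairContract B).rTensor N))) :
    locExp (-((pairContract B).rTensor N)) hD = (wickExp (-B)).rTensor N := by
  refine TensorProduct.ext' fun s t => ?_
  rw [LinearMap.rTensor_tmul]
  refine (map_locExp (pairContract_locallyNilpotent (-B)) hD
    ((TensorProduct.mk ℂ _ N).flip t) (fun s => ?_) s).symm
  simp [pairContract_neg]

end Sym

/-! ### Koszul operators on `Sym V ⊗ Λ V'` -/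

section Koszul

variable {V V' W W' : Type*} [AddCommGroup V] [Module ℂ V] [AddCommGroup V'] [Module ℂ V']
  [AddCommGroup W] [Module ℂ W] [AddCommGroup W'] [Module ℂ W']

variable (V V') in
/-- The letters of degree `0`. -/
def evenLetter : V →ₗ[ℂ] SymmetricAlgebra ℂ V ⊗[ℂ] ExteriorAlgebra ℂ V' :=
  (Algebra.TensorProduct.includeLeft (S := ℂ)).toLinearMap ∘ₗ SymmetricAlgebra.ι ℂ V

variable (V V') in
/-- The letters of degree `-1`. -/
def oddLetter : V' →ₗ[ℂ] SymmetricAlgebra ℂ V ⊗[ℂ] ExteriorAlgebra ℂ V' :=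
  Algebra.TensorProduct.includeRight.toLinearMap ∘ₗ ExteriorAlgebra.ι ℂ

theorem evenLetter_apply (f : V) : evenLetter V V' f = SymmetricAlgebra.ι ℂ V f ⊗ₜ 1 := rfl

theorem oddLetter_apply (g : V') : oddLetter V V' g = 1 ⊗ₜ ExteriorAlgebra.ι ℂ g := rfl

theorem oddLetter_mul_tmul (g : V') (s : SymmetricAlgebra ℂ V) (ω : ExteriorAlgebra ℂ V') :
    oddLetter V V' g * s ⊗ₜ ω = s ⊗ₜ (ExteriorAlgebra.ι ℂ g * ω) := by
  rw [oddLetter_apply, Algebra.TensorProduct.tmul_mul_tmul, one_mul]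

theorem evenLetter_mul_tmul (f : V) (s : SymmetricAlgebra ℂ V) (ω : ExteriorAlgebra ℂ V') :
    evenLetter V V' f * s ⊗ₜ ω = (SymmetricAlgebra.ι ℂ V f * s) ⊗ₜ ω := by
  rw [evenLetter_apply, Algebra.TensorProduct.tmul_mul_tmul, one_mul]

@[elab_as_elim]
theorem oddLetter_induction {P : SymmetricAlgebra ℂ V ⊗[ℂ] ExteriorAlgebra ℂ V' → Prop}
    (sym : ∀ s, P (s ⊗ₜ 1)) (add : ∀ x y, P x → P y → P (x + y))
    (odd_mul : ∀ g x, P x → P (oddLetter V V' g * x))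
    (x : SymmetricAlgebra ℂ V ⊗[ℂ] ExteriorAlgebra ℂ V') : P x := by
  induction x using TensorProduct.induction_on with
  | zero => simpa using sym 0
  | add x y hx hy => exact add x y hx hy
  | tmul s ω =>
    induction ω using CliffordAlgebra.left_induction with
    | algebraMap r =>
      rw [Algebra.algebraMap_eq_smul_one, TensorProduct.tmul_smul, TensorProduct.smul_tmul']
      exact sym _
    | add ω η hω hη => rw [TensorProduct.tmul_add]; exact add _ _ hω hη
    | ι_mul ω g hω => exact oddLetter_mul_tmul g s ω ▸ odd_mul g _ hω

@[elab_as_elim]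
theorem word_induction {P : SymmetricAlgebra ℂ V ⊗[ℂ] ExteriorAlgebra ℂ V' → Prop}
    (one : P 1) (add : ∀ x y, P x → P y → P (x + y)) (smul : ∀ (c : ℂ) x, P x → P (c • x))
    (even_mul : ∀ f x, P x → P (evenLetter V V' f * x))
    (odd_mul : ∀ g x, P x → P (oddLetter V V' g * x))
    (x : SymmetricAlgebra ℂ V ⊗[ℂ] ExteriorAlgebra ℂ V') : P x := by
  induction x using oddLetter_induction with
  | sym s =>
    induction s using sym_induction with
    | one => exact one
    | add s t hs ht => rw [TensorProduct.add_tmul]; exact add _ _ hs ht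
    | smul c s hs => rw [← TensorProduct.smul_tmul']; exact smul c _ hs
    | ι_mul v s hs => rw [← evenLetter_mul_tmul]; exact even_mul v _ hs
  | add x y hx hy => exact add x y hx hy
  | odd_mul g x hx => exact odd_mul g x hx

variable (A : V' →ₗ[ℂ] SymmetricAlgebra ℂ V →ₗ[ℂ] SymmetricAlgebra ℂ V)

theorem koszul_tmul_one (s : SymmetricAlgebra ℂ V) : koszul A (s ⊗ₜ 1) = 0 := by
  have h := peelExt_algebraMap (V := V') 1
  rw [map_one] at h
  simp [koszul, h]

/-- The recursion of `peelExt`, tensored with the symmetric factor. Together with `koszul_tmul_one`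
it determines `koszul A`, and the later facts on Koszul operators rest on these two rules. -/
theorem koszul_oddLetter_mul (g : V') (x : SymmetricAlgebra ℂ V ⊗[ℂ] ExteriorAlgebra ℂ V') :
    koszul A (oddLetter V V' g * x) = (A g).rTensor _ x - oddLetter V V' g * koszul A x := by
  induction x using TensorProduct.induction_on with
  | zero => simp
  | add x y hx hy => simp only [mul_add, map_add, hx, hy]; abel
  | tmul s ω =>
    have h : ∀ z : V' ⊗[ℂ] ExteriorAlgebra ℂ V',
        (TensorProduct.lift A.flip).rTensor (ExteriorAlgebra ℂ V')
          ((TensorProduct.assoc ℂ (SymmetricAlgebra ℂ V) V' (ExteriorAlgebra ℂ V')).symm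
            (s ⊗ₜ (LinearMap.mul ℂ (ExteriorAlgebra ℂ V') (ExteriorAlgebra.ι ℂ g)).lTensor V' z)) =
        oddLetter V V' g * (TensorProduct.lift A.flip).rTensor (ExteriorAlgebra ℂ V')
          ((TensorProduct.assoc ℂ (SymmetricAlgebra ℂ V) V' (ExteriorAlgebra ℂ V')).symm
            (s ⊗ₜ z)) := by
      intro z
      induction z using TensorProduct.induction_on with
      | zero => simp
      | add x y hx hy => simp only [map_add, TensorProduct.tmul_add, hx, hy, mul_add]
      | tmul v ω => simp [oddLetter_mul_tmul]
    rw [oddLetter_mul_tmul]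
    simp only [koszul, LinearMap.comp_apply, LinearMap.lTensor_tmul, peelExt_ι_mul,
      TensorProduct.tmul_sub, map_sub, LinearEquiv.coe_coe, h]
    simp

/-- Maps that intertwine the coefficient operators intertwine the Koszul operators. -/
theorem map_koszul {A : V' →ₗ[ℂ] SymmetricAlgebra ℂ V →ₗ[ℂ] SymmetricAlgebra ℂ V}
    {B : W' →ₗ[ℂ] SymmetricAlgebra ℂ W →ₗ[ℂ] SymmetricAlgebra ℂ W}
    (T : SymmetricAlgebra ℂ V →ₗ[ℂ] SymmetricAlgebra ℂ W) (φ : V' →ₗ[ℂ] W')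
    (h : ∀ g s, T (A g s) = B (φ g) (T s))
    (x : SymmetricAlgebra ℂ V ⊗[ℂ] ExteriorAlgebra ℂ V') :
    TensorProduct.map T (ExteriorAlgebra.map φ).toLinearMap (koszul A x) =
      koszul B (TensorProduct.map T (ExteriorAlgebra.map φ).toLinearMap x) := by
  have hodd : ∀ g x, TensorProduct.map T (ExteriorAlgebra.map φ).toLinearMap
      (oddLetter V V' g * x) = oddLetter W W' (φ g) *
        TensorProduct.map T (ExteriorAlgebra.map φ).toLinearMap x := by
    intro g x
    induction x using TensorProduct.induction_on with
    | zero => simp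
    | add x y hx hy => simp only [mul_add, map_add, hx, hy]
    | tmul s ω => simp [oddLetter_mul_tmul]
  have hA : ∀ g x, TensorProduct.map T (ExteriorAlgebra.map φ).toLinearMap
      ((A g).rTensor _ x) = (B (φ g)).rTensor _
        (TensorProduct.map T (ExteriorAlgebra.map φ).toLinearMap x) := by
    intro g x
    induction x using TensorProduct.induction_on with
    | zero => simp
    | add x y hx hy => simp only [map_add, hx, hy]
    | tmul s ω => simp [h]
  induction x using oddLetter_induction with
  | sym s => simp [koszul_tmul_one]
  | add x y hx hy => simp only [map_add, hx, hy]
  | odd_mul g x hx => simp only [koszul_oddLetter_mul, hodd, map_sub, hA, hx]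

theorem rTensor_koszul {A B : V' →ₗ[ℂ] SymmetricAlgebra ℂ V →ₗ[ℂ] SymmetricAlgebra ℂ V}
    (T : SymmetricAlgebra ℂ V →ₗ[ℂ] SymmetricAlgebra ℂ V)
    (h : ∀ g s, T (A g s) = B g (T s))
    (x : SymmetricAlgebra ℂ V ⊗[ℂ] ExteriorAlgebra ℂ V') :
    T.rTensor _ (koszul A x) = koszul B (T.rTensor _ x) := by
  have h1 := map_koszul T LinearMap.id h x
  rwa [ExteriorAlgebra.map_id] at h1

/-- When the coefficients commute, `A g` passes through `koszul A`, and the two terms produced by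
pulling out `g` cancel. -/
theorem koszul_koszul (h : ∀ g g' s, A g (A g' s) = A g' (A g s))
    (x : SymmetricAlgebra ℂ V ⊗[ℂ] ExteriorAlgebra ℂ V') : koszul A (koszul A x) = 0 := by
  induction x using oddLetter_induction with
  | sym s => simp [koszul_tmul_one]
  | add x y hx hy => simp only [map_add, hx, hy, add_zero]
  | odd_mul g x hx =>
    rw [koszul_oddLetter_mul, map_sub, koszul_oddLetter_mul, hx, mul_zero, sub_zero,
      ← rTensor_koszul (A g) (fun g' s => h g g' s), sub_self]

theorem koszul_add (A B : V' →ₗ[ℂ] SymmetricAlgebra ℂ V →ₗ[ℂ] SymmetricAlgebra ℂ V) :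
    koszul (A + B) = koszul A + koszul B := by
  refine LinearMap.ext fun x => ?_
  induction x using oddLetter_induction with
  | sym s => simp [koszul_tmul_one]
  | add x y hx hy => simp only [map_add, hx, hy]
  | odd_mul g x hx =>
    rw [LinearMap.add_apply] at hx
    simp only [koszul_oddLetter_mul, LinearMap.add_apply, hx, LinearMap.rTensor_add, mul_add]
    abel

theorem koszul_smul (c : ℂ) (A : V' →ₗ[ℂ] SymmetricAlgebra ℂ V →ₗ[ℂ] SymmetricAlgebra ℂ V) :
    koszul (c • A) = c • koszul A := by
  refine LinearMap.ext fun x => ?_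
  induction x using oddLetter_induction with
  | sym s => simp [koszul_tmul_one]
  | add x y hx hy => simp only [map_add, hx, hy]
  | odd_mul g x hx =>
    rw [LinearMap.smul_apply] at hx
    simp only [koszul_oddLetter_mul, LinearMap.smul_apply, hx, LinearMap.rTensor_smul, smul_sub,
      mul_smul_comm]

/-! ### The number of letters of degree `-1` -/

theorem exteriorPower_zero : ⋀[ℂ]^0 V' = (1 : Submodule ℂ (ExteriorAlgebra ℂ V')) := pow_zero _

theorem exteriorPower_succ (k : ℕ) :
    ⋀[ℂ]^(k + 1) V' = LinearMap.range (ExteriorAlgebra.ι ℂ (M := V')) * ⋀[ℂ]^k V' :=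
  pow_succ' _ _

theorem exteriorPower_add (j k : ℕ) : ⋀[ℂ]^(j + k) V' = ⋀[ℂ]^j V' * ⋀[ℂ]^k V' :=
  pow_add _ _ _

variable (V V') in
/-- The span of the words with `k` letters of degree `-1`. -/
def oddDeg (k : ℕ) : Submodule ℂ (SymmetricAlgebra ℂ V ⊗[ℂ] ExteriorAlgebra ℂ V') :=
  LinearMap.range ((⋀[ℂ]^k V').subtype.lTensor (SymmetricAlgebra ℂ V))

theorem tmul_mem_oddDeg {k : ℕ} (s : SymmetricAlgebra ℂ V) {ω : ExteriorAlgebra ℂ V'}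
    (hω : ω ∈ ⋀[ℂ]^k V') : s ⊗ₜ ω ∈ oddDeg V V' k :=
  ⟨s ⊗ₜ ⟨ω, hω⟩, rfl⟩

theorem oddDeg_le {k : ℕ} {p : Submodule ℂ (SymmetricAlgebra ℂ V ⊗[ℂ] ExteriorAlgebra ℂ V')}
    (h : ∀ s, ∀ ω ∈ ⋀[ℂ]^k V', s ⊗ₜ ω ∈ p) : oddDeg V V' k ≤ p := by
  rintro _ ⟨x, rfl⟩
  induction x using TensorProduct.induction_on with
  | zero => simp
  | add x y hx hy => rw [map_add]; exact add_mem hx hy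
  | tmul s ω => exact h s ω.1 ω.2

theorem mem_oddDeg_zero {x : SymmetricAlgebra ℂ V ⊗[ℂ] ExteriorAlgebra ℂ V'}
    (hx : x ∈ oddDeg V V' 0) : ∃ s, x = s ⊗ₜ 1 := by
  have h : oddDeg V V' 0 ≤ LinearMap.range
      ((TensorProduct.mk ℂ (SymmetricAlgebra ℂ V) (ExteriorAlgebra ℂ V')).flip 1) := by
    refine oddDeg_le fun s ω hω => ?_
    rw [exteriorPower_zero] at hω
    obtain ⟨r, rfl⟩ := Submodule.mem_one.mp hω
    exact ⟨r • s, by simp [Algebra.algebraMap_eq_smul_one, TensorProduct.smul_tmul']⟩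
  obtain ⟨s, hs⟩ := h hx
  exact ⟨s, hs.symm⟩

theorem oddDeg_succ_le {k : ℕ}
    {p : Submodule ℂ (SymmetricAlgebra ℂ V ⊗[ℂ] ExteriorAlgebra ℂ V')}
    (h : ∀ g, ∀ x ∈ oddDeg V V' k, oddLetter V V' g * x ∈ p) : oddDeg V V' (k + 1) ≤ p := by
  refine oddDeg_le fun s ω hω => ?_
  rw [exteriorPower_succ] at hω
  induction hω using Submodule.mul_induction_on' with
  | add ω _ η _ hω hη => rw [TensorProduct.tmul_add]; exact add_mem hω hη
  | mem_mul_mem a ha η hη =>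
    obtain ⟨g, rfl⟩ := ha
    rw [← oddLetter_mul_tmul]
    exact h g _ (tmul_mem_oddDeg s hη)

theorem oddLetter_mul_mem {k : ℕ} (g : V') {x : SymmetricAlgebra ℂ V ⊗[ℂ] ExteriorAlgebra ℂ V'}
    (hx : x ∈ oddDeg V V' k) : oddLetter V V' g * x ∈ oddDeg V V' (k + 1) := by
  have h : oddDeg V V' k ≤ (oddDeg V V' (k + 1)).comap
      (LinearMap.mul ℂ _ (oddLetter V V' g)) := by
    refine oddDeg_le fun s ω hω => ?_
    rw [Submodule.mem_comap, LinearMap.mul_apply', oddLetter_mul_tmul]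
    refine tmul_mem_oddDeg s ?_
    rw [exteriorPower_succ]
    exact Submodule.mul_mem_mul (LinearMap.mem_range_self _ g) hω
  exact h hx

theorem rTensor_mem_oddDeg (T : SymmetricAlgebra ℂ V →ₗ[ℂ] SymmetricAlgebra ℂ V) {k : ℕ}
    {x : SymmetricAlgebra ℂ V ⊗[ℂ] ExteriorAlgebra ℂ V'} (hx : x ∈ oddDeg V V' k) :
    T.rTensor _ x ∈ oddDeg V V' k := by
  have h : oddDeg V V' k ≤ (oddDeg V V' k).comap (T.rTensor _) :=
    oddDeg_le fun s ω hω => tmul_mem_oddDeg (T s) hω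
  exact h hx

theorem mul_mem_oddDeg {j k : ℕ} {x y : SymmetricAlgebra ℂ V ⊗[ℂ] ExteriorAlgebra ℂ V'}
    (hx : x ∈ oddDeg V V' j) (hy : y ∈ oddDeg V V' k) : x * y ∈ oddDeg V V' (j + k) := by
  have h : oddDeg V V' j ≤ (oddDeg V V' (j + k)).comap ((LinearMap.mul ℂ _).flip y) := by
    refine oddDeg_le fun s ω hω => ?_
    have h' : oddDeg V V' k ≤ (oddDeg V V' (j + k)).comap (LinearMap.mul ℂ _ (s ⊗ₜ ω)) := by
      refine oddDeg_le fun t η hη => ?_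
      rw [Submodule.mem_comap, LinearMap.mul_apply', Algebra.TensorProduct.tmul_mul_tmul]
      refine tmul_mem_oddDeg (s * t) ?_
      rw [exteriorPower_add]
      exact Submodule.mul_mem_mul hω hη
    exact h' hy
  exact h hx

theorem koszul_eq_zero_of_mem {x : SymmetricAlgebra ℂ V ⊗[ℂ] ExteriorAlgebra ℂ V'}
    (hx : x ∈ oddDeg V V' 0) : koszul A x = 0 := by
  obtain ⟨s, rfl⟩ := mem_oddDeg_zero hx
  exact koszul_tmul_one A s

theorem koszul_mem_oddDeg (k : ℕ) : ∀ x ∈ oddDeg V V' (k + 1), koszul A x ∈ oddDeg V V' k := by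
  induction k with
  | zero =>
    refine oddDeg_succ_le (p := (oddDeg V V' 0).comap (koszul A)) fun g x hx => ?_
    rw [Submodule.mem_comap, koszul_oddLetter_mul, koszul_eq_zero_of_mem A hx, mul_zero, sub_zero]
    exact rTensor_mem_oddDeg _ hx
  | succ k ih =>
    refine oddDeg_succ_le (p := (oddDeg V V' (k + 1)).comap (koszul A)) fun g x hx => ?_
    rw [Submodule.mem_comap, koszul_oddLetter_mul]
    exact sub_mem (rTensor_mem_oddDeg _ hx) (oddLetter_mul_mem g (ih x hx))

/-- Symmetric words are central and letters of degree `-1` anticommute. A single such letter is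
moved across `y` in `hg`; the general case moves those of `x` one at a time. -/
theorem mul_comm_of_mem_oddDeg {j k : ℕ} {x y : SymmetricAlgebra ℂ V ⊗[ℂ] ExteriorAlgebra ℂ V'}
    (hx : x ∈ oddDeg V V' j) (hy : y ∈ oddDeg V V' k) : x * y = ((-1 : ℂ) ^ (j * k)) • (y * x) := by
  have hg : ∀ (k : ℕ) (g : V'), ∀ y ∈ oddDeg V V' k,
      y * oddLetter V V' g = ((-1 : ℂ) ^ k) • (oddLetter V V' g * y) := by
    intro k g
    induction k with
    | zero =>
      intro y hy
      obtain ⟨s, rfl⟩ := mem_oddDeg_zero hy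
      simp [oddLetter_apply]
    | succ k ih =>
      refine fun y hy => sub_eq_zero.mp (oddDeg_succ_le
        (p := LinearMap.ker ((LinearMap.mul ℂ _).flip (oddLetter V V' g) -
          ((-1 : ℂ) ^ (k + 1)) • LinearMap.mul ℂ _ (oddLetter V V' g))) (fun g' y hy => ?_) hy)
      have hsw : oddLetter V V' g' * oddLetter V V' g =
          (-1 : ℂ) • (oddLetter V V' g * oddLetter V V' g') := by
        simp only [oddLetter_apply, Algebra.TensorProduct.tmul_mul_tmul, one_mul,
          ← TensorProduct.tmul_smul]
        rw [eq_neg_of_add_eq_zero_left (ExteriorAlgebra.ι_add_mul_swap g' g), neg_one_smul]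
      rw [LinearMap.mem_ker, LinearMap.sub_apply, LinearMap.smul_apply, LinearMap.flip_apply,
        LinearMap.mul_apply', LinearMap.mul_apply', mul_assoc, ih y hy, mul_smul_comm,
        ← mul_assoc, hsw, smul_mul_assoc, smul_smul, pow_succ, mul_assoc, sub_self]
  induction j generalizing x with
  | zero =>
    obtain ⟨s, rfl⟩ := mem_oddDeg_zero hx
    have h : oddDeg V V' k ≤ LinearMap.ker (LinearMap.mul ℂ _ (s ⊗ₜ 1) -
        (LinearMap.mul ℂ _).flip (s ⊗ₜ 1)) := by
      refine oddDeg_le fun t η _ => ?_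
      simp [mul_comm s]
    have h1 := h hy
    rw [LinearMap.mem_ker, LinearMap.sub_apply, sub_eq_zero] at h1
    simpa using h1
  | succ j ih =>
    refine sub_eq_zero.mp (oddDeg_succ_le (p := LinearMap.ker ((LinearMap.mul ℂ _).flip y -
        ((-1 : ℂ) ^ ((j + 1) * k)) • LinearMap.mul ℂ _ y)) (fun g x hx => ?_) hx)
    rw [LinearMap.mem_ker, LinearMap.sub_apply, LinearMap.smul_apply, LinearMap.flip_apply,
      LinearMap.mul_apply', LinearMap.mul_apply', mul_assoc, ih hx, ← mul_assoc, hg k g y hy,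
      mul_smul_comm, smul_mul_assoc, smul_smul, ← mul_assoc, ← pow_add]
    have h2 : (-1 : ℂ) ^ (j * k + k + k) = (-1) ^ (j * k) := by
      rw [add_assoc, pow_add, ← two_mul, pow_mul]
      simp
    rw [add_mul, one_mul, h2, sub_self]

variable (V V') in
/-- The projection to the words with `k` letters of degree `-1`. -/
def oddProj (k : ℕ) : Module.End ℂ (SymmetricAlgebra ℂ V ⊗[ℂ] ExteriorAlgebra ℂ V') :=
  (GradedAlgebra.proj (fun i : ℕ => ⋀[ℂ]^i V') k).lTensor _

theorem oddProj_of_mem {k : ℕ} {x : SymmetricAlgebra ℂ V ⊗[ℂ] ExteriorAlgebra ℂ V'}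
    (hx : x ∈ oddDeg V V' k) : oddProj V V' k x = x := by
  have h : oddDeg V V' k ≤ LinearMap.ker (oddProj V V' k - 1) := by
    refine oddDeg_le fun s ω hω => ?_
    rw [LinearMap.mem_ker, LinearMap.sub_apply, oddProj, LinearMap.lTensor_tmul,
      GradedAlgebra.proj_apply, DirectSum.decompose_of_mem_same (fun i : ℕ => ⋀[ℂ]^i V') hω, Module.End.one_apply,
      sub_self]
  exact sub_eq_zero.mp (h hx)

theorem oddProj_of_mem_ne {j k : ℕ} (hjk : j ≠ k)
    {x : SymmetricAlgebra ℂ V ⊗[ℂ] ExteriorAlgebra ℂ V'}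
    (hx : x ∈ oddDeg V V' j) : oddProj V V' k x = 0 := by
  have h : oddDeg V V' j ≤ LinearMap.ker (oddProj V V' k) := by
    refine oddDeg_le fun s ω hω => ?_
    rw [LinearMap.mem_ker, oddProj, LinearMap.lTensor_tmul,
      GradedAlgebra.proj_apply, DirectSum.decompose_of_mem_ne (fun i : ℕ => ⋀[ℂ]^i V') hω hjk, TensorProduct.tmul_zero]
  exact h hx

theorem iSup_oddDeg : ⨆ k, oddDeg V V' k = ⊤ := by
  refine eq_top_iff.mpr fun x _ => ?_
  have h : ∀ x, ∀ g, x ∈ ⨆ k, oddDeg V V' k → oddLetter V V' g * x ∈ ⨆ k, oddDeg V V' k := by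
    intro x g hx
    have hle : ⨆ k, oddDeg V V' k ≤ (⨆ k, oddDeg V V' k).comap
        (LinearMap.mul ℂ _ (oddLetter V V' g)) :=
      iSup_le fun k y hy => Submodule.mem_iSup_of_mem (k + 1) (oddLetter_mul_mem g hy)
    exact hle hx
  induction x using oddLetter_induction with
  | sym s =>
    refine Submodule.mem_iSup_of_mem 0 (tmul_mem_oddDeg s ?_)
    rw [exteriorPower_zero]
    exact Submodule.one_le.mp le_rfl
  | add x y hx hy => exact add_mem (hx trivial) (hy trivial)
  | odd_mul g x hx => exact h x g (hx trivial)

end Koszul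

/-! ### Operators with eigenvalues in `ℕ` -/

section Weight

variable {M : Type*} [AddCommGroup M] [Module ℂ M]

/-- The eigenvectors of `N` of eigenvalue `m` that are fixed by `ρ` for `m = 0` and killed by `ρ`
for `m ≠ 0`. -/
def weightSpace (N ρ : Module.End ℂ M) (m : ℕ) : Submodule ℂ M :=
  LinearMap.ker (N - (m : ℂ) • 1) ⊓ LinearMap.ker (ρ - (if m = 0 then 1 else 0 : ℂ) • 1)

theorem mem_weightSpace {N ρ : Module.End ℂ M} {m : ℕ} {x : M} :
    x ∈ weightSpace N ρ m ↔ N x = (m : ℂ) • x ∧ ρ x = (if m = 0 then 1 else 0 : ℂ) • x := by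
  rw [weightSpace, Submodule.mem_inf, LinearMap.mem_ker, LinearMap.mem_ker, LinearMap.sub_apply,
    LinearMap.sub_apply, LinearMap.smul_apply, LinearMap.smul_apply, Module.End.one_apply,
    sub_eq_zero, sub_eq_zero]

/-- The product of the `1 - N / m` for `1 ≤ m ≤ n`. -/
def weightFilter (N : Module.End ℂ M) : ℕ → Module.End ℂ M
  | 0 => 1
  | n + 1 => (1 - ((n + 1 : ℕ) : ℂ)⁻¹ • N) * weightFilter N n

theorem weightFilter_eigenvector (N : Module.End ℂ M) {m : ℕ} {x : M} (hx : N x = (m : ℂ) • x) :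
    ∀ n, weightFilter N n x = (∏ k ∈ Finset.range n, (1 - ((k + 1 : ℕ) : ℂ)⁻¹ * m)) • x := by
  intro n
  induction n with
  | zero => simp [weightFilter]
  | succ n ih =>
    rw [weightFilter, Module.End.mul_apply, ih, Finset.prod_range_succ]
    simp only [map_smul, LinearMap.sub_apply, Module.End.one_apply, LinearMap.smul_apply, hx]
    module

/-- On weight `0` every factor is `1`. On weight `m ≠ 0` the factor `1 - N / m` vanishes, and it is
present as soon as `n ≥ m`. -/
theorem weightFilter_eventually (N ρ : Module.End ℂ M) {x : M}
    (hx : x ∈ ⨆ m, weightSpace N ρ m) : ∃ n₀, ∀ n, n₀ ≤ n → weightFilter N n x = ρ x := by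
  induction hx using Submodule.iSup_induction' with
  | mem m x hx =>
    obtain ⟨h1, h2⟩ := mem_weightSpace.mp hx
    refine ⟨m, fun n hn => ?_⟩
    rw [weightFilter_eigenvector N h1, h2]
    congr 1
    split_ifs with hm
    · simp [hm]
    · obtain ⟨k, rfl⟩ := Nat.exists_eq_succ_of_ne_zero hm
      refine Finset.prod_eq_zero (Finset.mem_range.mpr hn) ?_
      rw [inv_mul_cancel₀ (Nat.cast_ne_zero.mpr k.succ_ne_zero), sub_self]
  | zero => exact ⟨0, by simp⟩
  | add x y _ _ hx hy =>
    obtain ⟨a, ha⟩ := hx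
    obtain ⟨b, hb⟩ := hy
    refine ⟨max a b, fun n hn => ?_⟩
    rw [map_add, map_add, ha n (le_of_max_le_left hn), hb n (le_of_max_le_right hn)]

/-- A vector of an `N`-invariant subspace differs from its part of weight `0` by the image under
`N` of a vector of that subspace. -/
theorem exists_sub_eq_apply (N ρ : Module.End ℂ M) (p : Submodule ℂ M)
    (hp : ∀ x ∈ p, N x ∈ p) {x : M} (hxp : x ∈ p) (hx : x ∈ ⨆ m, weightSpace N ρ m) :
    ∃ y ∈ p, x - ρ x = N y := by
  -- The filter is a polynomial in `N` with constant term `1`, so its difference from the identity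
  -- is divisible by `N`. The quotient is again a polynomial in `N` and thus preserves `p`, although
  -- `p` is not assumed to be spanned by eigenvectors.
  have h : ∀ n, weightFilter N n x ∈ p ∧ ∃ y ∈ p, x - weightFilter N n x = N y := by
    intro n
    induction n with
    | zero => exact ⟨hxp, 0, zero_mem p, by simp [weightFilter]⟩
    | succ n ih =>
      obtain ⟨h1, y, hy, hxy⟩ := ih
      have h2 : weightFilter N (n + 1) x =
          weightFilter N n x - ((n + 1 : ℕ) : ℂ)⁻¹ • N (weightFilter N n x) := rfl
      refine ⟨h2 ▸ sub_mem h1 (p.smul_mem _ (hp _ h1)),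
        y + ((n + 1 : ℕ) : ℂ)⁻¹ • weightFilter N n x, add_mem hy (p.smul_mem _ h1), ?_⟩
      rw [h2, map_add, ← hxy, map_smul]
      abel
  obtain ⟨n, hn⟩ := weightFilter_eventually N ρ hx
  exact hn n le_rfl ▸ (h n).2

/-- A letter of weight `ε` raises the weight by `ε`. It is fixed by `ρ` if `ε = 0` and killed if `ε
= 1`, so multiplicativity of `ρ` matches `m + ε = 0` holding only for `m = ε = 0`. -/
theorem mul_mem_iSup_weightSpace {A : Type*} [Ring A] [Algebra ℂ A] {N : Module.End ℂ A}
    {ρ : A →ₐ[ℂ] A} {l : A} (ε : ℕ) (hε : ε = 0 ∨ ε = 1)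
    (hN : ∀ x, N (l * x) = l * N x + (ε : ℂ) • (l * x)) (hρ : ρ l = (1 - ε : ℂ) • l) {x : A}
    (hx : x ∈ ⨆ m, weightSpace N ρ.toLinearMap m) :
    l * x ∈ ⨆ m, weightSpace N ρ.toLinearMap m := by
  have hle : ⨆ m, weightSpace N ρ.toLinearMap m ≤
      (⨆ m, weightSpace N ρ.toLinearMap m).comap (LinearMap.mul ℂ A l) := by
    refine iSup_le fun m x hx => ?_
    obtain ⟨h1, h2⟩ := mem_weightSpace.mp hx
    rw [AlgHom.toLinearMap_apply] at h2
    refine Submodule.mem_iSup_of_mem (m + ε) (mem_weightSpace.mpr ⟨?_, ?_⟩)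
    · rw [LinearMap.mul_apply', hN, h1, mul_smul_comm, ← add_smul, Nat.cast_add]
    · rw [LinearMap.mul_apply', AlgHom.toLinearMap_apply, map_mul, h2, hρ, smul_mul_smul_comm]
      congr 1
      rcases hε with rfl | rfl <;> simp
  exact hle hx

end Weight

/-! ### Exactness of the Koszul complex -/

section Exactness

variable {V V' : Type*} [AddCommGroup V] [Module ℂ V] [AddCommGroup V'] [Module ℂ V']

/-- The derivation with `f ↦ r f` for letters of degree `0` and `g ↦ 0` for letters of
degree `-1`. -/
def koszulHomotopy (r : V →ₗ[ℂ] V') :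
    Module.End ℂ (SymmetricAlgebra ℂ V ⊗[ℂ] ExteriorAlgebra ℂ V') :=
  TensorProduct.lift (LinearMap.mul ℂ _ ∘ₗ oddLetter V V' ∘ₗ r) ∘ₗ
    (TensorProduct.assoc ℂ V (SymmetricAlgebra ℂ V) (ExteriorAlgebra ℂ V')).toLinearMap ∘ₗ
      peelSym.rTensor (ExteriorAlgebra ℂ V')

variable (r : V →ₗ[ℂ] V')

theorem koszulHomotopy_tmul (s : SymmetricAlgebra ℂ V) (ω : ExteriorAlgebra ℂ V') :
    koszulHomotopy r (s ⊗ₜ ω) = TensorProduct.lift (LinearMap.mul ℂ _ ∘ₗ oddLetter V V' ∘ₗ r)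
      (TensorProduct.assoc ℂ V (SymmetricAlgebra ℂ V) (ExteriorAlgebra ℂ V')
        (peelSym s ⊗ₜ ω)) := rfl

theorem koszulHomotopy_one : koszulHomotopy r 1 = 0 := by
  have h := peelSym_algebraMap (V := V) 1
  rw [map_one] at h
  rw [Algebra.TensorProduct.one_def, koszulHomotopy_tmul, h]
  simp

theorem koszulHomotopy_even_mul (f : V) (x : SymmetricAlgebra ℂ V ⊗[ℂ] ExteriorAlgebra ℂ V') :
    koszulHomotopy r (evenLetter V V' f * x) =
      evenLetter V V' f * koszulHomotopy r x + oddLetter V V' (r f) * x := by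
  induction x using TensorProduct.induction_on with
  | zero => simp
  | add x y hx hy => simp only [mul_add, map_add, hx, hy]; abel
  | tmul s ω =>
    have h : ∀ z : V ⊗[ℂ] SymmetricAlgebra ℂ V,
        TensorProduct.lift (LinearMap.mul ℂ _ ∘ₗ oddLetter V V' ∘ₗ r)
          (TensorProduct.assoc ℂ V (SymmetricAlgebra ℂ V) (ExteriorAlgebra ℂ V')
            ((LinearMap.mul ℂ (SymmetricAlgebra ℂ V) (SymmetricAlgebra.ι ℂ V f)).lTensor V z
              ⊗ₜ ω)) =
        evenLetter V V' f * TensorProduct.lift (LinearMap.mul ℂ _ ∘ₗ oddLetter V V' ∘ₗ r)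
          (TensorProduct.assoc ℂ V (SymmetricAlgebra ℂ V) (ExteriorAlgebra ℂ V') (z ⊗ₜ ω)) := by
      intro z
      induction z using TensorProduct.induction_on with
      | zero => simp
      | add x y hx hy => simp only [map_add, TensorProduct.add_tmul, hx, hy, mul_add]
      | tmul v s => simp [oddLetter_mul_tmul, evenLetter_mul_tmul]
    rw [evenLetter_mul_tmul, koszulHomotopy_tmul, peelSym_mul, TensorProduct.add_tmul, map_add,
      map_add, h, koszulHomotopy_tmul, peelSym_ι]
    simp

theorem koszulHomotopy_odd_mul (g : V') (x : SymmetricAlgebra ℂ V ⊗[ℂ] ExteriorAlgebra ℂ V') :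
    koszulHomotopy r (oddLetter V V' g * x) = -(oddLetter V V' g * koszulHomotopy r x) := by
  induction x using TensorProduct.induction_on with
  | zero => simp
  | add x y hx hy => simp only [mul_add, map_add, hx, hy]; abel
  | tmul s ω =>
    have h : ∀ z : V ⊗[ℂ] SymmetricAlgebra ℂ V,
        TensorProduct.lift (LinearMap.mul ℂ _ ∘ₗ oddLetter V V' ∘ₗ r)
          (TensorProduct.assoc ℂ V (SymmetricAlgebra ℂ V) (ExteriorAlgebra ℂ V')
            (z ⊗ₜ (ExteriorAlgebra.ι ℂ g * ω))) =
        -(oddLetter V V' g * TensorProduct.lift (LinearMap.mul ℂ _ ∘ₗ oddLetter V V' ∘ₗ r)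
          (TensorProduct.assoc ℂ V (SymmetricAlgebra ℂ V) (ExteriorAlgebra ℂ V')
            (z ⊗ₜ ω))) := by
      intro z
      induction z using TensorProduct.induction_on with
      | zero => simp
      | add x y hx hy =>
        simp only [map_add, TensorProduct.add_tmul, hx, hy, mul_add]
        abel
      | tmul v s =>
        simp only [TensorProduct.assoc_tmul, TensorProduct.lift.tmul, LinearMap.comp_apply,
          LinearMap.mul_apply', oddLetter_mul_tmul, ← mul_assoc, ← TensorProduct.tmul_neg]
        rw [eq_neg_of_add_eq_zero_left (ExteriorAlgebra.ι_add_mul_swap (r v) g), neg_mul]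
    rw [oddLetter_mul_tmul, koszulHomotopy_tmul, h, koszulHomotopy_tmul]

theorem koszulHomotopy_mem (k : ℕ) : ∀ x ∈ oddDeg V V' k,
    koszulHomotopy r x ∈ oddDeg V V' (k + 1) := by
  refine oddDeg_le (p := (oddDeg V V' (k + 1)).comap (koszulHomotopy r)) fun s ω hω => ?_
  rw [Submodule.mem_comap, koszulHomotopy_tmul]
  induction peelSym s using TensorProduct.induction_on with
  | zero => simp
  | add x y hx hy =>
    rw [TensorProduct.add_tmul, map_add, map_add]
    exact add_mem hx hy
  | tmul v s => exact oddLetter_mul_mem (r v) (tmul_mem_oddDeg s hω)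

/-- The Koszul complex of an injective map `P` with left inverse `r`. -/
theorem exists_koszul_eq {A : V' →ₗ[ℂ] SymmetricAlgebra ℂ V →ₗ[ℂ] SymmetricAlgebra ℂ V}
    (P : V' →ₗ[ℂ] V) (hA : ∀ g s, A g s = SymmetricAlgebra.ι ℂ V (P g) * s)
    (hr : ∀ g, r (P g) = g)
    (ρ : SymmetricAlgebra ℂ V ⊗[ℂ] ExteriorAlgebra ℂ V' →ₐ[ℂ]
      SymmetricAlgebra ℂ V ⊗[ℂ] ExteriorAlgebra ℂ V')
    (hρ : ∀ f, ρ (evenLetter V V' f) = evenLetter V V' (f - P (r f)))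
    (hρ' : ∀ g, ρ (oddLetter V V' g) = 0)
    {k : ℕ} {x : SymmetricAlgebra ℂ V ⊗[ℂ] ExteriorAlgebra ℂ V'} (hx : x ∈ oddDeg V V' k)
    (hdx : koszul A x = 0) (hρx : ρ x = 0) : ∃ z ∈ oddDeg V V' (k + 1), koszul A z = x := by
  have hAr : ∀ g x, (A g).rTensor (ExteriorAlgebra ℂ V') x = evenLetter V V' (P g) * x := by
    intro g x
    induction x using TensorProduct.induction_on with
    | zero => simp
    | add x y hx hy => simp only [mul_add, map_add, hx, hy]
    | tmul s ω => simp [evenLetter_mul_tmul, hA]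
  have hdeven : ∀ f x, koszul A (evenLetter V V' f * x) = evenLetter V V' f * koszul A x := by
    have hr : ∀ f, (LinearMap.mul ℂ _ (SymmetricAlgebra.ι ℂ V f)).rTensor
        (ExteriorAlgebra ℂ V') = LinearMap.mul ℂ _ (evenLetter V V' f) := by
      refine fun f => TensorProduct.ext' fun s ω => ?_
      simp [evenLetter_mul_tmul]
    intro f x
    have h := rTensor_koszul (A := A) (B := A) (LinearMap.mul ℂ _ (SymmetricAlgebra.ι ℂ V f))
      (fun g s => by simp [hA, mul_left_comm]) x
    rw [hr] at h
    exact h.symm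
  -- The anticommutator of the two odd derivations is the even derivation `f ↦ P (r f)`, `g ↦ g`. It
  -- counts the letters in the image of `P` and those of degree `-1`.
  set N : Module.End ℂ (SymmetricAlgebra ℂ V ⊗[ℂ] ExteriorAlgebra ℂ V') :=
    koszul A ∘ₗ koszulHomotopy r + koszulHomotopy r ∘ₗ koszul A with hNdef
  have hN : ∀ x, N x = koszul A (koszulHomotopy r x) + koszulHomotopy r (koszul A x) :=
    fun _ => rfl
  have hNeven : ∀ f x, N (evenLetter V V' f * x) =
      evenLetter V V' f * N x + evenLetter V V' (P (r f)) * x := by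
    intro f x
    simp only [hN, koszulHomotopy_even_mul, hdeven, map_add, koszul_oddLetter_mul, hAr, mul_add]
    abel
  have hNodd : ∀ g x, N (oddLetter V V' g * x) =
      oddLetter V V' g * N x + oddLetter V V' g * x := by
    intro g x
    simp only [hN, koszulHomotopy_odd_mul, koszul_oddLetter_mul, map_neg, map_sub, hAr,
      koszulHomotopy_even_mul, hr, mul_add]
    abel
  have htop : ∀ x, x ∈ ⨆ m, weightSpace N ρ.toLinearMap m := by
    intro x
    induction x using word_induction with
    | one =>
      refine Submodule.mem_iSup_of_mem 0 (mem_weightSpace.mpr ⟨?_, by simp⟩)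
      rw [hN, koszulHomotopy_one, Algebra.TensorProduct.one_def, koszul_tmul_one]
      simp
    | add x y hx hy => exact add_mem hx hy
    | smul c x hx => exact Submodule.smul_mem _ c hx
    | even_mul f x hx =>
      -- The splitting of `V` into `ker r`, of weight `0`, and the image of `P`, of weight `1`.
      have hf : f = (f - P (r f)) + P (r f) := by abel
      rw [hf, map_add, add_mul]
      refine add_mem (mul_mem_iSup_weightSpace 0 (Or.inl rfl) (fun x => ?_) ?_ hx)
        (mul_mem_iSup_weightSpace 1 (Or.inr rfl) (fun x => ?_) ?_ hx)
      · rw [hNeven, show r (f - P (r f)) = 0 by rw [map_sub, hr, sub_self]]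
        simp
      · simp [hρ, hr]
      · simp [hNeven, hr]
      · simp [hρ, hr]
    | odd_mul g x hx =>
      refine mul_mem_iSup_weightSpace 1 (Or.inr rfl) (fun x => ?_) ?_ hx
      · simp [hNodd]
      · simp [hρ']
  have hdd : ∀ x, koszul A (koszul A x) = 0 :=
    koszul_koszul A fun g g' s => by simp only [hA, mul_left_comm]
  -- The invariant subspace consists of the cycles with `k` odd letters. On a cycle `y` the operator
  -- `N` is the differential of the homotopy, and `ρ x = 0`, so `x = N y` is a boundary.
  obtain ⟨y, ⟨hy1, hy2⟩, hxy⟩ := exists_sub_eq_apply N ρ.toLinearMap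
    (oddDeg V V' k ⊓ LinearMap.ker (koszul A)) (fun x hx => by
      obtain ⟨h1, h2⟩ := hx
      rw [SetLike.mem_coe, LinearMap.mem_ker] at h2
      refine ⟨?_, ?_⟩
      · rw [hN, h2, map_zero, add_zero]
        exact koszul_mem_oddDeg A k _ (koszulHomotopy_mem r k x h1)
      · rw [SetLike.mem_coe, LinearMap.mem_ker, hN, h2, map_zero, add_zero, hdd])
    ⟨hx, hdx⟩ (htop x)
  rw [SetLike.mem_coe, LinearMap.mem_ker] at hy2
  refine ⟨koszulHomotopy r y, koszulHomotopy_mem r k y hy1, ?_⟩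
  rw [AlgHom.toLinearMap_apply, hρx, sub_zero, hN, hy2, map_zero, add_zero] at hxy
  exact hxy.symm

end Exactness

/-! ### Test functions and the equation of motion -/

section Analysis

variable {I J : Opens ℝ}

theorem continuous_cexp_mul (c : ℂ) : Continuous fun t : ℝ => Complex.exp (c * t) := by fun_prop

theorem contDiff_cexp_mul (c : ℂ) : ContDiff ℝ (⊤ : ℕ∞) fun t : ℝ => Complex.exp (c * t) :=
  (contDiff_const.mul Complex.ofRealCLM.contDiff).cexp

theorem hasDerivAt_cexp_mul (c : ℂ) (t : ℝ) :
    HasDerivAt (fun t : ℝ => Complex.exp (c * t)) (c * Complex.exp (c * t)) t := by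
  have h := ((Complex.ofRealCLM.hasDerivAt (x := t)).const_mul c).cexp
  simpa [mul_comm] using h

/-- Multiplication by `t ↦ e^{ct}`. -/
def mulExp (c : ℂ) (f : Cc I) : Cc I where
  toFun t := f t * Complex.exp (c * t)
  contDiff' := f.contDiff.mul (contDiff_cexp_mul c)
  hasCompactSupport' := f.hasCompactSupport.mul_right
  tsupport_subset' := (tsupport_mul_subset_left (f := f)).trans f.tsupport_subset

theorem mulExp_apply (c : ℂ) (f : Cc I) (t : ℝ) : mulExp c f t = f t * Complex.exp (c * t) := rfl

/-- The functional `f ↦ ∫ f(t) e^{ct} dt`. -/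
def pairExp (c : ℂ) : Cc I →ₗ[ℂ] ℂ := pairWith (fun t => Complex.exp (c * t)) (continuous_cexp_mul c)

theorem pairExp_apply (c : ℂ) (f : Cc I) : pairExp c f = ∫ t, f t * Complex.exp (c * t) := rfl

theorem hasDerivAt_Cc (f : Cc I) (t : ℝ) : HasDerivAt f (derivCc f t) t :=
  ((contDiff_infty_iff_deriv.mp f.contDiff).1 t).hasDerivAt

theorem integrable_Cc (f : Cc I) : MeasureTheory.Integrable f :=
  f.continuous.integrable_of_hasCompactSupport f.hasCompactSupport

theorem derivCc_mulExp (c : ℂ) (f : Cc I) :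
    derivCc (mulExp c f) = mulExp c (derivCc f) + c • mulExp c f := by
  ext t
  have h := ((hasDerivAt_Cc f t).mul (hasDerivAt_cexp_mul c t)).deriv
  refine h.trans ?_
  simp only [IsAddApply.add_apply, IsSMulApply.smul_apply, mulExp_apply, smul_eq_mul]
  ring

theorem integral_derivCc (f : Cc I) : ∫ t, derivCc f t = 0 :=
  MeasureTheory.integral_eq_zero_of_hasDerivAt_of_integrable (hasDerivAt_Cc f)
    (integrable_Cc (derivCc f)) (integrable_Cc f)

theorem pairExp_derivCc (c : ℂ) (f : Cc I) : pairExp c (derivCc f) = -c * pairExp c f := by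
  have h := integral_derivCc (mulExp c f)
  rw [derivCc_mulExp] at h
  have h2 : (∫ t, mulExp c (derivCc f) t) + ∫ t, (c • mulExp c f : Cc I) t = 0 := by
    rw [← MeasureTheory.integral_add (integrable_Cc _) (integrable_Cc _)]
    exact h
  have h3 : ∫ t, (c • mulExp c f : Cc I) t = c * pairExp c f :=
    MeasureTheory.integral_const_mul c _
  rw [h3] at h2
  rw [neg_mul]
  exact eq_neg_of_add_eq_zero_left h2

/-! ### The image of the equation of motion operator -/

theorem eom_apply (ω : ℝ) (f : Cc I) :
    eom ω f = derivCc (derivCc f) + ((ω : ℂ) ^ 2) • f := rfl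

theorem pairExp_eom (ω : ℝ) {c : ℂ} (hc : c ^ 2 = -(ω : ℂ) ^ 2) (f : Cc I) :
    pairExp c (eom ω f) = 0 := by
  rw [eom_apply, map_add, map_smul, pairExp_derivCc, pairExp_derivCc, smul_eq_mul]
  linear_combination pairExp c f * hc

/-- The antiderivative that vanishes to the left of the support also vanishes to its right, because
the total integral is zero. Connectedness of `I` keeps the interval spanned by the support of `f`
inside `I`. -/
theorem exists_derivCc_eq (hI : _root_.IsConnected (I : Set ℝ)) {f : Cc I} (hf : ∫ t, f t = 0) :
    ∃ a : Cc I, derivCc a = f := by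
  rcases (tsupport f).eq_empty_or_nonempty with hK | hK
  · refine ⟨0, ?_⟩
    have : (f : ℝ → ℂ) = 0 := tsupport_eq_empty_iff.mp hK
    ext t
    rw [map_zero, this]
    rfl
  have hKc : IsCompact (tsupport f) := f.hasCompactSupport
  set c := sInf (tsupport f)
  set d := sSup (tsupport f)
  have hc : c ∈ (I : Set ℝ) := f.tsupport_subset (hKc.sInf_mem hK)
  have hd : d ∈ (I : Set ℝ) := f.tsupport_subset (hKc.sSup_mem hK)
  have hcd : Set.Icc c d ⊆ I := hI.isPreconnected.ordConnected.out hc hd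
  have hzero_left : ∀ t < c, f t = 0 := fun t ht => by
    by_contra h
    exact absurd (csInf_le hKc.bddBelow (subset_tsupport f h)) (not_le.mpr ht)
  have hzero_right : ∀ t, d < t → f t = 0 := fun t ht => by
    by_contra h
    exact absurd (le_csSup hKc.bddAbove (subset_tsupport f h)) (not_le.mpr ht)
  have hcd' : c ≤ d := csInf_le hKc.bddBelow (hKc.sSup_mem hK)
  -- The base point lies strictly to the left of the support, so the half-open interval from `c - 1`
  -- to `t` contains the whole support once `t > d`.
  let a : ℝ → ℂ := fun t => ∫ s in (c - 1)..t, f s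
  have hder : ∀ t, HasDerivAt a (f t) t := fun t =>
    f.continuous.integral_hasStrictDerivAt (c - 1) t |>.hasDerivAt
  have hderiv : deriv a = f := funext fun t => (hder t).deriv
  have hsupp : Function.support a ⊆ Set.Icc c d := by
    intro t ht
    by_contra hn
    refine ht ?_
    rcases lt_or_ge t c with h | h
    · refine intervalIntegral.integral_zero_ae (Filter.Eventually.of_forall fun s hs => ?_)
      refine hzero_left s ?_
      rw [Set.mem_uIoc] at hs
      rcases hs with hs | hs <;> linarith [hs.2]
    · have hdt : d < t := by
        by_contra h'
        exact hn ⟨h, not_lt.mp h'⟩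
      change ∫ s in (c - 1)..t, f s = 0
      rw [intervalIntegral.integral_eq_integral_of_support_subset, hf]
      intro s hs
      refine ⟨?_, ?_⟩
      · by_contra h'
        exact hs (hzero_left s (by linarith))
      · by_contra h'
        exact hs (hzero_right s (by linarith))
  have hts : tsupport a ⊆ Set.Icc c d := closure_minimal hsupp isClosed_Icc
  have hsmooth : ContDiff ℝ (⊤ : ℕ∞) a := by
    refine contDiff_infty_iff_deriv.mpr ⟨fun t => (hder t).differentiableAt, ?_⟩
    rw [hderiv]
    exact f.contDiff
  refine ⟨⟨a, hsmooth, isCompact_Icc.of_isClosed_subset (isClosed_tsupport a) hts,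
    hts.trans hcd⟩, ?_⟩
  ext t
  exact congrFun hderiv t

/-- Write `∂² + ω² = (∂ + iω)(∂ - iω)`. Each first-order factor is solved by an antiderivative after
multiplication by an exponential, and the two hypotheses make these antiderivatives compactly
supported. -/
theorem exists_eom_eq {ω : ℝ} (hω : ω ≠ 0) (hI : _root_.IsConnected (I : Set ℝ)) {f : Cc I}
    (h₁ : pairExp (-Complex.I * ω) f = 0) (h₂ : pairExp (Complex.I * ω) f = 0) :
    ∃ g : Cc I, eom ω g = f := by
  obtain ⟨a, ha⟩ := exists_derivCc_eq hI (f := mulExp (Complex.I * ω) f) h₂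
  obtain ⟨b, hb⟩ := exists_derivCc_eq hI (f := mulExp (-Complex.I * ω) f) h₁
  have hω' : (ω : ℂ) ≠ 0 := Complex.ofReal_ne_zero.mpr hω
  have hinv : ∀ (c : ℂ) (f : Cc I), mulExp (-c) (mulExp c f) = f := by
    intro c f
    ext t
    rw [mulExp_apply, mulExp_apply, mul_assoc, ← Complex.exp_add]
    simp
  have hI2 : Complex.I * Complex.I = -1 := Complex.I_mul_I
  set a' := mulExp (-Complex.I * ω) a with ha'
  set b' := mulExp (Complex.I * ω) b with hb'
  have hda : derivCc a' = f + (-Complex.I * ω) • a' := by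
    rw [ha', derivCc_mulExp, ha, neg_mul, hinv]
  have hdb : derivCc b' = f + (Complex.I * ω) • b' := by
    rw [hb', derivCc_mulExp, hb]
    congr 1
    have h := hinv (-Complex.I * ω) f
    rwa [neg_mul, neg_neg, ← neg_mul] at h
  -- Partial fractions: `(∂ + iω) a' = f` and `(∂ - iω) b' = f`, while `i / 2ω = -1 / 2iω`.
  refine ⟨(Complex.I / (2 * ω)) • (a' - b'), ?_⟩
  rw [eom_apply, map_smul, map_smul, map_sub, hda, hdb]
  simp only [map_sub, map_add, map_smul, hda, hdb]
  ext t
  simp only [IsAddApply.add_apply, IsSMulApply.smul_apply, IsSubApply.sub_apply, smul_eq_mul]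
  field_simp
  ring_nf
  simp [show Complex.I ^ 3 = -Complex.I by rw [pow_succ, Complex.I_sq]; ring]
  ring

theorem exists_integral_ne_zero (hI : (I : Set ℝ).Nonempty) : ∃ f : Cc I, ∫ t, f t ≠ 0 := by
  obtain ⟨x, hx⟩ := hI
  obtain ⟨φ, h1, h2, h3, h4, h5⟩ := exists_contDiff_tsupport_subset (n := ⊤)
    (I.isOpen.mem_nhds hx)
  have hcomp : Function.support (fun t => (φ t : ℂ)) = Function.support φ := by
    ext t; simp
  refine ⟨⟨fun t => φ t, Complex.ofRealCLM.contDiff.comp h3, ?_, ?_⟩, ?_⟩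
  · rw [HasCompactSupport, tsupport, hcomp]; exact h2
  · rw [tsupport, hcomp]; exact h1
  · change ∫ t, (φ t : ℂ) ≠ 0
    rw [integral_complex_ofReal, Complex.ofReal_ne_zero]
    refine (Continuous.integral_pos_of_hasCompactSupport_nonneg_nonzero h3.continuous h2
      (fun t => (h4 (Set.mem_range_self t)).1) (x := x) ?_).ne'
    rw [h5]; exact one_ne_zero

/-- For every `f` the function `f' - c f` pairs to zero with `e^{-ct}` and to `-2c ∫ f e^{ct}` with
`e^{ct}`. Taking `f = e^{-ct} φ` with `∫ φ ≠ 0` makes the second number nonzero. -/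
theorem exists_pairExp_dual {c : ℂ} (hc : c ≠ 0) (hI : (I : Set ℝ).Nonempty) :
    ∃ u : Cc I, pairExp c u = 1 ∧ pairExp (-c) u = 0 := by
  obtain ⟨φ, hφ⟩ := exists_integral_ne_zero hI
  set f := mulExp (-c) φ with hf
  have h1 : pairExp c f = ∫ t, φ t := by
    rw [pairExp_apply]
    refine MeasureTheory.integral_congr_ae (Filter.Eventually.of_forall fun t => ?_)
    simp only [hf, mulExp_apply]
    rw [mul_assoc, ← Complex.exp_add]
    simp
  refine ⟨(-(2 * c * ∫ t, φ t))⁻¹ • (derivCc f - c • f), ?_, ?_⟩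
  · rw [map_smul, map_sub, map_smul, pairExp_derivCc, h1]
    simp only [smul_eq_mul]
    field_simp
    ring
  · rw [map_smul, map_sub, map_smul, pairExp_derivCc]
    simp

/-! ### The Feynman propagator -/

theorem feynman_eq (ω : ℝ) (f : Cc I) (t : ℝ) :
    feynman ω f t = Complex.I / (2 * ω) *
      (Complex.exp (-Complex.I * ω * t) * (∫ s in Set.Iic t, f s * Complex.exp (Complex.I * ω * s)) +
       Complex.exp (Complex.I * ω * t) *
        (∫ s in Set.Ioi t, f s * Complex.exp (-Complex.I * ω * s))) := by
  have hint := integrable_kernel_mul ω f t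
  rw [feynman, ← intervalIntegral.integral_Iic_add_Ioi hint.integrableOn hint.integrableOn]
  rw [← MeasureTheory.integral_const_mul, ← MeasureTheory.integral_const_mul]
  congr 2
  · refine MeasureTheory.setIntegral_congr_fun measurableSet_Iic fun s hs => ?_
    have h : |t - s| = t - s := abs_of_nonneg (sub_nonneg.mpr hs)
    simp only [h]
    rw [mul_left_comm, ← Complex.exp_add, mul_comm]
    congr 2
    push_cast
    ring
  · refine MeasureTheory.setIntegral_congr_fun measurableSet_Ioi fun s hs => ?_
    have h : |t - s| = s - t := by rw [abs_sub_comm]; exact abs_of_nonneg (sub_nonneg.mpr hs.le)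
    simp only [h]
    rw [mul_left_comm, ← Complex.exp_add, mul_comm]
    congr 2
    push_cast
    ring

/-- For `c² = -ω²` the product `e^{cs} (g'' + ω² g)` is the derivative of `e^{cs} (g' - c g)`. Both
half-line integrals are thus boundary terms at `t`; the contributions of `g'` cancel and those of
`g` add up. -/
theorem feynman_eom {ω : ℝ} (hω : ω ≠ 0) (g : Cc I) (t : ℝ) : feynman ω (eom ω g) t = g t := by
  have hω' : (ω : ℂ) ≠ 0 := Complex.ofReal_ne_zero.mpr hω
  have key : ∀ c : ℂ, c ^ 2 = -(ω : ℂ) ^ 2 → ∀ s, eom ω g s * Complex.exp (c * s) =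
      deriv (mulExp c (derivCc g - c • g)) s := by
    intro c hc s
    have h := DFunLike.congr_fun (derivCc_mulExp c (derivCc g - c • g)) s
    refine Eq.trans ?_ h.symm
    simp only [IsAddApply.add_apply, IsSMulApply.smul_apply, mulExp_apply, map_sub, map_smul,
      IsSubApply.sub_apply, smul_eq_mul, eom_apply]
    linear_combination (g s * Complex.exp (c * s)) * hc
  have h1 : (Complex.I * ω) ^ 2 = -(ω : ℂ) ^ 2 := by rw [mul_pow, Complex.I_sq]; ring
  have h2 : (-Complex.I * ω) ^ 2 = -(ω : ℂ) ^ 2 := by rw [mul_pow, neg_sq, Complex.I_sq]; ring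
  have hsm : ∀ f : Cc I, ContDiff ℝ 1 f := fun f => f.contDiff.of_le (by exact_mod_cast le_top)
  rw [feynman_eq]
  simp only [key _ h1, key _ h2]
  rw [HasCompactSupport.integral_Iic_deriv_eq (hsm _) (TestFunction.hasCompactSupport _),
    HasCompactSupport.integral_Ioi_deriv_eq (hsm _) (TestFunction.hasCompactSupport _)]
  simp only [mulExp_apply, IsSubApply.sub_apply, IsSMulApply.smul_apply, smul_eq_mul]
  have he : Complex.exp (-Complex.I * ω * t) * Complex.exp (Complex.I * ω * t) = 1 := by
    rw [← Complex.exp_add]; simp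
  generalize Complex.exp (-Complex.I * ω * t) = E₁ at he ⊢
  generalize Complex.exp (Complex.I * ω * t) = E₂ at he ⊢
  field_simp
  linear_combination (-2 * Complex.I ^ 2 * ω * g t) * he - 2 * ω * g t * Complex.I_sq

/-! ### The Wick contraction -/

theorem wickForm_apply (ω ℏ : ℝ) (f g : Cc I) :
    wickForm ω ℏ f g = Complex.I * ℏ * ∫ t, f t * feynman ω g t := rfl

theorem pairing_apply (f g : Cc I) : pairing f g = ∫ t, f t * g t := rfl

/-- The link between `C` and `Δ`: through it conjugation by `e^{-C}` removes `Δ` from the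
differential. -/
theorem wickForm_eom {ω : ℝ} (hω : ω ≠ 0) (ℏ : ℝ) (f g : Cc I) :
    wickForm ω ℏ f (eom ω g) = Complex.I * ℏ * pairing f g := by
  simp only [wickForm_apply, feynman_eom hω, pairing_apply]

/-- The kernel depends only on `|t - s|`; Fubini applies because the integrand is continuous with
compact support. -/
theorem wickForm_comm (ω ℏ : ℝ) (f g : Cc I) : wickForm ω ℏ f g = wickForm ω ℏ g f := by
  have h : ∀ f g : Cc I, ∫ t, f t * feynman ω g t = Complex.I / (2 * ω) *
      ∫ t, ∫ s, f t * (Complex.exp (-Complex.I * ω * (|t - s| : ℝ)) * g s) := by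
    intro f g
    rw [← MeasureTheory.integral_const_mul]
    refine MeasureTheory.integral_congr_ae (Filter.Eventually.of_forall fun t => ?_)
    simp only [feynman]
    rw [MeasureTheory.integral_const_mul]
    ring
  rw [wickForm_apply, wickForm_apply, h, h,
    MeasureTheory.integral_integral_swap_of_hasCompactSupport]
  · simp only [abs_sub_comm, mul_left_comm, mul_comm]
  · have hk := continuous_kernel ω
    exact (f.continuous.comp continuous_fst).mul (hk.mul (g.continuous.comp continuous_snd))
  · have hcomp : IsCompact (tsupport f ×ˢ tsupport g) :=
      f.hasCompactSupport.isCompact.prod g.hasCompactSupport.isCompact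
    refine HasCompactSupport.intro hcomp fun p hp => ?_
    rw [Set.mem_prod, not_and_or] at hp
    rcases hp with hp | hp
    · simp [Function.uncurry, image_eq_zero_of_notMem_tsupport hp]
    · simp [Function.uncurry, image_eq_zero_of_notMem_tsupport hp]

/-- Both sides are, up to the factor `i`, the symmetric form `wickForm` with `ℏ = 1` on `P f` and `P
g`, so no integration by parts is needed. -/
theorem pairing_eom {ω : ℝ} (hω : ω ≠ 0) (f g : Cc I) :
    pairing (eom ω f) g = pairing (eom ω g) f := by
  have h := wickForm_comm ω 1 (eom ω f) (eom ω g)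
  rw [wickForm_eom hω, wickForm_eom hω] at h
  simpa using h

theorem eom_injective {ω : ℝ} (hω : ω ≠ 0) : Function.Injective (eom ω : Cc I →ₗ[ℂ] Cc I) := by
  intro f g h
  ext t
  rw [← feynman_eom hω f, h, feynman_eom hω]

theorem wickForm_incl (ω ℏ : ℝ) (h : I ≤ J) (f g : Cc I) :
    wickForm ω ℏ (inclCc h f) (inclCc h g) = wickForm ω ℏ f g := rfl

theorem eom_incl (ω : ℝ) (h : I ≤ J) (f : Cc I) :
    eom ω (inclCc h f) = inclCc h (eom ω f) := rfl

theorem apply_eq_zero_of_notMem (f : Cc I) {t : ℝ} (ht : t ∉ I) : f t = 0 :=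
  image_eq_zero_of_notMem_tsupport fun h => ht (f.tsupport_subset h)

theorem pairing_incl_of_disjoint {I₁ I₂ : Opens ℝ} (h : Disjoint I₁ I₂) (h₁ : I₁ ≤ J)
    (h₂ : I₂ ≤ J) (f : Cc I₁) (g : Cc I₂) : pairing (inclCc h₁ f) (inclCc h₂ g) = 0 := by
  have h0 : ∀ t, f t * g t = 0 := by
    intro t
    by_cases ht : t ∈ I₁
    · have ht2 : t ∉ I₂ := fun ht2 => by
        have : t ∈ I₁ ⊓ I₂ := ⟨ht, ht2⟩
        rw [h.eq_bot] at this
        exact this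
      rw [apply_eq_zero_of_notMem g ht2, mul_zero]
    · rw [apply_eq_zero_of_notMem f ht, zero_mul]
  change ∫ t, f t * g t = 0
  simp [h0]

/-- The contraction of a letter with an earlier one. -/
theorem wickForm_incl_of_later (ω ℏ : ℝ) {I₁ I₂ : Opens ℝ} (h : ∀ t ∈ I₂, ∀ s ∈ I₁, t < s)
    (h₁ : I₁ ≤ J) (h₂ : I₂ ≤ J) (f : Cc I₁) (g : Cc I₂) :
    wickForm ω ℏ (inclCc h₁ f) (inclCc h₂ g) =
      -(ℏ / (2 * ω)) * (pairExp (-Complex.I * ω) f * pairExp (Complex.I * ω) g) := by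
  -- For `s < t` the absolute value disappears and the kernel factors as `e^{-iωt} e^{iωs}`.
  have hk : ∀ t, f t * feynman ω g t = Complex.I / (2 * ω) * pairExp (Complex.I * ω) g *
      (f t * Complex.exp (-Complex.I * ω * t)) := by
    intro t
    by_cases ht : t ∈ I₁
    · have h2 : ∫ s, Complex.exp (-Complex.I * ω * (|t - s| : ℝ)) * g s =
          Complex.exp (-Complex.I * ω * t) * ∫ s, g s * Complex.exp (Complex.I * ω * s) := by
        rw [← MeasureTheory.integral_const_mul]
        refine MeasureTheory.integral_congr_ae (Filter.Eventually.of_forall fun s => ?_)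
        by_cases hs : s ∈ I₂
        · have h3 : |t - s| = t - s := abs_of_pos (sub_pos.mpr (h s hs t ht))
          simp only [h3]
          rw [mul_left_comm, ← Complex.exp_add, mul_comm]
          congr 2
          push_cast
          ring
        · simp [apply_eq_zero_of_notMem g hs]
      rw [feynman, h2, pairExp_apply]
      ring
    · simp [apply_eq_zero_of_notMem f ht]
  have h4 : wickForm ω ℏ (inclCc h₁ f) (inclCc h₂ g) =
    Complex.I * ℏ * ∫ t, f t * feynman ω g t := rfl
  rw [h4]
  simp only [hk]
  rw [MeasureTheory.integral_const_mul, ← pairExp_apply]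
  linear_combination (ℏ / (2 * ω) * (pairExp (-Complex.I * ω) f * pairExp (Complex.I * ω) g)) *
    Complex.I_sq

end Analysis

/-! ### Graded vector spaces -/

theorem isInternal_of_projections {M : Type*} [AddCommGroup M] [Module ℂ M]
    (S : ℤ → Submodule ℂ M) (p : ℤ → Module.End ℂ M) (hp : ∀ n, ∀ x ∈ S n, p n x = x)
    (hp' : ∀ m n, m ≠ n → ∀ x ∈ S m, p n x = 0) (htop : ⨆ n, S n = ⊤) :
    DirectSum.IsInternal S := by
  refine (DirectSum.isInternal_submodule_iff_iSupIndep_and_iSup_eq_top S).mpr ⟨fun n => ?_, htop⟩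
  rw [Submodule.disjoint_def]
  intro x hx hx'
  have hle : ⨆ m, ⨆ (_ : m ≠ n), S m ≤ LinearMap.ker (p n) :=
    iSup_le fun m => iSup_le fun hm y hy => hp' m n hm y hy
  rw [← hp n x hx]
  exact hle hx'

/-! ### Letterwise maps of words -/

section WordMap

variable {V W V₁ V₂ : Type*} [AddCommGroup V] [Module ℂ V] [AddCommGroup W] [Module ℂ W]
  [AddCommGroup V₁] [Module ℂ V₁] [AddCommGroup V₂] [Module ℂ V₂]

/-- The algebra map `Sym V → Sym W` induced by a linear map. -/
def symMap (f : V →ₗ[ℂ] W) : SymmetricAlgebra ℂ V →ₐ[ℂ] SymmetricAlgebra ℂ W :=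
  SymmetricAlgebra.lift (SymmetricAlgebra.ι ℂ W ∘ₗ f)

theorem symMap_ι (f : V →ₗ[ℂ] W) (v : V) :
    symMap f (SymmetricAlgebra.ι ℂ V v) = SymmetricAlgebra.ι ℂ W (f v) := by
  simp [symMap]

theorem contract_symMap (f : V →ₗ[ℂ] W) (φ : Module.Dual ℂ W) (s : SymmetricAlgebra ℂ V) :
    contract φ (symMap f s) = symMap f (contract (φ ∘ₗ f) s) :=
  contract_map f φ s

/-- The algebra map of words that applies a linear map to every letter. -/
def wordMap (f : V →ₗ[ℂ] W) : SymmetricAlgebra ℂ V ⊗[ℂ] ExteriorAlgebra ℂ V →ₐ[ℂ]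
    SymmetricAlgebra ℂ W ⊗[ℂ] ExteriorAlgebra ℂ W :=
  Algebra.TensorProduct.map (symMap f) (ExteriorAlgebra.map f)

theorem wordMap_tmul (f : V →ₗ[ℂ] W) (s : SymmetricAlgebra ℂ V) (ω : ExteriorAlgebra ℂ V) :
    wordMap f (s ⊗ₜ ω) = symMap f s ⊗ₜ ExteriorAlgebra.map f ω := rfl

theorem wordMap_oddLetter (f : V →ₗ[ℂ] W) (g : V) :
    wordMap f (oddLetter V V g) = oddLetter W W (f g) := by
  rw [oddLetter_apply, wordMap_tmul, map_one, ExteriorAlgebra.map_apply_ι, oddLetter_apply]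

theorem wordMap_mem_oddDeg (f : V →ₗ[ℂ] W) (k : ℕ) :
    ∀ x ∈ oddDeg V V k, wordMap f x ∈ oddDeg W W k := by
  induction k with
  | zero =>
    intro x hx
    obtain ⟨s, rfl⟩ := mem_oddDeg_zero hx
    rw [wordMap_tmul, map_one]
    refine tmul_mem_oddDeg _ ?_
    rw [exteriorPower_zero]
    exact Submodule.one_le.mp le_rfl
  | succ k ih =>
    refine oddDeg_succ_le (p := (oddDeg W W (k + 1)).comap (wordMap f).toLinearMap)
      fun g x hx => ?_
    rw [Submodule.mem_comap, AlgHom.toLinearMap_apply, map_mul, wordMap_oddLetter]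
    exact oddLetter_mul_mem _ (ih x hx)

theorem wordMap_koszul (f : V →ₗ[ℂ] W)
    {A : V →ₗ[ℂ] SymmetricAlgebra ℂ V →ₗ[ℂ] SymmetricAlgebra ℂ V}
    {B : W →ₗ[ℂ] SymmetricAlgebra ℂ W →ₗ[ℂ] SymmetricAlgebra ℂ W}
    (h : ∀ g s, symMap f (A g s) = B (f g) (symMap f s))
    (x : SymmetricAlgebra ℂ V ⊗[ℂ] ExteriorAlgebra ℂ V) :
    wordMap f (koszul A x) = koszul B (wordMap f x) :=
  map_koszul (symMap f).toLinearMap f h x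

/-- The Leibniz rule for a Koszul operator on the product of words in two kinds of letters that do
not interact. -/
theorem koszul_wordMap_mul (f₁ : V₁ →ₗ[ℂ] V) (f₂ : V₂ →ₗ[ℂ] V)
    (A : V →ₗ[ℂ] SymmetricAlgebra ℂ V →ₗ[ℂ] SymmetricAlgebra ℂ V)
    (h₁ : ∀ g s t, A (f₁ g) (s * symMap f₂ t) = A (f₁ g) s * symMap f₂ t)
    (h₂ : ∀ g s t, A (f₂ g) (symMap f₁ s * t) = symMap f₁ s * A (f₂ g) t)
    (b : SymmetricAlgebra ℂ V₂ ⊗[ℂ] ExteriorAlgebra ℂ V₂) (k : ℕ) :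
    ∀ a ∈ oddDeg V₁ V₁ k, koszul A (wordMap f₁ a * wordMap f₂ b) =
      koszul A (wordMap f₁ a) * wordMap f₂ b +
        ((-1 : ℂ) ^ k) • (wordMap f₁ a * koszul A (wordMap f₂ b)) := by
  induction k with
  | zero =>
    intro a ha
    obtain ⟨s, rfl⟩ := mem_oddDeg_zero ha
    rw [wordMap_tmul, map_one, koszul_tmul_one, zero_mul, zero_add, pow_zero, one_smul]
    induction b using oddLetter_induction with
    | sym t => simp [wordMap_tmul, koszul_tmul_one]
    | add x y hx hy => simp only [map_add, mul_add, hx, hy]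
    | odd_mul g x hx =>
      -- The coefficient of a letter of the second kind passes over the symmetric word of the first
      -- kind.
      have hA : ∀ y : SymmetricAlgebra ℂ V ⊗[ℂ] ExteriorAlgebra ℂ V,
          (A (f₂ g)).rTensor (ExteriorAlgebra ℂ V) ((symMap f₁ s ⊗ₜ 1) * y) =
          (symMap f₁ s ⊗ₜ 1) * (A (f₂ g)).rTensor (ExteriorAlgebra ℂ V) y := by
        intro y
        induction y using TensorProduct.induction_on with
        | zero => simp
        | add x y hx hy => simp only [map_add, mul_add, hx, hy]
        | tmul t η => simp [h₂]
      have hsw : (symMap f₁ s ⊗ₜ[ℂ] (1 : ExteriorAlgebra ℂ V)) * oddLetter V V (f₂ g) =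
          oddLetter V V (f₂ g) * symMap f₁ s ⊗ₜ 1 := by
        simp [oddLetter_apply]
      rw [map_mul (wordMap f₂), wordMap_oddLetter, ← mul_assoc, hsw, mul_assoc, koszul_oddLetter_mul, hx, hA,
        koszul_oddLetter_mul, mul_sub, ← mul_assoc, ← mul_assoc, hsw]
  | succ k ih =>
    intro a ha
    refine sub_eq_zero.mp (oddDeg_succ_le (p := LinearMap.ker
      (koszul A ∘ₗ (LinearMap.mul ℂ _).flip (wordMap f₂ b) ∘ₗ (wordMap f₁).toLinearMap -
      ((LinearMap.mul ℂ _).flip (wordMap f₂ b) ∘ₗ koszul A ∘ₗ (wordMap f₁).toLinearMap +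
        ((-1 : ℂ) ^ (k + 1)) •
          ((LinearMap.mul ℂ _).flip (koszul A (wordMap f₂ b)) ∘ₗ (wordMap f₁).toLinearMap))))
      (fun g x hx => ?_) ha)
    have hA : ∀ y : SymmetricAlgebra ℂ V ⊗[ℂ] ExteriorAlgebra ℂ V,
        (A (f₁ g)).rTensor (ExteriorAlgebra ℂ V) (y * wordMap f₂ b) =
        (A (f₁ g)).rTensor (ExteriorAlgebra ℂ V) y * wordMap f₂ b := by
      intro y
      induction y using TensorProduct.induction_on with
      | zero => simp
      | add x y hx hy => simp only [map_add, add_mul, hx, hy]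
      | tmul s ω =>
        clear ih
        induction b using TensorProduct.induction_on with
        | zero => simp
        | add x y hx hy => simp only [map_add, mul_add, hx, hy]
        | tmul t η => simp [wordMap_tmul, h₁]
    have hneg : ∀ y : SymmetricAlgebra ℂ V ⊗[ℂ] ExteriorAlgebra ℂ V, (-1 : ℂ) • y = -y := by
      refine fun y => eq_neg_of_add_eq_zero_left ?_
      nth_rewrite 2 [← one_smul ℂ y]
      rw [← add_smul, neg_add_cancel, zero_smul]
    refine sub_eq_zero.mpr ?_
    change koszul A (wordMap f₁ (oddLetter V₁ V₁ g * x) * wordMap f₂ b) =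
      koszul A (wordMap f₁ (oddLetter V₁ V₁ g * x)) * wordMap f₂ b +
        ((-1 : ℂ) ^ (k + 1)) •
          (wordMap f₁ (oddLetter V₁ V₁ g * x) * koszul A (wordMap f₂ b))
    rw [map_mul (wordMap f₁), wordMap_oddLetter, mul_assoc, koszul_oddLetter_mul, ih x hx, hA,
      koszul_oddLetter_mul, sub_mul, mul_add, mul_smul_comm, pow_succ', mul_smul, hneg,
      mul_assoc, mul_assoc]
    abel

end WordMap

/-! ### The off-shell prefactorization algebra -/

section BV

variable {I J : Opens ℝ}

theorem obsIncl_eq (h : I ≤ J) : obsIncl h = wordMap (inclCc h) := rfl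

theorem obsIncl_refl (a : Obs I) : obsIncl (le_refl I) a = a := by
  have h1 : symMap (inclCc (le_refl I)) = AlgHom.id ℂ _ := by
    refine SymmetricAlgebra.algHom_ext (LinearMap.ext fun v => ?_)
    exact symMap_ι _ v
  have h2 : ExteriorAlgebra.map (inclCc (le_refl I)) = AlgHom.id ℂ _ := ExteriorAlgebra.map_id
  rw [obsIncl_eq, wordMap, h1, h2, Algebra.TensorProduct.map_id, AlgHom.id_apply]

theorem obsIncl_obsIncl {K : Opens ℝ} (h : I ≤ J) (h' : J ≤ K) (a : Obs I) :
    obsIncl h' (obsIncl h a) = obsIncl (h.trans h') a := by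
  have h1 : (symMap (inclCc h')).comp (symMap (inclCc h)) = symMap (inclCc (h.trans h')) := by
    refine SymmetricAlgebra.algHom_ext (LinearMap.ext fun v => ?_)
    change symMap (inclCc h') (symMap (inclCc h) (SymmetricAlgebra.ι ℂ _ v)) =
      symMap (inclCc (h.trans h')) (SymmetricAlgebra.ι ℂ _ v)
    rw [symMap_ι, symMap_ι, symMap_ι]
    rfl
  have h2 : (ExteriorAlgebra.map (inclCc h')).comp (ExteriorAlgebra.map (inclCc h)) =
      ExteriorAlgebra.map (inclCc (h.trans h')) := ExteriorAlgebra.map_comp_map _ _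
  simp only [obsIncl_eq]
  induction a using TensorProduct.induction_on with
  | zero => simp
  | add x y hx hy => simp only [map_add, hx, hy]
  | tmul s ω => rw [wordMap_tmul, wordMap_tmul, wordMap_tmul, ← h1, ← h2]; rfl

/-- The coefficient operators of the differential `d + Δ`. -/
def bvCoeff (ω ℏ : ℝ) (I : Opens ℝ) :
    Cc I →ₗ[ℂ] SymmetricAlgebra ℂ (Cc I) →ₗ[ℂ] SymmetricAlgebra ℂ (Cc I) :=
  LinearMap.mul ℂ (SymmetricAlgebra ℂ (Cc I)) ∘ₗ SymmetricAlgebra.ι ℂ (Cc I) ∘ₗ eom ω +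
    (Complex.I * ℏ) • (contract ∘ₗ pairing.flip)

theorem bvCoeff_apply (ω ℏ : ℝ) (g : Cc I) (s : SymmetricAlgebra ℂ (Cc I)) :
    bvCoeff ω ℏ I g s = SymmetricAlgebra.ι ℂ (Cc I) (eom ω g) * s +
      (Complex.I * ℏ) • contract (pairing.flip g) s := rfl

/-- Both `d` and `Δ` consume exactly one letter of degree `-1`, so their sum is a single Koszul
operator and the general facts on `koszul` apply to it. -/
theorem obsQ_d (ω ℏ : ℝ) (I : Opens ℝ) : (obsQ ω ℏ I).d = koszul (bvCoeff ω ℏ I) := by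
  rw [bvCoeff, koszul_add, koszul_smul]
  rfl

/-- Multiplications commute with each other, and so do contractions. The cross terms are the scalars
`iℏ⟨P g', g⟩` and `iℏ⟨P g, g'⟩`, which agree because `P` is symmetric. -/
theorem bvCoeff_comm {ω : ℝ} (hω : ω ≠ 0) (ℏ : ℝ) (g g' : Cc I) (s : SymmetricAlgebra ℂ (Cc I)) :
    bvCoeff ω ℏ I g (bvCoeff ω ℏ I g' s) = bvCoeff ω ℏ I g' (bvCoeff ω ℏ I g s) := by
  simp only [bvCoeff_apply, map_add, map_smul, contract_ι_mul, smul_add,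
    LinearMap.flip_apply, pairing_eom hω g' g, contract_comm (pairing.flip g) (pairing.flip g')]
  rw [mul_left_comm]
  abel

theorem obsDeg_neg (I : Opens ℝ) (k : ℕ) : obsDeg I (-(k : ℤ)) = oddDeg (Cc I) (Cc I) k := by
  rw [obsDeg, if_pos (by simp), Int.natAbs_neg, Int.natAbs_natCast]
  rfl

theorem obsDeg_of_pos (I : Opens ℝ) {n : ℤ} (hn : 0 < n) : obsDeg I n = ⊥ := by
  rw [obsDeg, if_neg (by lia)]

theorem obsDeg_cases {n : ℤ} {x : Obs I} (hx : x ∈ obsDeg I n) :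
    x = 0 ∨ ∃ k : ℕ, n = -k ∧ x ∈ oddDeg (Cc I) (Cc I) k := by
  rcases lt_or_ge 0 n with h | h
  · rw [obsDeg_of_pos I h] at hx
    exact Or.inl hx
  · obtain ⟨k, hk⟩ := Int.exists_eq_neg_ofNat h
    refine Or.inr ⟨k, hk, ?_⟩
    rwa [hk, obsDeg_neg] at hx

theorem obsQ_isComplex {ω : ℝ} (hω : ω ≠ 0) (ℏ : ℝ) (I : Opens ℝ) : (obsQ ω ℏ I).IsComplex where
  internal := by
    refine isInternal_of_projections (obsDeg I)
      (fun n => if n ≤ 0 then oddProj (Cc I) (Cc I) n.natAbs else 0) ?_ ?_ ?_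
    · intro n x hx
      rcases obsDeg_cases hx with rfl | ⟨k, rfl, hk⟩
      · simp
      · simp [oddProj_of_mem hk]
    · intro m n hmn x hx
      rcases obsDeg_cases hx with rfl | ⟨k, rfl, hk⟩
      · simp
      · split_ifs with hn
        · exact oddProj_of_mem_ne (by lia) hk
        · rfl
    · refine eq_top_iff.mpr ((iSup_oddDeg (V := Cc I) (V' := Cc I)).ge.trans (iSup_le fun k => ?_))
      rw [← obsDeg_neg]
      exact le_iSup (obsDeg I) _
  d_mem n x hx := by
    rw [obsQ_d]
    change koszul (bvCoeff ω ℏ I) x ∈ obsDeg I (n + 1)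
    rcases obsDeg_cases hx with h0 | ⟨k, rfl, hk⟩
    · rw [h0, map_zero]; exact zero_mem _
    · cases k with
      | zero => rw [koszul_eq_zero_of_mem _ hk]; exact zero_mem _
      | succ k =>
        rw [show -((k + 1 : ℕ) : ℤ) + 1 = -(k : ℤ) by push_cast; ring, obsDeg_neg]
        exact koszul_mem_oddDeg _ k x hk
  d_d x := by
    rw [obsQ_d]
    exact koszul_koszul _ (bvCoeff_comm hω ℏ) x

theorem symMap_bvCoeff (ω ℏ : ℝ) (h : I ≤ J) (g : Cc I) (s : SymmetricAlgebra ℂ (Cc I)) :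
    symMap (inclCc h) (bvCoeff ω ℏ I g s) =
      bvCoeff ω ℏ J (inclCc h g) (symMap (inclCc h) s) := by
  rw [bvCoeff_apply, bvCoeff_apply, map_add, map_mul, map_smul, symMap_ι, eom_incl,
    contract_symMap]
  rfl

theorem obsIncl_isChainMap (ω ℏ : ℝ) (h : I ≤ J) :
    DGSpace.IsChainMap (E := obsQ ω ℏ I) (F := obsQ ω ℏ J) (obsIncl h).toLinearMap where
  map_mem n x hx := by
    change obsIncl h x ∈ obsDeg J n
    rcases obsDeg_cases hx with h0 | ⟨k, rfl, hk⟩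
    · rw [h0, map_zero]; exact zero_mem _
    · rw [obsDeg_neg]
      exact wordMap_mem_oddDeg _ k x hk
  map_d x := by
    rw [obsQ_d, obsQ_d]
    exact wordMap_koszul _ (symMap_bvCoeff ω ℏ h) x

/-- Contraction is a derivation, and it annihilates words whose letters have support disjoint from
that of `g`. This locality turns the second-order operator `Δ` into a derivation on the structure
products. -/
theorem bvCoeff_mul (ω ℏ : ℝ) {I₁ I₂ : Opens ℝ} (hd : Disjoint I₁ I₂) (h₁ : I₁ ≤ J) (h₂ : I₂ ≤ J)
    (g : Cc I₁) (s : SymmetricAlgebra ℂ (Cc J)) (t : SymmetricAlgebra ℂ (Cc I₂)) :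
    bvCoeff ω ℏ J (inclCc h₁ g) (s * symMap (inclCc h₂) t) =
      bvCoeff ω ℏ J (inclCc h₁ g) s * symMap (inclCc h₂) t := by
  have h0 : pairing.flip (inclCc h₁ g) ∘ₗ inclCc h₂ = (0 : Cc I₂ →ₗ[ℂ] ℂ) := by
    refine LinearMap.ext fun f => ?_
    exact pairing_incl_of_disjoint hd.symm h₂ h₁ f g
  rw [bvCoeff_apply, bvCoeff_apply, contract_mul, contract_symMap, h0, map_zero,
    LinearMap.zero_apply, map_zero, mul_zero, zero_add, add_mul, mul_assoc, smul_mul_assoc,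
    mul_comm (symMap _ t) (contract _ s)]

theorem neg_one_zpow_neg (k : ℕ) : (-1 : ℂ) ^ (-(k : ℤ)) = (-1) ^ k := by
  rw [zpow_neg, zpow_natCast, ← inv_pow]
  norm_num

theorem koszul_obsIncl_mul (ω ℏ : ℝ) {I₁ I₂ : Opens ℝ} (hd : Disjoint I₁ I₂) (h₁ : I₁ ≤ J)
    (h₂ : I₂ ≤ J) {p : ℤ} {a : Obs I₁} (ha : a ∈ obsDeg I₁ p) (b : Obs I₂) :
    koszul (bvCoeff ω ℏ J) (obsIncl h₁ a * obsIncl h₂ b) =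
      obsIncl h₁ (koszul (bvCoeff ω ℏ I₁) a) * obsIncl h₂ b +
        ((-1 : ℂ) ^ p) • (obsIncl h₁ a * obsIncl h₂ (koszul (bvCoeff ω ℏ I₂) b)) := by
  rw [obsIncl_eq, obsIncl_eq, wordMap_koszul _ (symMap_bvCoeff ω ℏ h₁),
    wordMap_koszul _ (symMap_bvCoeff ω ℏ h₂)]
  rcases obsDeg_cases ha with h0 | ⟨j, rfl, hj⟩
  · simp [h0]
  rw [neg_one_zpow_neg]
  refine koszul_wordMap_mul _ _ _ (fun g s t => bvCoeff_mul ω ℏ hd h₁ h₂ g s t)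
    (fun g s t => ?_) b j a hj
  rw [mul_comm, bvCoeff_mul ω ℏ hd.symm h₂ h₁, mul_comm]

theorem bv_isPrefactorizationAlgebra {ω : ℝ} (hω : ω ≠ 0) (ℏ : ℝ) :
    IsPrefactorizationAlgebra (bvFactorization ω ℏ) where
  isComplex U := obsQ_isComplex hω ℏ U.1
  incl_isChainMap h := obsIncl_isChainMap ω ℏ h
  prod_mem {U₁ U₂ V} _ h₁ h₂ p q a ha b hb := by
    change obsIncl h₁ a * obsIncl h₂ b ∈ obsDeg V.1 (p + q)
    rcases obsDeg_cases ha with h0 | ⟨j, rfl, hj⟩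
    · rw [h0, map_zero, zero_mul]; exact zero_mem _
    rcases obsDeg_cases hb with h0 | ⟨k, rfl, hk⟩
    · rw [h0, map_zero, mul_zero]; exact zero_mem _
    rw [← neg_add, ← Nat.cast_add, obsDeg_neg]
    exact mul_mem_oddDeg (wordMap_mem_oddDeg _ j a hj) (wordMap_mem_oddDeg _ k b hk)
  prod_d {U₁ U₂ V} h h₁ h₂ p a ha b := by
    change (obsQ ω ℏ V.1).d _ = (bvFactorization ω ℏ).prod h h₁ h₂ ((obsQ ω ℏ U₁.1).d a) b +
      ((-1 : ℂ) ^ p) • (bvFactorization ω ℏ).prod h h₁ h₂ a ((obsQ ω ℏ U₂.1).d b)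
    rw [obsQ_d, obsQ_d, obsQ_d]
    exact koszul_obsIncl_mul ω ℏ h h₁ h₂ ha b
  incl_refl V a := obsIncl_refl a
  incl_incl h h' a := obsIncl_obsIncl h h' a
  incl_prod {U₁ U₂ V W} _ h₁ h₂ h' a b := by
    have key : ∀ (a : Obs U₁.1) (b : Obs U₂.1), obsIncl h' (obsIncl h₁ a * obsIncl h₂ b) =
        obsIncl (h₁.trans h') a * obsIncl (h₂.trans h') b := fun a b => by
      rw [map_mul, obsIncl_obsIncl, obsIncl_obsIncl]
    exact key a b
  prod_incl {U₁ U₂ V₁ V₂ W} _ _ h₁ h₂ h₁' h₂' a b := by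
    have key : ∀ (a : Obs U₁.1) (b : Obs U₂.1),
        obsIncl h₁' (obsIncl h₁ a) * obsIncl h₂' (obsIncl h₂ b) =
          obsIncl (h₁.trans h₁') a * obsIncl (h₂.trans h₂') b := fun a b => by
      rw [obsIncl_obsIncl, obsIncl_obsIncl]
    exact key a b
  assoc {U₁ U₂ U₃ V₁ V₂ W} _ _ _ _ u₁ u₂ u₂' u₃ v₁ v₂ w₁ w₃ a b c := by
    have key : ∀ (a : Obs U₁.1) (b : Obs U₂.1) (c : Obs U₃.1),
        obsIncl v₁ (obsIncl u₁ a * obsIncl u₂ b) * obsIncl w₃ c =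
          obsIncl w₁ a * obsIncl v₂ (obsIncl u₂' b * obsIncl u₃ c) := fun a b c => by
      rw [map_mul, map_mul, obsIncl_obsIncl, obsIncl_obsIncl, obsIncl_obsIncl, obsIncl_obsIncl,
        mul_assoc]
    exact key a b c
  comm {U₁ U₂ V} _ h₁ h₂ p q a ha b hb := by
    change obsIncl h₁ a * obsIncl h₂ b =
      ((-1 : ℂ) ^ (p * q)) • (obsIncl h₂ b * obsIncl h₁ a)
    rcases obsDeg_cases ha with h0 | ⟨j, rfl, hj⟩
    · rw [h0]; simp
    rcases obsDeg_cases hb with h0 | ⟨k, rfl, hk⟩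
    · rw [h0]; simp
    rw [neg_mul_neg, ← Nat.cast_mul, zpow_natCast]
    exact mul_comm_of_mem_oddDeg (wordMap_mem_oddDeg _ j a hj) (wordMap_mem_oddDeg _ k b hk)

end BV

/-! ### The normal ordered product -/

section WeylMul

theorem weylMul_apply (x y : Weyl) : weylMul x y =
    LinearMap.mul' ℂ Weyl (locExp weylContraction weylContraction_locallyNilpotent (x ⊗ₜ y)) := rfl

theorem weylMul_one (y : Weyl) : weylMul 1 y = y := by
  rw [weylMul_apply, locExp_of_apply_eq_zero]
  · simp
  · simp [weylContraction]

/-- As `∂l/∂a` is the constant `c`, the commutator of `∂/∂a ⊗ ∂/∂a†` with multiplication by `l ⊗ 1`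
is `c (1 ⊗ ∂/∂a†)`, which commutes with `∂/∂a ⊗ ∂/∂a†`. This is the counterpart for `μ` of the
recursion `projSym_ι_mul`. -/
theorem weylMul_mul {l : Weyl} {c : ℂ} (hl : MvPolynomial.pderiv 0 l = MvPolynomial.C c)
    (x y : Weyl) :
    weylMul (l * x) y = l * weylMul x y + c • weylMul x (MvPolynomial.pderiv 1 y) := by
  set D1 : Module.End ℂ Weyl := (MvPolynomial.pderiv 1).toLinearMap
  have h1 : ∀ z : Weyl ⊗[ℂ] Weyl, weylContraction ((LinearMap.mul ℂ Weyl l).rTensor Weyl z) =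
      (LinearMap.mul ℂ Weyl l).rTensor Weyl (weylContraction z) + (c • D1.lTensor Weyl) z := by
    intro z
    induction z using TensorProduct.induction_on with
    | zero => simp
    | add x y hx hy => simp only [map_add, hx, hy]; abel
    | tmul x y =>
      have h : MvPolynomial.pderiv 0 (l * x) = l * MvPolynomial.pderiv 0 x + c • x := by
        rw [Derivation.leibniz, hl, smul_eq_mul, smul_eq_mul, mul_comm x, MvPolynomial.smul_eq_C_mul]
      change MvPolynomial.pderiv 0 (l * x) ⊗ₜ[ℂ] D1 y =
        (l * MvPolynomial.pderiv 0 x) ⊗ₜ[ℂ] D1 y + c • x ⊗ₜ[ℂ] D1 y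
      rw [h, TensorProduct.add_tmul, TensorProduct.smul_tmul']
  have h2 : ∀ z : Weyl ⊗[ℂ] Weyl, weylContraction (D1.lTensor Weyl z) =
      D1.lTensor Weyl (weylContraction z) := by
    intro z
    induction z using TensorProduct.induction_on with
    | zero => simp
    | add x y hx hy => simp only [map_add, hx, hy]
    | tmul x y => rfl
  have h3 := locExp_commutator weylContraction_locallyNilpotent (c := c • D1.lTensor Weyl) h1
    (fun z => by rw [LinearMap.smul_apply, map_smul, h2, LinearMap.smul_apply]) (x ⊗ₜ y)
  have h4 : ∀ z : Weyl ⊗[ℂ] Weyl, LinearMap.mul' ℂ Weyl ((LinearMap.mul ℂ Weyl l).rTensor Weyl z) =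
      l * LinearMap.mul' ℂ Weyl z := by
    intro z
    induction z using TensorProduct.induction_on with
    | zero => simp
    | add x y hx hy => simp only [map_add, hx, hy, mul_add]
    | tmul x y => simp [mul_assoc]
  have h5 := map_locExp weylContraction_locallyNilpotent weylContraction_locallyNilpotent
    (D1.lTensor Weyl) (fun z => (h2 z).symm) (x ⊗ₜ y)
  rw [LinearMap.rTensor_tmul, LinearMap.mul_apply', LinearMap.smul_apply, h5] at h3
  rw [weylMul_apply, h3, map_add, h4, map_smul]
  rfl

end WeylMul

/-! ### The projection -/

section Projection

variable {I J : Opens ℝ}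

theorem pairWith_sigmaPlus (ω ℏ : ℝ) (f : Cc I) :
    pairWith (sigmaPlus ω ℏ) (continuous_sigmaPlus ω ℏ) f =
      (Real.sqrt (ℏ / (2 * ω)) : ℂ) * pairExp (-Complex.I * ω) f := by
  rw [pairExp_apply, ← MeasureTheory.integral_const_mul]
  simp only [pairWith, LinearMap.coe_mk, AddHom.coe_mk, sigmaPlus, mul_left_comm]

theorem pairWith_sigmaMinus (ω ℏ : ℝ) (f : Cc I) :
    pairWith (sigmaMinus ω ℏ) (continuous_sigmaMinus ω ℏ) f =
      (Real.sqrt (ℏ / (2 * ω)) : ℂ) * pairExp (Complex.I * ω) f := by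
  rw [pairExp_apply, ← MeasureTheory.integral_const_mul]
  simp only [pairWith, LinearMap.coe_mk, AddHom.coe_mk, sigmaMinus, mul_left_comm]

theorem projLin_apply (ω ℏ : ℝ) (f : Cc I) : projLin ω ℏ I f =
    pairWith (sigmaPlus ω ℏ) (continuous_sigmaPlus ω ℏ) f • MvPolynomial.X 0 +
      pairWith (sigmaMinus ω ℏ) (continuous_sigmaMinus ω ℏ) f • MvPolynomial.X 1 := rfl

theorem projLin_incl (ω ℏ : ℝ) (h : I ≤ J) (f : Cc I) :
    projLin ω ℏ J (inclCc h f) = projLin ω ℏ I f := rfl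

theorem projLin_eom (ω ℏ : ℝ) (g : Cc I) : projLin ω ℏ I (eom ω g) = 0 := by
  have h1 : (Complex.I * ω) ^ 2 = -(ω : ℂ) ^ 2 := by rw [mul_pow, Complex.I_sq]; ring
  have h2 : (-Complex.I * ω) ^ 2 = -(ω : ℂ) ^ 2 := by rw [mul_pow, neg_sq, Complex.I_sq]; ring
  rw [projLin_apply, pairWith_sigmaPlus, pairWith_sigmaMinus, pairExp_eom ω h1, pairExp_eom ω h2]
  simp

theorem pderiv_projLin_zero (ω ℏ : ℝ) (f : Cc I) : MvPolynomial.pderiv 0 (projLin ω ℏ I f) =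
    MvPolynomial.C (pairWith (sigmaPlus ω ℏ) (continuous_sigmaPlus ω ℏ) f) := by
  simp [projLin_apply, MvPolynomial.pderiv_X, MvPolynomial.smul_eq_C_mul]

theorem pderiv_projLin_one (ω ℏ : ℝ) (f : Cc I) : MvPolynomial.pderiv 1 (projLin ω ℏ I f) =
    MvPolynomial.C (pairWith (sigmaMinus ω ℏ) (continuous_sigmaMinus ω ℏ) f) := by
  simp [projLin_apply, MvPolynomial.pderiv_X, MvPolynomial.smul_eq_C_mul]

/-! ### Wick's theorem for words of degree `0` -/

/-- The restriction of `Π` to words of degree `0`. -/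
def projSym (ω ℏ : ℝ) (I : Opens ℝ) : SymmetricAlgebra ℂ (Cc I) →ₗ[ℂ] Weyl :=
  (SymmetricAlgebra.lift (projLin ω ℏ I)).toLinearMap ∘ₗ wickExp (-(wickForm ω ℏ))

theorem neg_wickForm_comm (ω ℏ : ℝ) (f g : Cc I) :
    (-(wickForm ω ℏ)) f g = (-(wickForm ω ℏ)) g f := by
  rw [LinearMap.neg_apply, LinearMap.neg_apply, LinearMap.neg_apply, LinearMap.neg_apply,
    wickForm_comm]

theorem projSym_apply (ω ℏ : ℝ) (s : SymmetricAlgebra ℂ (Cc I)) : projSym ω ℏ I s =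
    SymmetricAlgebra.lift (projLin ω ℏ I) (wickExp (-(wickForm ω ℏ)) s) := rfl

theorem proj_eq (ω ℏ : ℝ) (I : Opens ℝ) : proj ω ℏ I =
    (projZero ω ℏ I).toLinearMap ∘ₗ (wickExp (-(wickForm ω ℏ))).rTensor _ := by
  have h : locExp (-(wick ω ℏ I)) (neg_wick_locallyNilpotent ω ℏ I) =
      (wickExp (-(wickForm ω ℏ))).rTensor _ :=
    locExp_neg_rTensor (wickForm ω ℏ) (neg_wick_locallyNilpotent ω ℏ I)
  rw [proj, h]

theorem projZero_tmul (ω ℏ : ℝ) (s : SymmetricAlgebra ℂ (Cc I)) (η : ExteriorAlgebra ℂ (Cc I)) :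
    projZero ω ℏ I (s ⊗ₜ η) =
      ExteriorAlgebra.algebraMapInv η • SymmetricAlgebra.lift (projLin ω ℏ I) s := by
  rw [projZero, Algebra.TensorProduct.lift_tmul, AlgHom.comp_apply, Algebra.ofId_apply, mul_comm,
    Algebra.smul_def]

theorem proj_tmul (ω ℏ : ℝ) (s : SymmetricAlgebra ℂ (Cc I)) (η : ExteriorAlgebra ℂ (Cc I)) :
    proj ω ℏ I (s ⊗ₜ η) = ExteriorAlgebra.algebraMapInv η • projSym ω ℏ I s := by
  rw [proj_eq, LinearMap.comp_apply, LinearMap.rTensor_tmul, AlgHom.toLinearMap_apply,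
    projZero_tmul, projSym_apply]

theorem projSym_one (ω ℏ : ℝ) : projSym ω ℏ I 1 = 1 := by
  rw [projSym_apply, wickExp_one, map_one]

theorem projSym_ι_mul (ω ℏ : ℝ) (f : Cc I) (s : SymmetricAlgebra ℂ (Cc I)) :
    projSym ω ℏ I (SymmetricAlgebra.ι ℂ _ f * s) =
      projLin ω ℏ I f * projSym ω ℏ I s - projSym ω ℏ I (contract (wickForm ω ℏ f) s) := by
  rw [projSym_apply, wickExp_ι_mul (neg_wickForm_comm ω ℏ), map_add, map_mul,
    SymmetricAlgebra.lift_ι_apply, LinearMap.neg_apply, map_neg, LinearMap.neg_apply, map_neg,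
    ← wickExp_contract (neg_wickForm_comm ω ℏ), sub_eq_add_neg]
  rfl

/-- The exponential commutes with contractions, and under `Π₀` contraction with `⟨·, σ₋⟩` is the
chain rule for `∂/∂a†`. -/
theorem pderiv_projSym (ω ℏ : ℝ) (s : SymmetricAlgebra ℂ (Cc I)) :
    MvPolynomial.pderiv 1 (projSym ω ℏ I s) = projSym ω ℏ I
      (contract (pairWith (sigmaMinus ω ℏ) (continuous_sigmaMinus ω ℏ)) s) := by
  rw [projSym_apply, projSym_apply, wickExp_contract (neg_wickForm_comm ω ℏ)]
  induction wickExp (-(wickForm ω ℏ)) s using sym_induction with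
  | one => simp [contract_one]
  | add s t hs ht => simp only [map_add, hs, ht]
  | smul c s hs => rw [map_smul, Derivation.map_smul, hs, map_smul, map_smul]
  | ι_mul f s hs =>
    rw [map_mul, SymmetricAlgebra.lift_ι_apply, Derivation.leibniz, hs, pderiv_projLin_one,
      contract_ι_mul, map_add, map_mul, map_smul, SymmetricAlgebra.lift_ι_apply, smul_eq_mul,
      smul_eq_mul, MvPolynomial.smul_eq_C_mul, mul_comm (MvPolynomial.C _)]

theorem projSym_symMap (ω ℏ : ℝ) (h : I ≤ J) (s : SymmetricAlgebra ℂ (Cc I)) :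
    projSym ω ℏ J (symMap (inclCc h) s) = projSym ω ℏ I s := by
  have h1 := wickExp_map (inclCc h) (neg_wickForm_comm ω ℏ) (neg_wickForm_comm ω ℏ)
    (fun f g => by
      rw [LinearMap.neg_apply, LinearMap.neg_apply, LinearMap.neg_apply, LinearMap.neg_apply,
        wickForm_incl]) s
  have h2 : (SymmetricAlgebra.lift (projLin ω ℏ J)).comp (symMap (inclCc h)) =
      SymmetricAlgebra.lift (projLin ω ℏ I) := by
    refine SymmetricAlgebra.algHom_ext (LinearMap.ext fun f => ?_)
    change SymmetricAlgebra.lift (projLin ω ℏ J) (symMap (inclCc h) (SymmetricAlgebra.ι ℂ _ f)) =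
      SymmetricAlgebra.lift (projLin ω ℏ I) (SymmetricAlgebra.ι ℂ _ f)
    rw [symMap_ι, SymmetricAlgebra.lift_ι_apply, SymmetricAlgebra.lift_ι_apply, projLin_incl]
  rw [projSym_apply, projSym_apply, ← h2, symMap, h1]
  rfl

/-- The letter `P g` is killed by `Π₀`, and its contraction `-C(P g, ·) = -iℏ⟨·, g⟩` with the other
letters cancels the term of `Δ`. -/
theorem projSym_bvCoeff {ω : ℝ} (hω : ω ≠ 0) (ℏ : ℝ) (g : Cc I) (s : SymmetricAlgebra ℂ (Cc I)) :
    projSym ω ℏ I (bvCoeff ω ℏ I g s) = 0 := by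
  have h : wickForm ω ℏ (eom ω g) = (Complex.I * ℏ) • pairing.flip g := by
    refine LinearMap.ext fun f => ?_
    rw [wickForm_comm, wickForm_eom hω]
    rfl
  rw [bvCoeff_apply, map_add, projSym_ι_mul, projLin_eom, zero_mul, zero_sub, h, map_smul,
    LinearMap.smul_apply, neg_add_cancel]

/-- The normalization of `σ₊` and `σ₋` is chosen for this identity: positivity of `ω` and `ℏ` makes
the two square roots multiply to `ℏ / 2ω`. -/
theorem wickForm_incl_comp {ω ℏ : ℝ} (hω : 0 < ω) (hℏ : 0 < ℏ) {I₁ I₂ : Opens ℝ}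
    (h : ∀ t ∈ I₂, ∀ s ∈ I₁, t < s) (h₁ : I₁ ≤ J) (h₂ : I₂ ≤ J) (f : Cc I₁) :
    wickForm ω ℏ (inclCc h₁ f) ∘ₗ inclCc h₂ =
      -(pairWith (sigmaPlus ω ℏ) (continuous_sigmaPlus ω ℏ) f) •
        pairWith (I := I₂) (sigmaMinus ω ℏ) (continuous_sigmaMinus ω ℏ) := by
  refine LinearMap.ext fun g => ?_
  have hsq : (Real.sqrt (ℏ / (2 * ω)) : ℂ) * Real.sqrt (ℏ / (2 * ω)) = ℏ / (2 * ω) := by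
    rw [← Complex.ofReal_mul, Real.mul_self_sqrt (by positivity)]
    push_cast
    rfl
  rw [LinearMap.comp_apply, wickForm_incl_of_later ω ℏ h, LinearMap.smul_apply, pairWith_sigmaPlus,
    pairWith_sigmaMinus, smul_eq_mul]
  linear_combination (pairExp (-Complex.I * ω) f * pairExp (Complex.I * ω) g) * hsq

/-- `Π` takes the product of a word with an earlier one to the normal ordered product. -/
theorem projSym_mul {ω ℏ : ℝ} (hω : 0 < ω) (hℏ : 0 < ℏ) {I₁ I₂ : Opens ℝ}
    (h : ∀ t ∈ I₂, ∀ s ∈ I₁, t < s) (h₁ : I₁ ≤ J) (h₂ : I₂ ≤ J)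
    (s : SymmetricAlgebra ℂ (Cc I₁)) (t : SymmetricAlgebra ℂ (Cc I₂)) :
    projSym ω ℏ J (symMap (inclCc h₁) s * symMap (inclCc h₂) t) =
      weylMul (projSym ω ℏ I₁ s) (projSym ω ℏ I₂ t) := by
  -- Pulling a letter off `s = f x` also produces contractions of `x`, so the hypothesis is needed
  -- for all words of the same filtration degree as `x`, and for all `t`.
  suffices hn : ∀ n : ℕ, ∀ s ∈ symFil (Cc I₁) n, ∀ t : SymmetricAlgebra ℂ (Cc I₂),
      projSym ω ℏ J (symMap (inclCc h₁) s * symMap (inclCc h₂) t) =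
        weylMul (projSym ω ℏ I₁ s) (projSym ω ℏ I₂ t) by
    obtain ⟨n, hs⟩ := exists_mem_symFil s
    exact hn n s hs t
  have hscalar : ∀ (r : ℂ) (t : SymmetricAlgebra ℂ (Cc I₂)),
      projSym ω ℏ J (symMap (inclCc h₁) (algebraMap ℂ _ r) * symMap (inclCc h₂) t) =
        weylMul (projSym ω ℏ I₁ (algebraMap ℂ _ r)) (projSym ω ℏ I₂ t) := by
    intro r t
    rw [AlgHom.commutes, ← Algebra.smul_def, map_smul, projSym_symMap,
      Algebra.algebraMap_eq_smul_one, map_smul, projSym_one, map_smul, LinearMap.smul_apply,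
      weylMul_one]
  intro n
  induction n with
  | zero =>
    intro s hs t
    rw [symFil, pow_zero] at hs
    obtain ⟨r, rfl⟩ := Submodule.mem_one.mp hs
    exact hscalar r t
  | succ n ih =>
    intro s hs
    rw [symFil, pow_succ'] at hs
    induction hs using Submodule.mul_induction_on' with
    | add x _ y _ hx hy =>
      intro t
      simp only [map_add, add_mul, LinearMap.add_apply, hx, hy]
    | mem_mul_mem m hm x hx =>
      intro t
      have hx' : x ∈ symFil (Cc I₁) n := hx
      obtain ⟨a, ha, b, ⟨f, rfl⟩, rfl⟩ := Submodule.mem_sup.mp hm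
      obtain ⟨r, rfl⟩ := Submodule.mem_one.mp ha
      rw [add_mul, map_add, add_mul, map_add, map_add, map_add, LinearMap.add_apply]
      congr 1
      · rw [← Algebra.smul_def, map_smul, smul_mul_assoc, map_smul, ih x hx', map_smul, map_smul,
          LinearMap.smul_apply]
      -- The letter `f` is projected, or contracted inside the later word, or contracted with the
      -- earlier word. The first two cases give `projSym_ι_mul` over `I₁`; the third gives the term
      -- `⟨f, σ₊⟩ ∂/∂a†` of `weylMul_mul`.
      · have hB : wickForm ω ℏ (inclCc h₁ f) ∘ₗ inclCc h₁ = wickForm ω ℏ f :=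
          LinearMap.ext fun g => wickForm_incl ω ℏ h₁ f g
        rw [map_mul (symMap (inclCc h₁)), symMap_ι, mul_assoc, projSym_ι_mul, ih x hx', contract_mul, contract_symMap,
          contract_symMap, hB, wickForm_incl_comp hω hℏ h h₁ h₂, map_add,
          mul_comm (symMap (inclCc h₂) t), ih _ (contract_mem _ n x hx'), ih x hx', projSym_ι_mul,
          projLin_incl, map_sub, LinearMap.sub_apply, weylMul_mul (pderiv_projLin_zero ω ℏ f),
          pderiv_projSym, map_smul, LinearMap.smul_apply, map_smul, map_smul]
        module

/-! ### The projection on all words -/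

theorem algebraMapInv_map (h : I ≤ J) (η : ExteriorAlgebra ℂ (Cc I)) :
    ExteriorAlgebra.algebraMapInv (ExteriorAlgebra.map (inclCc h) η) =
      ExteriorAlgebra.algebraMapInv η := by
  have h2 : (ExteriorAlgebra.algebraMapInv (R := ℂ) (M := Cc J)).comp
      (ExteriorAlgebra.map (inclCc h)) = ExteriorAlgebra.algebraMapInv := by
    ext f
    simp [ExteriorAlgebra.algebraMapInv]
  exact DFunLike.congr_fun h2 η

theorem proj_obsIncl (ω ℏ : ℝ) (h : I ≤ J) (a : Obs I) :
    proj ω ℏ J (obsIncl h a) = proj ω ℏ I a := by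
  induction a using TensorProduct.induction_on with
  | zero => simp
  | add x y hx hy => simp only [map_add, hx, hy]
  | tmul s η =>
    rw [obsIncl_eq, wordMap_tmul, proj_tmul, proj_tmul, projSym_symMap, algebraMapInv_map]

theorem proj_mul_tmul (ω ℏ : ℝ) (s t : SymmetricAlgebra ℂ (Cc I)) (η θ : ExteriorAlgebra ℂ (Cc I)) :
    proj ω ℏ I (s ⊗ₜ η * t ⊗ₜ θ) = (ExteriorAlgebra.algebraMapInv η *
      ExteriorAlgebra.algebraMapInv θ) • projSym ω ℏ I (s * t) := by
  rw [Algebra.TensorProduct.tmul_mul_tmul, proj_tmul, map_mul]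

theorem proj_mul {ω ℏ : ℝ} (hω : 0 < ω) (hℏ : 0 < ℏ) {I₁ I₂ : Opens ℝ}
    (h : ∀ t ∈ I₂, ∀ s ∈ I₁, t < s) (h₁ : I₁ ≤ J) (h₂ : I₂ ≤ J) (a : Obs I₁) (b : Obs I₂) :
    proj ω ℏ J (obsIncl h₁ a * obsIncl h₂ b) = weylMul (proj ω ℏ I₁ a) (proj ω ℏ I₂ b) := by
  induction a using TensorProduct.induction_on with
  | zero => simp
  | add x y hx hy => simp only [map_add, add_mul, LinearMap.add_apply, hx, hy]
  | tmul s η =>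
    induction b using TensorProduct.induction_on with
    | zero => simp
    | add x y hx hy => simp only [map_add, mul_add, hx, hy]
    | tmul t θ =>
      rw [obsIncl_eq, obsIncl_eq, wordMap_tmul, wordMap_tmul, proj_mul_tmul, algebraMapInv_map,
        algebraMapInv_map, projSym_mul hω hℏ h h₁ h₂, proj_tmul, proj_tmul, map_smul, map_smul,
        LinearMap.smul_apply, smul_smul, mul_comm]

/-- Exchanging the factors can cost a sign only on words with letters of degree `-1`, and `Π` kills
those, so no homogeneity is required. -/
theorem proj_mul_flip {ω ℏ : ℝ} (hω : 0 < ω) (hℏ : 0 < ℏ) {I₁ I₂ : Opens ℝ}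
    (h : ∀ t ∈ I₁, ∀ s ∈ I₂, t < s) (h₁ : I₁ ≤ J) (h₂ : I₂ ≤ J) (a : Obs I₁) (b : Obs I₂) :
    proj ω ℏ J (obsIncl h₁ a * obsIncl h₂ b) = weylMul (proj ω ℏ I₂ b) (proj ω ℏ I₁ a) := by
  rw [← proj_mul hω hℏ h h₂ h₁]
  induction a using TensorProduct.induction_on with
  | zero => simp
  | add x y hx hy => simp only [map_add, add_mul, mul_add, hx, hy]
  | tmul s η =>
    induction b using TensorProduct.induction_on with
    | zero => simp
    | add x y hx hy => simp only [map_add, mul_add, add_mul, hx, hy]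
    | tmul t θ =>
      rw [obsIncl_eq, obsIncl_eq, wordMap_tmul, wordMap_tmul, proj_mul_tmul, proj_mul_tmul,
        mul_comm (symMap (inclCc h₂) t), mul_comm (ExteriorAlgebra.algebraMapInv _)]

/-- Of the two terms of `koszul_oddLetter_mul`, one is in the image of a coefficient operator and
the other still contains the letter `g`; each is killed separately. -/
theorem proj_koszul {ω : ℝ} (hω : ω ≠ 0) (ℏ : ℝ) (x : Obs I) :
    proj ω ℏ I (koszul (bvCoeff ω ℏ I) x) = 0 := by
  induction x using oddLetter_induction with
  | sym s => rw [koszul_tmul_one, map_zero]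
  | add x y hx hy => rw [map_add, map_add, hx, hy, add_zero]
  | odd_mul g x _ =>
    have h1 : ∀ x : Obs I, proj ω ℏ I ((bvCoeff ω ℏ I g).rTensor _ x) = 0 := by
      intro x
      induction x using TensorProduct.induction_on with
      | zero => simp
      | add x y hx hy => rw [map_add, map_add, hx, hy, add_zero]
      | tmul s η => rw [LinearMap.rTensor_tmul, proj_tmul, projSym_bvCoeff hω, smul_zero]
    have h2 : ∀ y : Obs I, proj ω ℏ I (oddLetter (Cc I) (Cc I) g * y) = 0 := by
      intro y
      induction y using TensorProduct.induction_on with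
      | zero => simp
      | add x y hx hy => rw [mul_add, map_add, hx, hy, add_zero]
      | tmul s η =>
        rw [oddLetter_mul_tmul, proj_tmul, map_mul]
        simp [ExteriorAlgebra.algebraMapInv]
    rw [koszul_oddLetter_mul, map_sub, h1, h2, sub_zero]

theorem projZero_eq_zero_of_mem (ω ℏ : ℝ) {k : ℕ} {x : Obs I}
    (hx : x ∈ oddDeg (Cc I) (Cc I) (k + 1)) : projZero ω ℏ I x = 0 := by
  refine oddDeg_succ_le (p := LinearMap.ker (projZero ω ℏ I).toLinearMap) (fun g x _ => ?_) hx
  rw [LinearMap.mem_ker, AlgHom.toLinearMap_apply, map_mul, oddLetter_apply, projZero_tmul]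
  simp [ExteriorAlgebra.algebraMapInv]

theorem proj_eq_zero_of_mem (ω ℏ : ℝ) {k : ℕ} {x : Obs I}
    (hx : x ∈ oddDeg (Cc I) (Cc I) (k + 1)) : proj ω ℏ I x = 0 := by
  rw [proj_eq]
  exact projZero_eq_zero_of_mem ω ℏ (rTensor_mem_oddDeg _ hx)

/-! ### A section of the projection and exactness -/

theorem exists_dual_basis {ω ℏ : ℝ} (hω : 0 < ω) (hℏ : 0 < ℏ) (hI : (I : Set ℝ).Nonempty) :
    ∃ u v : Cc I, projLin ω ℏ I u = MvPolynomial.X 0 ∧ projLin ω ℏ I v = MvPolynomial.X 1 := by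
  have hω' : (ω : ℂ) ≠ 0 := Complex.ofReal_ne_zero.mpr hω.ne'
  have hκ : (Real.sqrt (ℏ / (2 * ω)) : ℂ) ≠ 0 :=
    Complex.ofReal_ne_zero.mpr (Real.sqrt_pos.mpr (by positivity)).ne'
  obtain ⟨u, hu, hu'⟩ := exists_pairExp_dual (c := -Complex.I * ω)
    (mul_ne_zero (neg_ne_zero.mpr Complex.I_ne_zero) hω') hI
  obtain ⟨v, hv, hv'⟩ := exists_pairExp_dual (c := Complex.I * ω)
    (mul_ne_zero Complex.I_ne_zero hω') hI
  rw [neg_mul, neg_neg] at hu'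
  rw [← neg_mul] at hv'
  refine ⟨(Real.sqrt (ℏ / (2 * ω)) : ℂ)⁻¹ • u, (Real.sqrt (ℏ / (2 * ω)) : ℂ)⁻¹ • v, ?_, ?_⟩
  · rw [map_smul, projLin_apply, pairWith_sigmaPlus, pairWith_sigmaMinus, hu, hu', mul_one, mul_zero,
      zero_smul, add_zero, smul_smul, inv_mul_cancel₀ hκ, one_smul]
  · rw [map_smul, projLin_apply, pairWith_sigmaPlus, pairWith_sigmaMinus, hv, hv', mul_one, mul_zero,
      zero_smul, zero_add, smul_smul, inv_mul_cancel₀ hκ, one_smul]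

theorem exists_symSection {ω ℏ : ℝ} (hω : 0 < ω) (hℏ : 0 < ℏ) (hI : (I : Set ℝ).Nonempty) :
    ∃ σ : Weyl →ₐ[ℂ] SymmetricAlgebra ℂ (Cc I), ∃ q : Weyl →ₗ[ℂ] Cc I,
      (∀ w, SymmetricAlgebra.lift (projLin ω ℏ I) (σ w) = w) ∧
      (∀ f, σ (projLin ω ℏ I f) = SymmetricAlgebra.ι ℂ _ (q (projLin ω ℏ I f))) ∧
      ∀ f, projLin ω ℏ I (q (projLin ω ℏ I f)) = projLin ω ℏ I f := by
  obtain ⟨u, v, hu, hv⟩ := exists_dual_basis (ω := ω) (ℏ := ℏ) hω hℏ hI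
  let σ : Weyl →ₐ[ℂ] SymmetricAlgebra ℂ (Cc I) := MvPolynomial.aeval
    ![SymmetricAlgebra.ι ℂ _ u, SymmetricAlgebra.ι ℂ _ v]
  -- This reads off the coefficients of `a` and `a†`, so it agrees with `σ` only on linear
  -- polynomials; hence the claims about `q` concern values of `projLin`.
  let q : Weyl →ₗ[ℂ] Cc I :=
    (MvPolynomial.lcoeff ℂ (Finsupp.single 0 1)).smulRight u +
      (MvPolynomial.lcoeff ℂ (Finsupp.single 1 1)).smulRight v
  have hq0 : q (MvPolynomial.X 0) = u := by
    simp [q, MvPolynomial.coeff_X, Finsupp.single_left_inj]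
  have hq1 : q (MvPolynomial.X 1) = v := by
    simp [q, MvPolynomial.coeff_X, Finsupp.single_left_inj]
  have hσ0 : σ (MvPolynomial.X 0) = SymmetricAlgebra.ι ℂ _ u := by simp [σ]
  have hσ1 : σ (MvPolynomial.X 1) = SymmetricAlgebra.ι ℂ _ v := by simp [σ]
  refine ⟨σ, q, fun w => ?_, fun f => ?_, fun f => ?_⟩
  · have h : (SymmetricAlgebra.lift (projLin ω ℏ I)).comp σ = AlgHom.id ℂ Weyl := by
      refine MvPolynomial.algHom_ext fun i => ?_
      rw [AlgHom.comp_apply, AlgHom.id_apply]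
      fin_cases i
      · exact (congrArg _ hσ0).trans ((SymmetricAlgebra.lift_ι_apply _ u).trans hu)
      · exact (congrArg _ hσ1).trans ((SymmetricAlgebra.lift_ι_apply _ v).trans hv)
    exact DFunLike.congr_fun h w
  · rw [projLin_apply]
    simp only [map_add, map_smul, hσ0, hσ1, hq0, hq1]
  · conv_rhs => rw [projLin_apply]
    conv_lhs => rw [projLin_apply ω ℏ f]
    simp only [map_add, map_smul, hq0, hq1, hu, hv]

theorem projSym_surjective {ω ℏ : ℝ} (hω : 0 < ω) (hℏ : 0 < ℏ) (hI : (I : Set ℝ).Nonempty) :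
    Function.Surjective (projSym ω ℏ I) := by
  intro w
  obtain ⟨σ, -, hσ, -⟩ := exists_symSection (ω := ω) (ℏ := ℏ) hω hℏ hI
  refine ⟨wickExp (wickForm ω ℏ) (σ w), ?_⟩
  have h := wickExp_wickExp_neg (neg_wickForm_comm (I := I) ω ℏ) (σ w)
  rw [neg_neg] at h
  rw [projSym_apply, h, hσ]

/-- Precomposing any linear left inverse of `P` with the projection `1 - q ∘ projLin` onto `ker
projLin`, which is the image of `P`, prescribes the complement of that image. -/
theorem exists_eom_leftInverse {ω ℏ : ℝ} (hω : 0 < ω) (hℏ : 0 < ℏ)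
    (hI : _root_.IsConnected (I : Set ℝ)) (q : Weyl →ₗ[ℂ] Cc I)
    (hq : ∀ f, projLin ω ℏ I (q (projLin ω ℏ I f)) = projLin ω ℏ I f) :
    ∃ r : Cc I →ₗ[ℂ] Cc I, (∀ g, r (eom ω g) = g) ∧
      ∀ f, f - eom ω (r f) = q (projLin ω ℏ I f) := by
  have hκ : (Real.sqrt (ℏ / (2 * ω)) : ℂ) ≠ 0 :=
    Complex.ofReal_ne_zero.mpr (Real.sqrt_pos.mpr (by positivity)).ne'
  obtain ⟨r₀, hr₀⟩ := LinearMap.exists_leftInverse_of_injective (eom ω : Cc I →ₗ[ℂ] Cc I)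
    (LinearMap.ker_eq_bot.mpr (eom_injective hω.ne'))
  have hr₀' : ∀ g, r₀ (eom ω g) = g := fun g => LinearMap.congr_fun hr₀ g
  refine ⟨r₀ ∘ₗ (LinearMap.id - q ∘ₗ projLin ω ℏ I), fun g => ?_, fun f => ?_⟩
  · rw [LinearMap.comp_apply, LinearMap.sub_apply, LinearMap.comp_apply, projLin_eom, map_zero,
      sub_zero, LinearMap.id_apply, hr₀']
  · have hker : projLin ω ℏ I (f - q (projLin ω ℏ I f)) = 0 := by rw [map_sub, hq, sub_self]
    have h0 : pairExp (-Complex.I * ω) (f - q (projLin ω ℏ I f)) = 0 := by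
      have h := pderiv_projLin_zero ω ℏ (f - q (projLin ω ℏ I f))
      rw [hker, map_zero, eq_comm, MvPolynomial.C_eq_zero, pairWith_sigmaPlus] at h
      exact (mul_eq_zero.mp h).resolve_left hκ
    have h1 : pairExp (Complex.I * ω) (f - q (projLin ω ℏ I f)) = 0 := by
      have h := pderiv_projLin_one ω ℏ (f - q (projLin ω ℏ I f))
      rw [hker, map_zero, eq_comm, MvPolynomial.C_eq_zero, pairWith_sigmaMinus] at h
      exact (mul_eq_zero.mp h).resolve_left hκ
    obtain ⟨g, hg⟩ := exists_eom_eq hω.ne' hI h0 h1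
    rw [LinearMap.comp_apply, LinearMap.sub_apply, LinearMap.comp_apply, LinearMap.id_apply, ← hg,
      hr₀', hg, sub_sub_cancel]

/-- A cycle that is killed by `Π` is a boundary. -/
theorem exists_koszul_bvCoeff_eq {ω ℏ : ℝ} (hω : 0 < ω) (hℏ : 0 < ℏ)
    (hI : _root_.IsConnected (I : Set ℝ)) {k : ℕ} {x : Obs I} (hx : x ∈ oddDeg (Cc I) (Cc I) k)
    (hdx : koszul (bvCoeff ω ℏ I) x = 0) (hπ : proj ω ℏ I x = 0) :
    ∃ z ∈ oddDeg (Cc I) (Cc I) (k + 1), koszul (bvCoeff ω ℏ I) z = x := by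
  obtain ⟨σ, q, -, hσ, hq⟩ := exists_symSection (ω := ω) (ℏ := ℏ) hω hℏ hI.nonempty
  obtain ⟨r, hr, hr'⟩ := exists_eom_leftInverse hω hℏ hI q hq
  set A : Cc I →ₗ[ℂ] SymmetricAlgebra ℂ (Cc I) →ₗ[ℂ] SymmetricAlgebra ℂ (Cc I) :=
    LinearMap.mul ℂ (SymmetricAlgebra ℂ (Cc I)) ∘ₗ SymmetricAlgebra.ι ℂ (Cc I) ∘ₗ eom ω
  have hA : ∀ g s, A g s = SymmetricAlgebra.ι ℂ (Cc I) (eom ω g) * s := fun _ _ => rfl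
  -- The projection to weight `0` of the Koszul complex. It factors through `Π₀`, so `Π x = 0` makes
  -- it vanish on `e^{-C} x`.
  set ρ : Obs I →ₐ[ℂ] Obs I :=
    (Algebra.TensorProduct.includeLeft.comp σ).comp (projZero ω ℏ I) with hρ
  have hB : ∀ g : Cc I, wickForm ω ℏ (eom ω g) = (Complex.I * ℏ) • pairing.flip g := by
    refine fun g => LinearMap.ext fun f => ?_
    rw [wickForm_comm, wickForm_eom hω.ne']
    rfl
  -- On coefficients this is `e^{-C} (d + Δ) = d e^{-C}`: the shift of multiplication by `P g`
  -- cancels the contraction. A primitive for `d` is carried back by `e^{C}`, using `hE'`.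
  have hE : ∀ g s, wickExp (-(wickForm ω ℏ)) (bvCoeff ω ℏ I g s) =
      A g (wickExp (-(wickForm ω ℏ)) s) := by
    intro g s
    rw [bvCoeff_apply, map_add, wickExp_ι_mul (neg_wickForm_comm ω ℏ), LinearMap.neg_apply, hB,
      map_neg, map_smul, map_smul, wickExp_contract (neg_wickForm_comm ω ℏ), hA]
    simp
  have hEE : ∀ s : SymmetricAlgebra ℂ (Cc I),
      wickExp (-(wickForm ω ℏ)) (wickExp (wickForm ω ℏ) s) = s := by
    intro s
    have h := wickExp_wickExp_neg (neg_wickForm_comm (I := I) ω ℏ) s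
    rwa [neg_neg] at h
  have hE' : ∀ g s, wickExp (wickForm ω ℏ) (A g s) =
      bvCoeff ω ℏ I g (wickExp (wickForm ω ℏ) s) := by
    intro g s
    have h := wickExp_wickExp_neg (wickForm_comm (I := I) ω ℏ)
      (bvCoeff ω ℏ I g (wickExp (wickForm ω ℏ) s))
    rwa [hE, hEE] at h
  obtain ⟨z, hz, hzx⟩ := exists_koszul_eq r (A := A) (eom ω) hA hr ρ
    (fun f => by
      rw [hρ, AlgHom.comp_apply, evenLetter_apply, projZero_tmul, map_one, one_smul,
        SymmetricAlgebra.lift_ι_apply, AlgHom.comp_apply, hσ, hr', evenLetter_apply]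
      rfl)
    (fun g => by
      rw [hρ, AlgHom.comp_apply, oddLetter_apply, projZero_tmul]
      simp [ExteriorAlgebra.algebraMapInv])
    (rTensor_mem_oddDeg (wickExp (-(wickForm ω ℏ))) hx)
    (by rw [← rTensor_koszul (A := bvCoeff ω ℏ I) _ hE, hdx, map_zero])
    (by
      rw [proj_eq] at hπ
      rw [hρ, AlgHom.comp_apply]
      exact (congrArg _ hπ).trans (map_zero _))
  refine ⟨(wickExp (wickForm ω ℏ)).rTensor _ z, rTensor_mem_oddDeg _ hz, ?_⟩
  rw [← rTensor_koszul (A := A) _ hE', hzx, ← LinearMap.comp_apply, ← LinearMap.rTensor_comp]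
  have h : wickExp (wickForm ω ℏ) ∘ₗ wickExp (-(wickForm ω ℏ)) =
      (LinearMap.id : SymmetricAlgebra ℂ (Cc I) →ₗ[ℂ] SymmetricAlgebra ℂ (Cc I)) :=
    LinearMap.ext (wickExp_wickExp_neg (wickForm_comm ω ℏ))
  rw [h, LinearMap.rTensor_id, LinearMap.id_apply]

end Projection

/-! ### Quasi-isomorphisms to a space in degree `0` -/

section QuasiIso

namespace DGSpace

variable {E F : DGSpace}

theorem IsComplex.toCochainComplex_d (hE : E.IsComplex) (n : ℤ) :
    hE.toCochainComplex.d n (n + 1) = ModuleCat.ofHom (E.d.restrict (hE.d_mem n)) :=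
  CochainComplex.of_d (fun n => ModuleCat.of ℂ (E.deg n))
    (fun n => ModuleCat.ofHom (E.d.restrict (hE.d_mem n))) n

theorem IsComplex.toCochainComplex_d_apply (hE : E.IsComplex) (n : ℤ) (x : E.deg n) :
    hE.toCochainComplex.d n (n + 1) x = (⟨E.d x, hE.d_mem n x x.2⟩ : E.deg (n + 1)) := by
  rw [hE.toCochainComplex_d]
  rfl

theorem IsComplex.exactAt (hE : E.IsComplex) (n : ℤ)
    (h : ∀ x ∈ E.deg (n + 1), E.d x = 0 → ∃ z ∈ E.deg n, E.d z = x) :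
    hE.toCochainComplex.ExactAt (n + 1) := by
  rw [HomologicalComplex.exactAt_iff' _ n (n + 1) (n + 1 + 1) (by simp) (by simp),
    ShortComplex.moduleCat_exact_iff]
  intro x hx
  have hx' := (hE.toCochainComplex_d_apply (n + 1) x).symm.trans hx
  obtain ⟨z, hz, hzx⟩ := h x.1 x.2 (congrArg Subtype.val hx')
  exact ⟨(⟨z, hz⟩ : E.deg n), (hE.toCochainComplex_d_apply n _).trans (Subtype.ext hzx)⟩

/-- Surjectivity in degree `0` together with exactness of cycles in the kernel. -/
theorem isQuasiIso_of_degree_zero (hE : E.IsComplex) (hF : F.IsComplex) {R : E →ₗ[ℂ] F}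
    (hR : IsChainMap R) (hFdeg : ∀ n ≠ 0, F.deg n = ⊥) (hE0 : ∀ x ∈ E.deg 0, E.d x = 0)
    (hsurj : ∀ y ∈ F.deg 0, ∃ x ∈ E.deg 0, R x = y)
    (hexact : ∀ n, ∀ x ∈ E.deg (n + 1), E.d x = 0 → R x = 0 → ∃ z ∈ E.deg n, E.d z = x) :
    IsQuasiIso R := by
  have hzero : ∀ n ≠ 0, ∀ y ∈ F.deg n, y = 0 := fun n hn y hy => by
    rw [hFdeg _ hn] at hy; exact hy
  refine ⟨hE, hF, hR, ⟨fun m => ?_⟩⟩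
  obtain ⟨n, rfl⟩ : ∃ n, m = n + 1 := ⟨m - 1, by ring⟩
  by_cases hn : n + 1 = 0
  · have hn1 : n ≠ 0 := by lia
    have hn2 : n + 1 + 1 ≠ 0 := by lia
    -- In degree `0` the differential out of `E` and both differentials of `F` vanish, so the claim
    -- is that `F^0` is the cokernel of `E^{-1} → E^0`.
    rw [quasiIsoAt_iff' _ n (n + 1) (n + 1 + 1) (by simp) (by simp),
      ShortComplex.quasiIso_iff_of_zeros']
    · refine ⟨?_, ?_⟩
      · rw [ShortComplex.moduleCat_exact_iff]
        intro x hx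
        obtain ⟨z, hz, hzx⟩ := hexact n x.1 x.2 (hE0 _ (hn ▸ x.2)) (congrArg Subtype.val hx)
        exact ⟨(⟨z, hz⟩ : E.deg n), (hE.toCochainComplex_d_apply n _).trans (Subtype.ext hzx)⟩
      · rw [ModuleCat.epi_iff_surjective]
        intro y
        obtain ⟨x, hx, hxy⟩ := hsurj y.1 (hn ▸ y.2)
        exact ⟨(⟨x, hn.symm ▸ hx⟩ : E.deg (n + 1)), Subtype.ext hxy⟩
    · refine ModuleCat.hom_ext (LinearMap.ext fun x => ?_)
      exact (hE.toCochainComplex_d_apply (n + 1) x).trans (Subtype.ext (hE0 _ (hn ▸ x.2)))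
    · refine ModuleCat.hom_ext (LinearMap.ext fun x => ?_)
      refine (hF.toCochainComplex_d_apply n x).trans (Subtype.ext ?_)
      change F.d x.1 = 0
      rw [hzero n hn1 x.1 x.2, map_zero]
    · refine ModuleCat.hom_ext (LinearMap.ext fun x => ?_)
      exact (hF.toCochainComplex_d_apply (n + 1) x).trans
        (Subtype.ext (hzero _ hn2 _ (hF.d_mem _ _ x.2)))
  -- In other degrees `F` is zero, and what remains is exactness of `E`; the condition `R x = 0` is
  -- then automatic.
  · have hFex : hF.toCochainComplex.ExactAt (n + 1) := hF.exactAt n fun x hx _ =>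
      ⟨0, zero_mem _, by rw [map_zero, hzero _ hn x hx]⟩
    rw [quasiIsoAt_iff_exactAt' _ _ hFex]
    exact hE.exactAt n fun x hx hdx => hexact n x hx hdx (hzero _ hn _ (hR.map_mem _ x hx))

end DGSpace

end QuasiIso

/-! ### The prefactorization algebra of the Weyl algebra -/

section Main

/-- If both orders fail, two pairs of points witness it, and order convexity of one of the intervals
then produces a common point. -/
theorem earlier_or_earlier {U₁ U₂ : ConnectedOpens ℝ} (h : Disjoint U₁.1 U₂.1) :
    Earlier U₁ U₂ ∨ Earlier U₂ U₁ := by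
  have hd : ∀ t, t ∈ U₁.1 → t ∈ U₂.1 → False := fun t h₁ h₂ => by
    have : t ∈ U₁.1 ⊓ U₂.1 := ⟨h₁, h₂⟩
    rw [h.eq_bot] at this
    exact this
  have c₁ := U₁.2.isPreconnected.ordConnected
  have c₂ := U₂.2.isPreconnected.ordConnected
  by_contra hn
  rw [not_or] at hn
  obtain ⟨h1, h2⟩ := hn
  simp only [Earlier, not_forall, not_lt] at h1 h2
  obtain ⟨t, ht, s, hs, hst⟩ := h1
  obtain ⟨a, ha, b, hb, hba⟩ := h2
  rcases le_or_gt b s with hbs | hsb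
  · exact hd s (c₁.out hb ht ⟨hbs, hst⟩) hs
  · exact hd b hb (c₂.out hs ha ⟨hsb.le, hba⟩)

theorem not_earlier_of_earlier {U₁ U₂ : ConnectedOpens ℝ} (h : Earlier U₁ U₂) :
    ¬Earlier U₂ U₁ := by
  obtain ⟨t, ht⟩ := U₁.2.nonempty
  obtain ⟨s, hs⟩ := U₂.2.nonempty
  exact fun h' => lt_asymm (h t ht s hs) (h' s hs t ht)

open Classical in
/-- The product of the Weyl algebra in time order. -/
def timeOrderedMul (U₁ U₂ : ConnectedOpens ℝ) : Weyl →ₗ[ℂ] Weyl →ₗ[ℂ] Weyl :=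
  if Earlier U₁ U₂ then weylMul.flip else weylMul

theorem timeOrderedMul_of_earlier {U₁ U₂ : ConnectedOpens ℝ} (h : Earlier U₁ U₂) (a b : Weyl) :
    timeOrderedMul U₁ U₂ a b = weylMul b a := by
  rw [timeOrderedMul, if_pos h, LinearMap.flip_apply]

theorem timeOrderedMul_of_later {U₁ U₂ : ConnectedOpens ℝ} (h : Earlier U₂ U₁) (a b : Weyl) :
    timeOrderedMul U₁ U₂ a b = weylMul a b := by
  rw [timeOrderedMul, if_neg (not_earlier_of_earlier h)]

theorem timeOrderedMul_comm {U₁ U₂ : ConnectedOpens ℝ} (h : Disjoint U₁.1 U₂.1) (a b : Weyl) :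
    timeOrderedMul U₁ U₂ a b = timeOrderedMul U₂ U₁ b a := by
  rcases earlier_or_earlier h with he | he
  · rw [timeOrderedMul_of_earlier he, timeOrderedMul_of_later he]
  · rw [timeOrderedMul_of_later he, timeOrderedMul_of_earlier he]

theorem timeOrderedMul_mono {U₁ U₂ V₁ V₂ : ConnectedOpens ℝ} (h : Disjoint V₁.1 V₂.1)
    (h₁ : U₁ ≤ V₁) (h₂ : U₂ ≤ V₂) (a b : Weyl) :
    timeOrderedMul V₁ V₂ a b = timeOrderedMul U₁ U₂ a b := by
  rcases earlier_or_earlier h with he | he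
  · have he' : Earlier U₁ U₂ := fun t ht s hs => he t (h₁ ht) s (h₂ hs)
    rw [timeOrderedMul_of_earlier he, timeOrderedMul_of_earlier he']
  · have he' : Earlier U₂ U₁ := fun t ht s hs => he t (h₂ ht) s (h₁ hs)
    rw [timeOrderedMul_of_later he, timeOrderedMul_of_later he']

theorem proj_prod {ω ℏ : ℝ} (hω : 0 < ω) (hℏ : 0 < ℏ) {U₁ U₂ V : ConnectedOpens ℝ}
    (h : Disjoint U₁.1 U₂.1) (h₁ : U₁ ≤ V) (h₂ : U₂ ≤ V) (a : Obs U₁.1) (b : Obs U₂.1) :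
    proj ω ℏ V.1 (obsIncl h₁ a * obsIncl h₂ b) =
      timeOrderedMul U₁ U₂ (proj ω ℏ U₁.1 a) (proj ω ℏ U₂.1 b) := by
  rcases earlier_or_earlier h with he | he
  · rw [timeOrderedMul_of_earlier he]
    exact proj_mul_flip hω hℏ he h₁ h₂ a b
  · rw [timeOrderedMul_of_later he]
    exact proj_mul hω hℏ he h₁ h₂ a b

theorem exists_proj_eq {ω ℏ : ℝ} (hω : 0 < ω) (hℏ : 0 < ℏ) {I : Opens ℝ}
    (hI : (I : Set ℝ).Nonempty) (w : Weyl) :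
    ∃ a : Obs I, a ∈ oddDeg (Cc I) (Cc I) 0 ∧ proj ω ℏ I a = w := by
  obtain ⟨s, rfl⟩ := projSym_surjective (ω := ω) (ℏ := ℏ) hω hℏ hI w
  refine ⟨s ⊗ₜ 1, tmul_mem_oddDeg s ?_, by rw [proj_tmul, map_one, one_smul]⟩
  rw [exteriorPower_zero]
  exact Submodule.one_le.mp le_rfl

/-- The grading of `ℂ[a, a†]` concentrated in degree `0`. -/
def weylDeg (n : ℤ) : Submodule ℂ Weyl := if n = 0 then ⊤ else ⊥

theorem weylDeg_zero : weylDeg 0 = ⊤ := if_pos rfl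

theorem eq_zero_of_mem_weylDeg {n : ℤ} (hn : n ≠ 0) {x : Weyl} (hx : x ∈ weylDeg n) : x = 0 := by
  rwa [weylDeg, if_neg hn] at hx

theorem weylDeg_isInternal : DirectSum.IsInternal weylDeg := by
  refine isInternal_of_projections _ (fun n => if n = 0 then 1 else 0) ?_ ?_ ?_
  · intro n x hx
    by_cases hn : n = 0
    · simp [hn]
    · rw [eq_zero_of_mem_weylDeg hn hx, map_zero]
  · intro m n hmn x hx
    by_cases hn : n = 0
    · rw [eq_zero_of_mem_weylDeg (hn ▸ hmn) hx, map_zero]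
    · simp [hn]
  · exact eq_top_iff.mpr (weylDeg_zero.ge.trans (le_iSup weylDeg 0))

theorem weylSpace_isComplex : weylSpace.IsComplex where
  internal := weylDeg_isInternal
  d_mem _ _ _ := zero_mem _
  d_d _ := rfl

theorem proj_isChainMap {ω : ℝ} (hω : ω ≠ 0) (ℏ : ℝ) (I : Opens ℝ) :
    DGSpace.IsChainMap (E := obsQ ω ℏ I) (F := weylSpace) (proj ω ℏ I) where
  map_mem n x hx := by
    change proj ω ℏ I x ∈ weylDeg n
    rcases obsDeg_cases hx with h0 | ⟨k, rfl, hk⟩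
    · rw [h0, map_zero]; exact zero_mem _
    · cases k with
      | zero =>
        rw [show -((0 : ℕ) : ℤ) = 0 from rfl, weylDeg_zero]
        exact Submodule.mem_top
      | succ k => rw [proj_eq_zero_of_mem ω ℏ hk]; exact zero_mem _
  map_d x := by
    rw [obsQ_d]
    exact proj_koszul hω ℏ x

theorem timeOrderedMul_mem (U₁ U₂ : ConnectedOpens ℝ) {p q : ℤ} {a b : Weyl} (ha : a ∈ weylDeg p)
    (hb : b ∈ weylDeg q) : timeOrderedMul U₁ U₂ a b ∈ weylDeg (p + q) := by
  by_cases hp : p = 0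
  · by_cases hq : q = 0
    · rw [hp, hq, add_zero, weylDeg_zero]
      exact Submodule.mem_top
    · rw [eq_zero_of_mem_weylDeg hq hb, map_zero]
      exact zero_mem _
  · rw [eq_zero_of_mem_weylDeg hp ha, map_zero, LinearMap.zero_apply]
    exact zero_mem _

/-- The associativity of the time-ordered product, from that of the product of words. -/
theorem timeOrderedMul_assoc {ω ℏ : ℝ} (hω : 0 < ω) (hℏ : 0 < ℏ)
    {U₁ U₂ U₃ V₁ V₂ W : ConnectedOpens ℝ}
    (h₁₂ : Disjoint U₁.1 U₂.1) (h₂₃ : Disjoint U₂.1 U₃.1)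
    (hV₁ : Disjoint V₁.1 U₃.1) (hV₂ : Disjoint U₁.1 V₂.1)
    (u₁ : U₁ ≤ V₁) (u₂ : U₂ ≤ V₁) (u₂' : U₂ ≤ V₂) (u₃ : U₃ ≤ V₂)
    (v₁ : V₁ ≤ W) (v₂ : V₂ ≤ W) (w₁ : U₁ ≤ W) (w₃ : U₃ ≤ W) (a b c : Weyl) :
    timeOrderedMul V₁ U₃ (timeOrderedMul U₁ U₂ a b) c =
      timeOrderedMul U₁ V₂ a (timeOrderedMul U₂ U₃ b c) := by
  -- The statement does not involve `ω` and `ℏ`; they only serve to lift the polynomials to words,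
  -- where the product is associative.
  obtain ⟨a, -, rfl⟩ := exists_proj_eq hω hℏ U₁.2.nonempty a
  obtain ⟨b, -, rfl⟩ := exists_proj_eq hω hℏ U₂.2.nonempty b
  obtain ⟨c, -, rfl⟩ := exists_proj_eq hω hℏ U₃.2.nonempty c
  rw [← proj_prod hω hℏ h₁₂ u₁ u₂, ← proj_prod hω hℏ hV₁ v₁ w₃, ← proj_prod hω hℏ h₂₃ u₂' u₃,
    ← proj_prod hω hℏ hV₂ w₁ v₂]
  exact congrArg (proj ω ℏ W.1) ((bv_isPrefactorizationAlgebra hω.ne' ℏ).assoc h₁₂ h₂₃ hV₁ hV₂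
    u₁ u₂ u₂' u₃ v₁ v₂ w₁ w₃ a b c)

theorem weyl_isPrefactorizationAlgebra {ω ℏ : ℝ} (hω : 0 < ω) (hℏ : 0 < ℏ) :
    IsPrefactorizationAlgebra weylFactorization where
  isComplex _ := weylSpace_isComplex
  incl_isChainMap _ := ⟨fun _ _ hx => hx, fun _ => rfl⟩
  prod_mem {U₁ U₂ _} _ _ _ _ _ _ ha _ hb := timeOrderedMul_mem U₁ U₂ ha hb
  prod_d {U₁ U₂ _} _ _ _ p a _ b := by
    have key : ∀ a b : Weyl, 0 = timeOrderedMul U₁ U₂ 0 b +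
        ((-1 : ℂ) ^ p) • timeOrderedMul U₁ U₂ a 0 := by simp
    exact key a b
  incl_refl _ _ := rfl
  incl_incl _ _ _ := rfl
  incl_prod _ _ _ _ _ _ := rfl
  prod_incl _ hV h₁ h₂ _ _ a b := timeOrderedMul_mono hV h₁ h₂ a b
  assoc h₁₂ h₂₃ hV₁ hV₂ u₁ u₂ u₂' u₃ v₁ v₂ w₁ w₃ a b c :=
    timeOrderedMul_assoc hω hℏ h₁₂ h₂₃ hV₁ hV₂ u₁ u₂ u₂' u₃ v₁ v₂ w₁ w₃ a b c
  comm {U₁ U₂ _} h _ _ p q a ha b _ := by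
    have key : ∀ a b : Weyl, a ∈ weylDeg p → timeOrderedMul U₁ U₂ a b =
        ((-1 : ℂ) ^ (p * q)) • timeOrderedMul U₂ U₁ b a := by
      intro a b ha
      by_cases hp : p = 0
      · rw [hp, zero_mul, zpow_zero, one_smul, timeOrderedMul_comm h]
      · rw [eq_zero_of_mem_weylDeg hp ha]
        simp
    exact key a b ha

theorem proj_isQuasiIso {ω ℏ : ℝ} (hω : 0 < ω) (hℏ : 0 < ℏ) (U : ConnectedOpens ℝ) :
    DGSpace.IsQuasiIso (E := obsQ ω ℏ U.1) (F := weylSpace) (proj ω ℏ U.1) := by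
  have h0 : obsDeg U.1 0 = oddDeg (Cc U.1) (Cc U.1) 0 := obsDeg_neg U.1 0
  refine DGSpace.isQuasiIso_of_degree_zero (obsQ_isComplex hω.ne' ℏ U.1) weylSpace_isComplex
    (proj_isChainMap hω.ne' ℏ U.1) (fun n hn => if_neg hn) ?_ ?_ ?_
  · intro x hx
    rw [obsQ_d]
    refine koszul_eq_zero_of_mem _ ?_
    rw [← h0]
    exact hx
  · intro y _
    obtain ⟨x, hx, hxy⟩ := exists_proj_eq hω hℏ U.2.nonempty y
    rw [← h0] at hx
    exact ⟨x, hx, hxy⟩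
  · intro n x hx hdx hπ
    rw [obsQ_d] at hdx ⊢
    rcases obsDeg_cases hx with h0 | ⟨k, hk, hxk⟩
    · exact ⟨0, zero_mem _, (map_zero (koszul (bvCoeff ω ℏ U.1))).trans h0.symm⟩
    · obtain ⟨z, hz, hzx⟩ := exists_koszul_bvCoeff_eq hω hℏ U.2 hxk hdx hπ
      -- A cycle of degree `n + 1 = -k` has `k` letters of degree `-1`, and its primitive has one
      -- more.
      have hn : n = -((k + 1 : ℕ) : ℤ) := by push_cast; linarith
      refine ⟨z, ?_, hzx⟩
      change z ∈ obsDeg U.1 n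
      rwa [hn, obsDeg_neg]

end Main

end HarmonicOscillator

end

theorem mainTheorem1 (ω ℏ : ℝ) (hω : 0 < ω) (hℏ : 0 < ℏ) :
    HarmonicOscillator.IsPrefactorizationAlgebra (HarmonicOscillator.bvFactorization ω ℏ) ∧
    HarmonicOscillator.IsPrefactorizationAlgebra HarmonicOscillator.weylFactorization ∧
    HarmonicOscillator.IsQuasiIsomorphism (HarmonicOscillator.bvFactorization ω ℏ)
      HarmonicOscillator.weylFactorization (fun I => HarmonicOscillator.proj ω ℏ I.1) :=
  ⟨HarmonicOscillator.bv_isPrefactorizationAlgebra hω.ne' ℏ,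
    HarmonicOscillator.weyl_isPrefactorizationAlgebra hω hℏ,
    { isChainMap := fun U => HarmonicOscillator.proj_isChainMap hω.ne' ℏ U.1
      map_incl := fun h a => HarmonicOscillator.proj_obsIncl ω ℏ h a
      map_prod := fun h h₁ h₂ a b => HarmonicOscillator.proj_prod hω hℏ h h₁ h₂ a b
      isQuasiIso := fun U => HarmonicOscillator.proj_isQuasiIso hω hℏ U }⟩
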